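/- Let $p>3$ be a prime. For $k\ge 1$ let $H_k^{(r)}=\sum_{j=1}^k j^{-r}$ and $H_k=H_k^{(1)}$; let $q_p(2)=\frac{2^{p-1}-1}{p}$ be the Fermat quotient; let $E_n$ be the Euler numbers, defined by $\frac{2}{e^t+e^{-t}}=\sum_{n\ge 0}E_n\frac{t^n}{n!}$; and let $\Gamma_p:\mathbb{Z}_p\to\mathbb{Z}_p$ be Morita's $p$-adic Gamma function, i.e. the unique continuous function on $\mathbb{Z}_p$ with $\Gamma_p(n)=(-1)^n\prod_{0\le k<n,\ (k,p)=1}k$ for all integers $n>1$. For $a,b\in\mathbb{Q}_p$, write $a\equiv b\pmod{p^2}$ if $a-b\in p^2\mathbb{Z}_p$. Then $$\sum_{k=1}^{p-1}\binom{2k}{k}^3\frac{H_k}{64^k}\equiv\begin{cases}\Gamma_p\left(\frac14\right)^4\left(2q_p(2)-p\,q_p(2)^2\right)&\text{if } p\equiv 1\pmod 4,\\[1mm] -\frac{p}{12}\,\Gamma_p\left(\frac14\right)^4&\text{if } p\equiv 3\pmod 4\end{cases}\pmod{p^2}$$ and $$\sum_{k=1}^{p-1}\binom{2k}{k}^3\frac{H_k^{(2)}}{64^k}\equiv\begin{cases}-\Gamma_p\left(\frac14\right)^4\left(4E_{p-3}-2E_{2p-4}\right)&\text{if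 } p\equiv 1\pmod 4,\\[1mm] -\frac14\,\Gamma_p\left(\frac14\right)^4&\text{if } p\equiv 3\pmod 4\end{cases}\pmod{p^2}.$$ -/

import Mathlib

open Filter Topology

/-- The generalized harmonic number `H_k^{(r)} = ∑_{j=1}^k 1 / j^r`. -/
def genHarmonic (r k : ℕ) : ℚ := ∑ j ∈ Finset.Icc 1 k, 1 / (j : ℚ) ^ r

/-- The Fermat quotient `q_p(a) = (a^(p-1) - 1) / p`. -/
def fermatQuotient (p a : ℕ) : ℚ := ((a : ℚ) ^ (p - 1) - 1) / p

/-- The Euler numbers `1, 0, -1, 0, 5, 0, -61, …`, that is,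
`2 / (e^t + e^(-t)) = ∑ E_n t^n / n!` (see `eulerNumber_generating`), through the recurrence
`∑_{k ≤ n, k ≡ n mod 2} C(n,k) E_k = 0` for `n ≥ 1`. -/
def eulerNumber (n : ℕ) : ℤ :=
  if n = 0 then 1
  else -∑ k : Fin n, if Even (n - (k : ℕ)) then (n.choose k : ℤ) * eulerNumber k else 0
termination_by n
decreasing_by exact k.isLt

theorem eulerNumber_recurrence (n : ℕ) :
    ∑ k ∈ Finset.range (n + 1), (if Even (n - k) then (n.choose k : ℤ) * eulerNumber k else 0)
      = if n = 0 then 1 else 0 := by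
  rw [Finset.sum_range_succ]
  by_cases hn : n = 0
  · subst hn
    have h0 : eulerNumber 0 = 1 := by rw [eulerNumber, if_pos rfl]
    simp [h0]
  · have h : eulerNumber n = -∑ k ∈ Finset.range n,
        (if Even (n - k) then (n.choose k : ℤ) * eulerNumber k else 0) := by
      conv_lhs => rw [eulerNumber]
      rw [if_neg hn, Finset.sum_range]
    simp [hn, h]

/-- The exponential generating function of the Euler numbers is `2 / (e^t + e^(-t))`. -/
theorem eulerNumber_generating :
    PowerSeries.mk (fun n => (eulerNumber n : ℚ) / (n.factorial : ℚ))
      * (PowerSeries.exp ℚ + PowerSeries.evalNegHom (PowerSeries.exp ℚ)) = 2 := by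
  ext n
  have h2 : (2 : PowerSeries ℚ) = PowerSeries.C (2 : ℚ) := (map_ofNat PowerSeries.C 2).symm
  rw [PowerSeries.coeff_mul, Finset.Nat.sum_antidiagonal_eq_sum_range_succ_mk, h2,
    PowerSeries.coeff_C]
  have h := congrArg (fun z : ℤ => (2 * (z : ℚ) / (n.factorial : ℚ))) (eulerNumber_recurrence n)
  simp only [Int.cast_sum, Finset.mul_sum, Finset.sum_div] at h
  have hr : (2 * (((if n = 0 then 1 else 0 : ℤ)) : ℚ) / (n.factorial : ℚ))
      = if n = 0 then 2 else 0 := by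
    split_ifs with h0 <;> simp [h0]
  rw [hr] at h
  rw [← h]
  refine Finset.sum_congr rfl fun k hk => ?_
  have hkn : k ≤ n := Nat.lt_succ_iff.mp (Finset.mem_range.mp hk)
  have hc : (n.choose k : ℚ) = n.factorial / (k.factorial * (n - k).factorial) :=
    Nat.cast_choose ℚ hkn
  have hf : (n.factorial : ℚ) ≠ 0 := by exact_mod_cast n.factorial_ne_zero
  have hf1 : (k.factorial : ℚ) ≠ 0 := by exact_mod_cast k.factorial_ne_zero
  have hf2 : ((n - k).factorial : ℚ) ≠ 0 := by exact_mod_cast (n - k).factorial_ne_zero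
  simp only [PowerSeries.coeff_mk, map_add, PowerSeries.coeff_exp, PowerSeries.evalNegHom,
    PowerSeries.coeff_rescale]
  split_ifs with he
  · simp only [he.neg_one_pow, Int.cast_mul, Int.cast_natCast, hc]
    simp
    field_simp
    ring
  · simp [(Nat.not_even_iff_odd.mp he).neg_one_pow]

/-- The sequence `n ↦ (-1)^n ∏_{0 ≤ k < n, (k,p) = 1} k`. -/
def moritaSeq (p n : ℕ) : ℤ :=
  (-1) ^ n * ∏ k ∈ (Finset.range n).filter (fun k => Nat.Coprime k p), (k : ℤ)

/-- Morita's `p`-adic Gamma function (for odd `p`): the continuous extension of `moritaSeq p`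
to `ℤ_[p]`, i.e. the limit of `moritaSeq p n` as the natural number `n` tends to `x`
`p`-adically. The limit exists, and it is the unique continuous extension: see
`padicGamma_natCast`, `continuous_padicGamma` and `eq_padicGamma`. -/
noncomputable def padicGamma (p : ℕ) [Fact p.Prime] (x : ℤ_[p]) : ℤ_[p] :=
  limUnder (comap (Nat.cast : ℕ → ℤ_[p]) (𝓝 x)) (fun n => (moritaSeq p n : ℤ_[p]))

theorem moritaSeq_succ (p n : ℕ) :
    moritaSeq p (n + 1) = -(if Nat.Coprime n p then (n : ℤ) else 1) * moritaSeq p n := by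
  unfold moritaSeq
  rw [Finset.prod_filter, Finset.prod_filter, Finset.prod_range_succ, pow_succ]
  ring

theorem zmod_prime_pow_prod_units (p k : ℕ) [Fact p.Prime] (hp : p ≠ 2) (hk : k ≠ 0) :
    ∏ x : (ZMod (p ^ k))ˣ, x = -1 := by
  have hpp : p.Prime := Fact.out
  have h1 : 1 < p ^ k := Nat.one_lt_pow hk hpp.one_lt
  have h2p : 2 < p ^ k :=
    lt_of_lt_of_le (lt_of_le_of_ne hpp.two_le (Ne.symm hp)) (Nat.le_self_pow hk p)
  have : Fact (1 < p ^ k) := ⟨h1⟩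
  have : Fact (2 < p ^ k) := ⟨h2p⟩
  have hne : (-1 : (ZMod (p ^ k))ˣ) ≠ 1 := by
    intro h
    have h' := congrArg Units.val h
    rw [Units.val_neg, Units.val_one] at h'
    exact ZMod.neg_one_ne_one h'
  have hsq : ∀ x : (ZMod (p ^ k))ˣ, x⁻¹ = x → x = 1 ∨ x = -1 := by
    intro x hx
    obtain ⟨a, ha⟩ := ZMod.intCast_surjective (x : ZMod (p ^ k))
    have hxx : (x : ZMod (p ^ k)) * x = 1 := by
      have : x * x = 1 := by nth_rewrite 1 [← hx]; simp
      rw [← Units.val_mul, this, Units.val_one]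
    have hd : ((p : ℤ) ^ k) ∣ (a - 1) * (a + 1) := by
      have h0 : (((a - 1) * (a + 1) : ℤ) : ZMod (p ^ k)) = 0 := by
        push_cast
        rw [ha]
        linear_combination hxx
      have := (ZMod.intCast_zmod_eq_zero_iff_dvd _ _).mp h0
      exact_mod_cast this
    have hpi : Prime (p : ℤ) := Nat.prime_iff_prime_int.mp hpp
    have hnot : ¬ ((p : ℤ) ∣ a - 1 ∧ (p : ℤ) ∣ a + 1) := by
      rintro ⟨h1, h2⟩
      have h3 : (p : ℤ) ∣ 2 := by
        have := dvd_sub h2 h1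
        ring_nf at this
        exact this
      have h4 : p ∣ 2 := by exact_mod_cast h3
      exact hp ((Nat.prime_dvd_prime_iff_eq hpp Nat.prime_two).mp h4)
    by_cases h : (p : ℤ) ∣ a - 1
    · have hco : IsCoprime ((p : ℤ) ^ k) (a + 1) :=
        ((hpi.coprime_iff_not_dvd).mpr fun h' => hnot ⟨h, h'⟩).pow_left
      have h5 := hco.dvd_of_dvd_mul_right hd
      left
      ext
      have h6 : ((a - 1 : ℤ) : ZMod (p ^ k)) = 0 :=
        (ZMod.intCast_zmod_eq_zero_iff_dvd _ _).mpr (by exact_mod_cast h5)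
      push_cast at h6
      rw [ha] at h6
      rw [Units.val_one]
      exact sub_eq_zero.mp h6
    · have hco : IsCoprime ((p : ℤ) ^ k) (a - 1) :=
        ((hpi.coprime_iff_not_dvd).mpr h).pow_left
      have h5 := hco.dvd_of_dvd_mul_left hd
      right
      ext
      have h6 : ((a + 1 : ℤ) : ZMod (p ^ k)) = 0 :=
        (ZMod.intCast_zmod_eq_zero_iff_dvd _ _).mpr (by exact_mod_cast h5)
      push_cast at h6
      rw [ha] at h6
      rw [Units.val_neg, Units.val_one]
      exact eq_neg_of_add_eq_zero_left h6
  have hrest : ∏ x ∈ (Finset.univ.erase (1 : (ZMod (p ^ k))ˣ)).erase (-1), x = 1 := by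
    refine Finset.prod_involution (fun x _ => x⁻¹) ?_ ?_ ?_ ?_
    · intro x _
      simp
    · intro x hx _ h
      rcases hsq x h with h | h <;> simp [h] at hx
    · intro x hx
      simp only [Finset.mem_erase, Finset.mem_univ, and_true, ne_eq] at hx ⊢
      refine ⟨fun h => hx.1 ?_, fun h => hx.2 (inv_eq_one.mp h)⟩
      rw [← inv_inv x, h]
      simp
    · intro x _
      simp
  rw [← Finset.mul_prod_erase Finset.univ (fun x => x) (Finset.mem_univ 1),
    ← Finset.mul_prod_erase (Finset.univ.erase 1) (fun x => x)
      (Finset.mem_erase.mpr ⟨hne, Finset.mem_univ (-1)⟩), hrest]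
  simp

theorem moritaSeq_period (p k : ℕ) [Fact p.Prime] (hp : p ≠ 2) (n : ℕ) :
    ((moritaSeq p (n + p ^ k) : ℤ) : ZMod (p ^ k)) = (moritaSeq p n : ℤ) := by
  have hpp : p.Prime := Fact.out
  by_cases hk : k = 0
  · subst hk
    have : Subsingleton (ZMod (p ^ 0)) := by rw [pow_zero]; infer_instance
    exact Subsingleton.elim _ _
  have : NeZero (p ^ k) := ⟨pow_ne_zero k hpp.ne_zero⟩
  induction n with
  | zero =>
    have hodd : Odd (p ^ k) := (hpp.odd_of_ne_two hp).pow
    have hprod : ∏ j ∈ Finset.range (p ^ k),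
        (if Nat.Coprime j p then (j : ZMod (p ^ k)) else 1) = -1 := by
      classical
      have hu := congrArg Units.val (zmod_prime_pow_prod_units p k hp hk)
      rw [Units.coe_prod, Units.val_neg, Units.val_one] at hu
      rw [← hu, ← Finset.prod_filter]
      symm
      refine Finset.prod_bij (fun x _ => (x : ZMod (p ^ k)).val) ?_ ?_ ?_ ?_
      · intro x _
        rw [Finset.mem_filter, Finset.mem_range]
        exact ⟨ZMod.val_lt _, (Nat.coprime_pow_right_iff (Nat.pos_of_ne_zero hk) _ _).mp
          (ZMod.val_coe_unit_coprime x)⟩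
      · intro x _ y _ h
        exact Units.ext (ZMod.val_injective _ h)
      · intro j hj
        rw [Finset.mem_filter, Finset.mem_range] at hj
        refine ⟨ZMod.unitOfCoprime j (hj.2.pow_right k), Finset.mem_univ _, ?_⟩
        rw [ZMod.coe_unitOfCoprime, ZMod.val_natCast, Nat.mod_eq_of_lt hj.1]
      · intro x _
        rw [ZMod.natCast_zmod_val]
    have hL : ((moritaSeq p (p ^ k) : ℤ) : ZMod (p ^ k)) = 1 := by
      unfold moritaSeq
      rw [Finset.prod_filter]
      push_cast
      rw [hprod, hodd.neg_one_pow]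
      ring
    rw [zero_add, hL]
    simp [moritaSeq]
  | succ n ih =>
    have hc : Nat.Coprime (n + p ^ k) p ↔ Nat.Coprime n p := by
      obtain ⟨j, rfl⟩ := Nat.exists_eq_succ_of_ne_zero hk
      rw [pow_succ]
      simp
    rw [show n + 1 + p ^ k = n + p ^ k + 1 by ring, moritaSeq_succ, moritaSeq_succ p n,
      Int.cast_mul, Int.cast_mul, ih]
    congr 1
    simp only [hc]
    split_ifs
    · have h0 : ((p : ZMod (p ^ k))) ^ k = 0 := by exact_mod_cast ZMod.natCast_self (p ^ k)
      push_cast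
      rw [h0]
      ring
    · rfl

theorem moritaSeq_lipschitz (p : ℕ) [Fact p.Prime] (hp : p ≠ 2) (m n : ℕ) :
    ‖(moritaSeq p m : ℤ_[p]) - (moritaSeq p n : ℤ_[p])‖ ≤ ‖(m : ℤ_[p]) - (n : ℤ_[p])‖ := by
  wlog hmn : n ≤ m generalizing m n
  · rw [norm_sub_rev, norm_sub_rev (m : ℤ_[p])]
    exact this n m (le_of_not_ge hmn)
  obtain ⟨d, rfl⟩ := Nat.exists_eq_add_of_le hmn
  by_cases hd : d = 0
  · simp [hd]
  have hd0 : (d : ℤ_[p]) ≠ 0 := by exact_mod_cast hd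
  have hmul : ∀ k j : ℕ, ((moritaSeq p (n + j * p ^ k) : ℤ) : ZMod (p ^ k))
      = (moritaSeq p n : ℤ) := by
    intro k j
    induction j with
    | zero => simp
    | succ j ih => rw [Nat.succ_mul, ← add_assoc, moritaSeq_period p k hp, ih]
  have hsub : ((n + d : ℕ) : ℤ_[p]) - (n : ℤ_[p]) = (d : ℤ_[p]) := by push_cast; ring
  rw [hsub, PadicInt.norm_eq_zpow_neg_valuation hd0]
  set k := (d : ℤ_[p]).valuation with hkdef
  have hdvd : p ^ k ∣ d := by
    have h : ‖((d : ℤ) : ℤ_[p])‖ ≤ (p : ℝ) ^ (-(k : ℤ)) := by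
      rw [Int.cast_natCast]
      exact (PadicInt.norm_eq_zpow_neg_valuation hd0).le
    have := (PadicInt.norm_int_le_pow_iff_dvd (p := p) (k := (d : ℤ)) (n := k)).mp h
    exact_mod_cast this
  obtain ⟨j, hj⟩ := hdvd
  rw [← Int.cast_sub, PadicInt.norm_int_le_pow_iff_dvd]
  have h := hmul k j
  rw [mul_comm j, ← hj] at h
  have h' : ((moritaSeq p (n + d) - moritaSeq p n : ℤ) : ZMod (p ^ k)) = 0 := by
    rw [Int.cast_sub, h, sub_self]
  exact_mod_cast (ZMod.intCast_zmod_eq_zero_iff_dvd _ _).mp h'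

instance comap_natCast_nhds_neBot (p : ℕ) [Fact p.Prime] (x : ℤ_[p]) :
    NeBot (comap (Nat.cast : ℕ → ℤ_[p]) (𝓝 x)) :=
  comap_neBot fun t ht => by
    obtain ⟨_, hy, n, rfl⟩ := mem_closure_iff_nhds.mp (PadicInt.denseRange_natCast x) t ht
    exact ⟨n, hy⟩

/-- The limit that defines `padicGamma` exists. -/
theorem tendsto_padicGamma (p : ℕ) [Fact p.Prime] (hp : p ≠ 2) (x : ℤ_[p]) :
    Tendsto (fun n => (moritaSeq p n : ℤ_[p])) (comap (Nat.cast : ℕ → ℤ_[p]) (𝓝 x))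
      (𝓝 (padicGamma p x)) := by
  refine tendsto_nhds_limUnder (CompleteSpace.complete (f := map _ _) ?_)
  rw [Metric.cauchy_iff]
  refine ⟨inferInstance, fun ε hε => ?_⟩
  refine ⟨(fun n => (moritaSeq p n : ℤ_[p])) ''
    ((Nat.cast : ℕ → ℤ_[p]) ⁻¹' Metric.ball x (ε / 2)),
    image_mem_map (preimage_mem_comap (Metric.ball_mem_nhds x (half_pos hε))), ?_⟩
  rintro _ ⟨m, hm, rfl⟩ _ ⟨n, hn, rfl⟩
  have hm' : dist (m : ℤ_[p]) x < ε / 2 := hm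
  have hn' : dist (n : ℤ_[p]) x < ε / 2 := hn
  calc dist (moritaSeq p m : ℤ_[p]) (moritaSeq p n : ℤ_[p])
      ≤ dist (m : ℤ_[p]) (n : ℤ_[p]) := by
        rw [dist_eq_norm, dist_eq_norm]
        exact moritaSeq_lipschitz p hp m n
    _ ≤ dist (m : ℤ_[p]) x + dist (n : ℤ_[p]) x := dist_triangle_right _ _ _
    _ < ε := by linarith

theorem padicGamma_dist_natCast (p : ℕ) [Fact p.Prime] (hp : p ≠ 2) (x : ℤ_[p]) (n : ℕ) :
    dist (padicGamma p x) (moritaSeq p n : ℤ_[p]) ≤ dist x (n : ℤ_[p]) := by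
  have hc : Tendsto (Nat.cast : ℕ → ℤ_[p]) (comap (Nat.cast : ℕ → ℤ_[p]) (𝓝 x)) (𝓝 x) :=
    tendsto_comap
  refine le_of_tendsto_of_tendsto' ((tendsto_padicGamma p hp x).dist tendsto_const_nhds)
    (hc.dist tendsto_const_nhds) fun m => ?_
  rw [dist_eq_norm, dist_eq_norm]
  exact moritaSeq_lipschitz p hp m n

/-- `padicGamma` extends `moritaSeq`. -/
theorem padicGamma_natCast (p : ℕ) [Fact p.Prime] (hp : p ≠ 2) (n : ℕ) :
    padicGamma p (n : ℤ_[p]) = (moritaSeq p n : ℤ_[p]) :=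
  dist_le_zero.mp ((padicGamma_dist_natCast p hp n n).trans_eq (dist_self _))

theorem continuous_padicGamma (p : ℕ) [Fact p.Prime] (hp : p ≠ 2) :
    Continuous (padicGamma p) := by
  have hL : LipschitzWith 1 (padicGamma p) := by
    refine LipschitzWith.of_dist_le_mul fun x y => ?_
    rw [NNReal.coe_one, one_mul]
    have hc : Tendsto (Nat.cast : ℕ → ℤ_[p]) (comap (Nat.cast : ℕ → ℤ_[p]) (𝓝 y)) (𝓝 y) :=
      tendsto_comap
    exact le_of_tendsto_of_tendsto' (tendsto_const_nhds.dist (tendsto_padicGamma p hp y))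
      (tendsto_const_nhds.dist hc) fun n => padicGamma_dist_natCast p hp x n
  exact hL.continuous

/-- `padicGamma` is the only continuous function that extends `moritaSeq` from `n > 1`. -/
theorem eq_padicGamma (p : ℕ) [Fact p.Prime] (hp : p ≠ 2) (f : ℤ_[p] → ℤ_[p])
    (hf : Continuous f) (h : ∀ n : ℕ, 1 < n → f (n : ℤ_[p]) = (moritaSeq p n : ℤ_[p])) :
    f = padicGamma p := by
  have hshift : (fun x : ℤ_[p] => f (x + 2)) = fun x => padicGamma p (x + 2) := by
    refine PadicInt.denseRange_natCast.equalizer (by fun_prop)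
      ((continuous_padicGamma p hp).comp (by fun_prop)) ?_
    funext n
    have h1 := h (n + 2) (by omega)
    have h2 := padicGamma_natCast p hp (n + 2)
    push_cast at h1 h2
    simp only [Function.comp_apply]
    rw [h1, h2]
  funext x
  have := congrFun hshift (x - 2)
  simpa using this

/-- The `p`-adic integer `1/4`, for a prime `p > 3`. -/
noncomputable def padicQuarter (p : ℕ) [Fact p.Prime] (h3 : 3 < p) : ℤ_[p] :=
  ⟨1 / 4, by
    have hpp : p.Prime := Fact.out
    have h4 : ‖((4 : ℕ) : ℚ_[p])‖ = 1 := by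
      rw [Padic.norm_natCast_eq_one_iff]
      exact (Nat.Coprime.pow_right 2 ((Nat.coprime_primes hpp Nat.prime_two).mpr (by omega)) :
        Nat.Coprime p (2 ^ 2))
    have h4' : ‖(4 : ℚ_[p])‖ = 1 := by exact_mod_cast h4
    rw [norm_div, h4', norm_one, div_one]⟩

/-- The congruence `a ≡ b (mod p^r)` between `p`-adic numbers: `a - b ∈ p^r ℤ_p`. -/
def PadicCongr (p : ℕ) [Fact p.Prime] (r : ℕ) (a b : ℚ_[p]) : Prop :=
  ∃ z : ℤ_[p], a - b = (p : ℚ_[p]) ^ r * (z : ℚ_[p])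

/-! Write `p = 2n + 1`. As `C(2k,k) / 4^k = (1/2)_k / k!`, both sums run over `(1/2)_k^3 / k!^3`
times a harmonic number. The identity `(1/2 + j)^2 - (j - n)(j + n + 1) = p^2 / 4` allows two of the
three factors `(1/2)_k` to be replaced modulo `p^2` by `(-n)_k (n+1)_k`. The sums then terminate at
`k = n` (`binomialSum_congrMod`).

Creative telescoping in steps of two in `n` evaluates three of the four terminating sums exactly.
For `n = 2m` they equal `c^2 H_{2m}` and `c^2 ∑_{j ≤ 2m} (-1)^j / j^2`, where `c = (1/2)_m / m!`.
For `n = 2m + 1` the sum weighted by `H_k^{(2)}` equals `-(m! / (3/2)_m)^2`. Three facts modulo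
`p^2` finish these cases. Splitting Morita's product at `(1 + 3p^2)/4`, which is close to `1/4`,
into blocks of length `p` identifies `c^2` with `-Γ_p(1/4)^4` and `4 (m! / (3/2)_m)^2` with
`Γ_p(1/4)^4` (`centralRatio_sq_congrMod_gamma`, `odd_ratio_sq_congrMod_gamma`). Comparing
second-order expansions of `(p-1)!` and `(1/2)_n` gives `H_n` (`fieldHarmonic_half`). Umbral
calculus for Euler numbers gives the alternating sum (`alternating_inv_sq_congrMod`).

The remaining sum, with weight `H_k` and `n = 2m + 1`, comes from a derivative of Dixon's
well-poised sum with parameters `1/2 + X, n + 1 - X, -n`. At `X = 0` its terms agree modulo `p^2`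
with those wanted, and their logarithmic derivative is `-3 H_k` plus `p` times a correction whose
weighted sum vanishes modulo `p` by the symmetry `k ↦ n - k`. The derivative is taken as a
difference quotient between `X = p^2` and `X = 0`: working modulo `p^4` and dividing by `p^2` leaves
precision `p^2`. In Dixon's product two factors are divisible by `p` at `X = 0`, so the difference
quotient is divisible by `p` and the other factors matter only modulo `p`
(`legendreSum_harmonic_one_odd_congrMod`). -/

/-! ### Terminating hypergeometric sums: recurrences, closed forms, Dixon's theorem -/

section Hypergeometric

variable {K : Type*} [Field K]

/-- The rising factorial `(x)_k = x (x + 1) ⋯ (x + k - 1)`. -/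
def rising (x : K) (k : ℕ) : K := ∏ j ∈ Finset.range k, (x + j)

@[simp] theorem rising_zero (x : K) : rising x 0 = 1 := by simp [rising]

theorem rising_succ (x : K) (k : ℕ) : rising x (k + 1) = rising x k * (x + k) := by
  simp [rising, Finset.prod_range_succ]

theorem mul_rising_add_one (x : K) (k : ℕ) : x * rising (x + 1) k = (x + k) * rising x k := by
  induction k with
  | zero => simp
  | succ k ih =>
    rw [rising_succ, rising_succ, ← mul_assoc, ih]
    push_cast
    ring

theorem rising_neg_natCast_eq_zero {n k : ℕ} (h : n < k) : rising (-(n : K)) k = 0 := by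
  rw [rising, Finset.prod_eq_zero (Finset.mem_range.mpr h)]
  simp

theorem rising_ne_zero {x : K} (hx : ∀ j : ℕ, x + j ≠ 0) (k : ℕ) : rising x k ≠ 0 :=
  Finset.prod_ne_zero_iff.mpr fun j _ => hx j

/-- The generalized harmonic number in a field. -/
def fieldHarmonic (K : Type*) [Field K] (r k : ℕ) : K := ∑ j ∈ Finset.range k, 1 / ((j : K) + 1) ^ r

@[simp] theorem fieldHarmonic_zero (r : ℕ) : fieldHarmonic K r 0 = 0 := by simp [fieldHarmonic]

theorem fieldHarmonic_succ (r k : ℕ) :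
    fieldHarmonic K r (k + 1) = fieldHarmonic K r k + 1 / ((k : K) + 1) ^ r := by
  simp [fieldHarmonic, Finset.sum_range_succ]

/-- The summand of `₃F₂(x, y, 1/2; 1, 1; 1)`. -/
def hyperTerm (x y : K) (k : ℕ) : K :=
  rising x k * rising y k * rising (1 / 2) k / (k.factorial : K) ^ 3

theorem hyperTerm_eq_zero {n k : ℕ} (h : n < k) (y : K) : hyperTerm (-(n : K)) y k = 0 := by
  simp [hyperTerm, rising_neg_natCast_eq_zero h]

/-- Contiguity: raising an upper parameter by one changes the summand by a rational factor. All the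
telescoping certificates below reduce to rational identities through this lemma and its twin. -/
theorem mul_hyperTerm_left (x y : K) (k : ℕ) :
    x * hyperTerm (x + 1) y k = (x + k) * hyperTerm x y k := by
  have := mul_rising_add_one x k
  simp only [hyperTerm]
  linear_combination (rising y k * rising (1 / 2) k / (k.factorial : K) ^ 3) * this

theorem mul_hyperTerm_right (x y : K) (k : ℕ) :
    y * hyperTerm x (y + 1) k = (y + k) * hyperTerm x y k := by
  have := mul_rising_add_one y k
  simp only [hyperTerm]
  linear_combination (rising x k * rising (1 / 2) k / (k.factorial : K) ^ 3) * this

/-- The summand `(-n)_k (n+1)_k (1/2)_k / k!^3`. -/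
def legendreTerm (K : Type*) [Field K] (n k : ℕ) : K := hyperTerm (-(n : K)) (n + 1) k

/-- The summand with upper parameters `-n-2, n+1, 1/2`. -/
def shiftedTerm (K : Type*) [Field K] (n k : ℕ) : K := hyperTerm (-((n + 2 : ℕ) : K)) (n + 1) k

theorem legendreTerm_eq_zero {n k : ℕ} (h : n < k) : legendreTerm K n k = 0 :=
  hyperTerm_eq_zero h _

theorem shiftedTerm_eq_zero {n k : ℕ} (h : n + 2 < k) : shiftedTerm K n k = 0 :=
  hyperTerm_eq_zero h _

/-- `∑_k (-n)_k (n+1)_k (1/2)_k / k!^3 · c_k` -/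
def legendreSum (K : Type*) [Field K] (c : ℕ → K) (n : ℕ) : K :=
  ∑ k ∈ Finset.range (n + 1), legendreTerm K n k * c k

theorem legendreSum_eq (c : ℕ → K) {n N : ℕ} (h : n < N) :
    legendreSum K c n = ∑ k ∈ Finset.range N, legendreTerm K n k * c k := by
  rw [legendreSum]
  refine Finset.sum_subset (Finset.range_mono h) fun k _ hk => ?_
  rw [legendreTerm_eq_zero (by simpa using hk), zero_mul]

/-- The sum `∑_k k² (-n-2)_k (n+1)_k (1/2)_k / k!^3`. -/
def shiftedSum (K : Type*) [Field K] (n : ℕ) : K :=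
  ∑ k ∈ Finset.range (n + 3), (k : K) ^ 2 * shiftedTerm K n k

theorem shiftedSum_eq {n N : ℕ} (h : n + 2 < N) :
    shiftedSum K n = ∑ k ∈ Finset.range N, (k : K) ^ 2 * shiftedTerm K n k := by
  rw [shiftedSum]
  refine Finset.sum_subset (Finset.range_mono h) fun k _ hk => ?_
  rw [shiftedTerm_eq_zero (by simp at hk; omega), mul_zero]

variable [CharZero K]

theorem hyperTerm_succ (x y : K) (k : ℕ) :
    hyperTerm x y (k + 1)
      = hyperTerm x y k * ((x + k) * (y + k) * (1 / 2 + k) / ((k : K) + 1) ^ 3) := by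
  have h : ((k : K) + 1) ≠ 0 := by exact_mod_cast k.succ_ne_zero
  have h' : (k.factorial : K) ≠ 0 := by exact_mod_cast k.factorial_ne_zero
  simp only [hyperTerm, rising_succ, Nat.factorial_succ]
  push_cast
  field_simp

/-- The parameters `-n-2, n+1` are the lower choices among those for `n` and for `n + 2`, so the
summands for both indices are polynomial multiples in `k` of the same `shiftedTerm`. -/
theorem legendreTerm_eq_shiftedTerm (n k : ℕ) :
    legendreTerm K n k
      = ((n : K) + 2 - k) * (n + 1 - k) / ((n + 1) * (n + 2)) * shiftedTerm K n k := by
  have h1 : ((n : K) + 1) ≠ 0 := by exact_mod_cast n.succ_ne_zero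
  have h2 : ((n : K) + 2) ≠ 0 := by exact_mod_cast (n + 1).succ_ne_zero
  have e1 := mul_hyperTerm_left (-(n + 2 : K)) (n + 1) k
  have e2 := mul_hyperTerm_left (-(n + 1 : K)) (n + 1) k
  rw [show -(n + 2 : K) + 1 = -(n + 1) by ring] at e1
  rw [show -(n + 1 : K) + 1 = -n by ring] at e2
  simp only [legendreTerm, shiftedTerm]
  push_cast
  field_simp
  linear_combination (-(n + 2 : K)) * e2 - (n + 1 - k : K) * e1

theorem legendreTerm_add_two (n k : ℕ) :
    legendreTerm K (n + 2) k
      = ((n : K) + 1 + k) * (n + 2 + k) / ((n + 1) * (n + 2)) * shiftedTerm K n k := by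
  have h1 : ((n : K) + 1) ≠ 0 := by exact_mod_cast n.succ_ne_zero
  have h2 : ((n : K) + 2) ≠ 0 := by exact_mod_cast (n + 1).succ_ne_zero
  have e1 := mul_hyperTerm_right (-(n + 2 : K)) (n + 1) k
  have e2 := mul_hyperTerm_right (-(n + 2 : K)) (n + 1 + 1) k
  simp only [legendreTerm, shiftedTerm]
  push_cast
  rw [show (n : K) + 2 + 1 = n + 1 + 1 + 1 by ring]
  field_simp
  linear_combination (n + 1 : K) * e2 + (n + 2 + k : K) * e1

theorem shiftedTerm_succ (n k : ℕ) :
    shiftedTerm K n (k + 1) = shiftedTerm K n k *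
      ((k - n - 2) * (n + 1 + k) * (1 / 2 + k) / ((k : K) + 1) ^ 3) := by
  rw [shiftedTerm, hyperTerm_succ, shiftedTerm]
  push_cast
  ring

/-- The telescoping certificate for the recurrence of the sums of `legendreTerm`. -/
theorem legendreTerm_telescope (n k : ℕ) :
    ((n : K) + 2) ^ 2 * legendreTerm K (n + 2) k - (n + 1) ^ 2 * legendreTerm K n k
      = -2 * (2 * n + 3) / ((n + 1) * (n + 2)) *
        (((k + 1 : ℕ) : K) ^ 3 * shiftedTerm K n (k + 1) - (k : K) ^ 3 * shiftedTerm K n k) := by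
  have h1 : ((n : K) + 1) ≠ 0 := by exact_mod_cast n.succ_ne_zero
  have h2 : ((n : K) + 2) ≠ 0 := by exact_mod_cast (n + 1).succ_ne_zero
  have hk : ((k : K) + 1) ≠ 0 := by exact_mod_cast k.succ_ne_zero
  rw [legendreTerm_add_two, legendreTerm_eq_shiftedTerm, shiftedTerm_succ]
  push_cast
  field_simp
  ring

/-- Both ends of the telescoped sum vanish: at `k = 0` by the factor `k^3`, at `k = n + 3` because
the series has terminated. -/
theorem legendreSum_one_recurrence (n : ℕ) :
    ((n : K) + 2) ^ 2 * legendreSum K 1 (n + 2) = (n + 1) ^ 2 * legendreSum K 1 n := by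
  rw [← sub_eq_zero, legendreSum_eq 1 (show n + 2 < n + 3 by omega),
    legendreSum_eq 1 (show n < n + 3 by omega), Finset.mul_sum, Finset.mul_sum,
    ← Finset.sum_sub_distrib]
  simp only [Pi.one_apply, mul_one, legendreTerm_telescope]
  rw [← Finset.mul_sum, Finset.sum_range_sub (fun k => (k : K) ^ 3 * shiftedTerm K n k),
    shiftedTerm_eq_zero (show n + 2 < n + 3 by omega)]
  simp

/-- Summation by parts: the increment `1/(k+1)^2` meets the factor `(k+1)^3` of the certificate and
leaves a multiple of `(k+1) * shiftedTerm K n (k+1)`. That is exactly the difference of the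
unweighted summands for `n + 2` and `n`, so the inhomogeneous part is already known. -/
theorem legendreSum_harmonic_two_recurrence (n : ℕ) :
    ((n : K) + 2) ^ 2 * legendreSum K (fieldHarmonic K 2) (n + 2)
      - (n + 1) ^ 2 * legendreSum K (fieldHarmonic K 2) n
      = legendreSum K 1 (n + 2) - legendreSum K 1 n := by
  have key : ∀ k : ℕ, ((n : K) + 2) ^ 2 * (legendreTerm K (n + 2) k * fieldHarmonic K 2 k)
      - (n + 1) ^ 2 * (legendreTerm K n k * fieldHarmonic K 2 k)
      - (legendreTerm K (n + 2) k * 1 - legendreTerm K n k * 1)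
      = -2 * (2 * n + 3) / ((n + 1) * (n + 2)) *
        ((((k + 1 : ℕ) : K) ^ 3 * fieldHarmonic K 2 (k + 1) - (k + 1 : ℕ)) *
            shiftedTerm K n (k + 1)
          - ((k : K) ^ 3 * fieldHarmonic K 2 k - k) * shiftedTerm K n k) := by
    intro k
    have h1 : ((n : K) + 1) ≠ 0 := by exact_mod_cast n.succ_ne_zero
    have h2 : ((n : K) + 2) ≠ 0 := by exact_mod_cast (n + 1).succ_ne_zero
    have hk : ((k : K) + 1) ≠ 0 := by exact_mod_cast k.succ_ne_zero
    have e := legendreTerm_telescope (K := K) n k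
    rw [fieldHarmonic_succ]
    have e' : legendreTerm K (n + 2) k - legendreTerm K n k
        = 2 * (2 * n + 3) / ((n + 1) * (n + 2)) * (k * shiftedTerm K n k) := by
      rw [legendreTerm_add_two, legendreTerm_eq_shiftedTerm]
      field_simp
      ring
    -- The `- (k + 1)` in the new certificate cancels the increment of the harmonic number.
    have e'' : (((k + 1 : ℕ) : K) ^ 3 * (fieldHarmonic K 2 k + 1 / ((k : K) + 1) ^ 2)
        - (k + 1 : ℕ)) = ((k + 1 : ℕ) : K) ^ 3 * fieldHarmonic K 2 k := by
      push_cast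
      field_simp
      ring
    rw [e'']
    linear_combination fieldHarmonic K 2 k * e - e'
  rw [← sub_eq_zero, legendreSum_eq _ (show n + 2 < n + 3 by omega),
    legendreSum_eq _ (show n < n + 3 by omega), legendreSum_eq 1 (show n + 2 < n + 3 by omega),
    legendreSum_eq 1 (show n < n + 3 by omega), Finset.mul_sum, Finset.mul_sum,
    ← Finset.sum_sub_distrib, ← Finset.sum_sub_distrib, ← Finset.sum_sub_distrib]
  simp only [Pi.one_apply, key]
  rw [← Finset.mul_sum, Finset.sum_range_sub (fun k => ((k : K) ^ 3 * fieldHarmonic K 2 k - k) *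
    shiftedTerm K n k), shiftedTerm_eq_zero (show n + 2 < n + 3 by omega)]
  simp

/-- Summation by parts again; now the increment `1/(k+1)` leaves a square `(k+1)^2`, which produces
the auxiliary sum `shiftedSum`. -/
theorem legendreSum_harmonic_one_recurrence (n : ℕ) :
    ((n : K) + 2) ^ 2 * legendreSum K (fieldHarmonic K 1) (n + 2)
      - (n + 1) ^ 2 * legendreSum K (fieldHarmonic K 1) n
      = 2 * (2 * n + 3) / ((n + 1) * (n + 2)) * shiftedSum K n := by
  have key : ∀ k : ℕ, ((n : K) + 2) ^ 2 * (legendreTerm K (n + 2) k * fieldHarmonic K 1 k)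
      - (n + 1) ^ 2 * (legendreTerm K n k * fieldHarmonic K 1 k)
      = -2 * (2 * n + 3) / ((n + 1) * (n + 2)) *
        (((k + 1 : ℕ) : K) ^ 3 * fieldHarmonic K 1 (k + 1) * shiftedTerm K n (k + 1)
          - (k : K) ^ 3 * fieldHarmonic K 1 k * shiftedTerm K n k)
       + 2 * (2 * n + 3) / ((n + 1) * (n + 2)) *
          (((k + 1 : ℕ) : K) ^ 2 * shiftedTerm K n (k + 1)) := by
    intro k
    have hk : ((k : K) + 1) ≠ 0 := by exact_mod_cast k.succ_ne_zero
    have e := legendreTerm_telescope (K := K) n k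
    have e'' : ((k + 1 : ℕ) : K) ^ 3 * fieldHarmonic K 1 (k + 1)
        = ((k + 1 : ℕ) : K) ^ 3 * fieldHarmonic K 1 k + ((k + 1 : ℕ) : K) ^ 2 := by
      rw [fieldHarmonic_succ]
      push_cast
      field_simp
    rw [e'']
    linear_combination fieldHarmonic K 1 k * e
  rw [legendreSum_eq _ (show n + 2 < n + 3 by omega), legendreSum_eq _ (show n < n + 3 by omega),
    Finset.mul_sum, Finset.mul_sum, ← Finset.sum_sub_distrib]
  simp only [key]
  rw [Finset.sum_add_distrib, ← Finset.mul_sum, ← Finset.mul_sum, Finset.sum_range_sub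
    (fun k => (k : K) ^ 3 * fieldHarmonic K 1 k * shiftedTerm K n k),
    shiftedTerm_eq_zero (show n + 2 < n + 3 by omega),
    shiftedSum_eq (show n + 2 < n + 3 + 1 by omega),
    Finset.sum_range_succ' (fun k : ℕ => (k : K) ^ 2 * shiftedTerm K n k)]
  simp

/-- Another instance of creative telescoping, here of order two with steps of one, so that even and
odd indices are coupled. -/
theorem shiftedSum_recurrence (n : ℕ) :
    ((n : K) + 2) * (n + 3) * (shiftedSum K (n + 2) - shiftedSum K n)
      + (2 * n + 5) * shiftedSum K (n + 1) = 0 := by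
  -- The lowest parameters occurring for `n`, `n + 1` and `n + 2`: all three summands are polynomial
  -- multiples of `y`.
  set y : ℕ → K := fun k => hyperTerm (-((n + 4 : ℕ) : K)) (n + 1) k with hy
  have h1 : ((n : K) + 1) ≠ 0 := by exact_mod_cast n.succ_ne_zero
  have h2 : ((n : K) + 2) ≠ 0 := by exact_mod_cast (n + 1).succ_ne_zero
  have h3 : ((n : K) + 3) ≠ 0 := by exact_mod_cast (n + 2).succ_ne_zero
  have h4 : ((n : K) + 4) ≠ 0 := by exact_mod_cast (n + 3).succ_ne_zero
  have e0 : ∀ k, shiftedTerm K n k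
      = ((n : K) + 4 - k) * (n + 3 - k) / ((n + 3) * (n + 4)) * y k := by
    intro k
    have e1 := mul_hyperTerm_left (-(n + 4 : K)) (n + 1) k
    have e2 := mul_hyperTerm_left (-(n + 3 : K)) (n + 1) k
    rw [show -(n + 4 : K) + 1 = -(n + 3) by ring] at e1
    rw [show -(n + 3 : K) + 1 = -(n + 2) by ring] at e2
    simp only [shiftedTerm, hy]
    push_cast
    field_simp
    linear_combination (-(n + 4 : K)) * e2 - (n + 3 - k : K) * e1
  have e1 : ∀ k, shiftedTerm K (n + 1) k
      = ((n : K) + 4 - k) * (n + 1 + k) / ((n + 1) * (n + 4)) * y k := by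
    intro k
    have e1 := mul_hyperTerm_left (-(n + 4 : K)) (n + 1) k
    have e2 := mul_hyperTerm_right (-(n + 3 : K)) (n + 1) k
    rw [show -(n + 4 : K) + 1 = -(n + 3) by ring] at e1
    simp only [shiftedTerm, hy]
    push_cast
    rw [show -((n : K) + 1 + 2) = -(n + 3) by ring]
    field_simp
    linear_combination ((n + 4 : K)) * e2 - (n + 1 + k : K) * e1
  have e2 : ∀ k, shiftedTerm K (n + 2) k
      = ((n : K) + 1 + k) * (n + 2 + k) / ((n + 1) * (n + 2)) * y k := by
    intro k
    have e1 := mul_hyperTerm_right (-(n + 4 : K)) (n + 1) k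
    have e2 := mul_hyperTerm_right (-(n + 4 : K)) (n + 1 + 1) k
    simp only [shiftedTerm, hy]
    push_cast
    rw [show (n : K) + 2 + 1 = n + 1 + 1 + 1 by ring, show -((n : K) + 2 + 2) = -(n + 4) by ring]
    field_simp
    linear_combination (n + 1 : K) * e2 + (n + 2 + k : K) * e1
  have key : ∀ k : ℕ, ((n : K) + 2) * (n + 3) * ((k : K) ^ 2 * shiftedTerm K (n + 2) k
        - (k : K) ^ 2 * shiftedTerm K n k)
      + (2 * n + 5) * ((k : K) ^ 2 * shiftedTerm K (n + 1) k)
      = -2 * (2 * n + 5) / ((n + 1) * (n + 4)) *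
        (((k + 1 : ℕ) : K) ^ 3 * ((k + 1 : ℕ) - 1) ^ 2 * y (k + 1)
          - (k : K) ^ 3 * (k - 1) ^ 2 * y k) := by
    intro k
    have hk : ((k : K) + 1) ≠ 0 := by exact_mod_cast k.succ_ne_zero
    rw [e0, e1, e2]
    simp only [hy, hyperTerm_succ]
    push_cast
    field_simp
    ring
  rw [shiftedSum_eq (show n + 2 + 2 < n + 5 by omega), shiftedSum_eq (show n + 2 < n + 5 by omega),
    shiftedSum_eq (show n + 1 + 2 < n + 5 by omega), ← Finset.sum_sub_distrib, Finset.mul_sum,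
    Finset.mul_sum, ← Finset.sum_add_distrib]
  simp only [key]
  rw [← Finset.mul_sum, Finset.sum_range_sub (fun k => (k : K) ^ 3 * (k - 1) ^ 2 * y k)]
  simp only [hy]
  rw [hyperTerm_eq_zero (show n + 4 < n + 5 by omega)]
  simp

/-- `(1/2)_m / m!`, that is, `C(2 * m, m) / 4^m`. -/
def centralRatio (K : Type*) [Field K] (m : ℕ) : K := rising (1 / 2) m / m.factorial

theorem centralRatio_succ (m : ℕ) :
    centralRatio K (m + 1) = centralRatio K m * ((2 * m + 1) / (2 * m + 2)) := by
  have h : ((m : K) + 1) ≠ 0 := by exact_mod_cast m.succ_ne_zero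
  have h' : (m.factorial : K) ≠ 0 := by exact_mod_cast m.factorial_ne_zero
  rw [centralRatio, centralRatio, rising_succ, Nat.factorial_succ]
  push_cast
  rw [show (2 * m + 2 : K) = 2 * (m + 1) by ring]
  field_simp
  ring

@[simp] theorem centralRatio_zero : centralRatio K 0 = 1 := by simp [centralRatio]

/-- At even index the recurrence multiplies by `((2m+1)/(2m+2))^2`, the square of the ratio in
`centralRatio_succ`. -/
theorem legendreSum_one_even (m : ℕ) : legendreSum K 1 (2 * m) = centralRatio K m ^ 2 := by
  induction m with
  | zero => simp [legendreSum, legendreTerm, hyperTerm]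
  | succ m ih =>
    have e := legendreSum_one_recurrence (K := K) (2 * m)
    have h : (2 * (m : K) + 2) ≠ 0 := by exact_mod_cast (2 * m + 1).succ_ne_zero
    push_cast at e
    rw [ih] at e
    rw [show 2 * (m + 1) = 2 * m + 2 by ring, centralRatio_succ]
    field_simp
    linear_combination e

/-- The sum for `n = 1` is `1 - 1`, and the recurrence is homogeneous. -/
theorem legendreSum_one_odd (m : ℕ) : legendreSum K 1 (2 * m + 1) = 0 := by
  induction m with
  | zero =>
    simp [legendreSum, legendreTerm, hyperTerm, Finset.sum_range_succ, rising]
    norm_num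
  | succ m ih =>
    have e := legendreSum_one_recurrence (K := K) (2 * m + 1)
    have h : (2 * (m : K) + 1 + 2) ≠ 0 := by exact_mod_cast (2 * m + 2).succ_ne_zero
    push_cast at e
    rw [ih, mul_zero] at e
    rw [show 2 * (m + 1) + 1 = 2 * m + 1 + 2 by ring]
    exact (mul_eq_zero.mp e).resolve_left (pow_ne_zero 2 h)

/-- Both parities are proved together because the recurrence expresses each new value by the two
preceding ones. Only the even values are used later. -/
theorem shiftedSum_eq_centralRatio (m : ℕ) :
    shiftedSum K (2 * m) = (2 * m + 1) ^ 2 / 2 * centralRatio K m ^ 2 ∧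
    shiftedSum K (2 * m + 1) = -(m + 1) * (2 * m + 3) * centralRatio K (m + 1) ^ 2 := by
  induction m with
  | zero =>
    simp [shiftedSum, shiftedTerm, hyperTerm, Finset.sum_range_succ, rising, Finset.prod_range_succ,
      centralRatio, Nat.factorial]
    norm_num
  | succ m ih =>
    obtain ⟨i0, i1⟩ := ih
    have e0 := shiftedSum_recurrence (K := K) (2 * m)
    have e1 := shiftedSum_recurrence (K := K) (2 * m + 1)
    have c1 := centralRatio_succ (K := K) m
    have c2 := centralRatio_succ (K := K) (m + 1)
    have h1 : ((m : K) + 1) ≠ 0 := by exact_mod_cast (m).succ_ne_zero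
    have h1' : ((m : K) + 2) ≠ 0 := by exact_mod_cast (m + 1).succ_ne_zero
    have h2 : (2 * (m : K) + 2) ≠ 0 := by exact_mod_cast (2 * m + 1).succ_ne_zero
    have h3 : (2 * (m : K) + 3) ≠ 0 := by exact_mod_cast (2 * m + 2).succ_ne_zero
    have h4 : (2 * (m : K) + 4) ≠ 0 := by exact_mod_cast (2 * m + 3).succ_ne_zero
    have s0 : shiftedSum K (2 * (m + 1)) = (2 * (m + 1 : ℕ) + 1) ^ 2 / 2 *
        centralRatio K (m + 1) ^ 2 := by
      rw [i0, i1, c1] at e0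
      rw [c1, show 2 * (m + 1) = 2 * m + 2 by ring]
      apply mul_left_cancel₀ (mul_ne_zero h2 h3)
      push_cast at e0 ⊢
      rw [← sub_eq_zero, ← e0]
      rw [show (2 * m + 2 : K) = 2 * (m + 1) by ring]
      field_simp
      ring
    refine ⟨s0, ?_⟩
    rw [show 2 * m + 1 + 1 = 2 * (m + 1) by ring, i1, s0] at e1
    rw [c2, show 2 * (m + 1) + 1 = 2 * m + 1 + 2 by ring]
    apply mul_left_cancel₀ (mul_ne_zero h3 h4)
    push_cast at e1 ⊢
    rw [← sub_eq_zero, ← e1]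
    rw [show (2 * (m + 1) + 2 : K) = 2 * (m + 2) by ring]
    field_simp
    ring

theorem legendreSum_harmonic_one_even (m : ℕ) :
    legendreSum K (fieldHarmonic K 1) (2 * m)
      = centralRatio K m ^ 2 * fieldHarmonic K 1 (2 * m) := by
  induction m with
  | zero => simp [legendreSum]
  | succ m ih =>
    have e := legendreSum_harmonic_one_recurrence (K := K) (2 * m)
    have h1 : (2 * (m : K) + 1) ≠ 0 := by exact_mod_cast (2 * m).succ_ne_zero
    have h2 : ((m : K) + 1) ≠ 0 := by exact_mod_cast m.succ_ne_zero
    rw [ih, (shiftedSum_eq_centralRatio m).1] at e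
    push_cast at e
    rw [show 2 * (m + 1) = 2 * m + 1 + 1 by ring, centralRatio_succ, fieldHarmonic_succ,
      fieldHarmonic_succ]
    rw [show (2 * m + 2 : K) = 2 * (m + 1) by ring] at e ⊢
    apply mul_left_cancel₀ (pow_ne_zero 2 (mul_ne_zero two_ne_zero h2))
    rw [sub_eq_iff_eq_add] at e
    rw [e]
    push_cast
    rw [show (2 * m + 1 + 1 : K) = 2 * (m + 1) by ring]
    field_simp
    ring

theorem legendreSum_harmonic_two_even (m : ℕ) :
    legendreSum K (fieldHarmonic K 2) (2 * m)
      = centralRatio K m ^ 2 * ∑ j ∈ Finset.range (2 * m), (-1) ^ (j + 1) / ((j : K) + 1) ^ 2 := by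
  induction m with
  | zero => simp [legendreSum]
  | succ m ih =>
    have e := legendreSum_harmonic_two_recurrence (K := K) (2 * m)
    have h1 : (2 * (m : K) + 1) ≠ 0 := by exact_mod_cast (2 * m).succ_ne_zero
    have h2 : ((m : K) + 1) ≠ 0 := by exact_mod_cast m.succ_ne_zero
    rw [ih, legendreSum_one_even, show 2 * m + 2 = 2 * (m + 1) by ring, legendreSum_one_even,
      centralRatio_succ] at e
    push_cast at e
    rw [centralRatio_succ, show 2 * (m + 1) = 2 * m + 1 + 1 by ring, Finset.sum_range_succ,
      Finset.sum_range_succ]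
    rw [show 2 * (m + 1) = 2 * m + 1 + 1 by ring] at e
    rw [show (2 * m + 2 : K) = 2 * (m + 1) by ring] at e ⊢
    apply mul_left_cancel₀ (pow_ne_zero 2 (mul_ne_zero two_ne_zero h2))
    rw [sub_eq_iff_eq_add] at e
    rw [e]
    push_cast
    rw [show (2 * m + 1 + 1 : K) = 2 * (m + 1) by ring]
    simp only [pow_succ, pow_mul]
    field_simp
    ring

/-- At odd index the unweighted sums vanish, so the recurrence becomes homogeneous and the answer is
a product. -/
theorem legendreSum_harmonic_two_odd (m : ℕ) :
    legendreSum K (fieldHarmonic K 2) (2 * m + 1)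
      = -(m.factorial / rising (3 / 2) m) ^ 2 := by
  induction m with
  | zero =>
    simp [legendreSum, legendreTerm, hyperTerm, Finset.sum_range_succ, rising, fieldHarmonic]
    norm_num
  | succ m ih =>
    have e := legendreSum_harmonic_two_recurrence (K := K) (2 * m + 1)
    have h3 : (2 * (m : K) + 3) ≠ 0 := by exact_mod_cast (2 * m + 2).succ_ne_zero
    have hr : rising (3 / 2 : K) m ≠ 0 := rising_ne_zero (fun j h => by
      have : (2 * (j : K) + 3) ≠ 0 := by exact_mod_cast (2 * j + 2).succ_ne_zero
      apply this
      linear_combination 2 * h) m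
    rw [ih, legendreSum_one_odd, show 2 * m + 1 + 2 = 2 * (m + 1) + 1 by ring, legendreSum_one_odd,
      sub_self] at e
    rw [rising_succ, Nat.factorial_succ]
    push_cast at e ⊢
    rw [show (3 / 2 + m : K) = (2 * m + 3) / 2 by ring]
    apply mul_left_cancel₀ (pow_ne_zero 2 h3)
    field_simp at e ⊢
    linear_combination e

/-- The summand of the well-poised series `₃F₂(a, b, -n; 1 + a - b, 1 + a + n; 1)`. -/
def dixonTerm (a b : K) (n k : ℕ) : K :=
  rising a k * rising b k * rising (-(n : K)) k /
    (k.factorial * rising (1 + a - b) k * rising (1 + a + n) k)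

/-- First-order telescoping in `n`; the hypotheses keep the lower parameters of the series away from
zero. -/
theorem dixon_recurrence (a b : K) (n : ℕ) (hab : ∀ j : ℕ, 1 + a - b + j ≠ 0)
    (ha : ∀ j : ℕ, 1 + a + j ≠ 0) :
    (1 + a / 2 + n) * (1 + a - b + n) * ∑ k ∈ Finset.range (n + 2), dixonTerm a b (n + 1) k
      = (1 + a + n) * (1 + a / 2 - b + n) * ∑ k ∈ Finset.range (n + 1), dixonTerm a b n k := by
  have hn : ((n : K) + 1) ≠ 0 := by exact_mod_cast n.succ_ne_zero
  have han : ∀ j : ℕ, 1 + a + n + j ≠ 0 := fun j h => ha (n + j) (by push_cast; linear_combination h)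
  have hext : ∑ k ∈ Finset.range (n + 1), dixonTerm a b n k
      = ∑ k ∈ Finset.range (n + 2), dixonTerm a b n k := by
    rw [Finset.sum_range_succ _ (n + 1), dixonTerm, rising_neg_natCast_eq_zero (Nat.lt_succ_self n)]
    simp
  -- Common factor of the summands for `n` and `n + 1`: the denominator carries one extra factor so
  -- that it is divisible by both denominators.
  set y : ℕ → K := fun k => rising a k * rising b k * rising (-((n + 1 : ℕ) : K)) k /
    (k.factorial * rising (1 + a - b) k * rising (1 + a + n) (k + 1)) with hy
  have hfac : ∀ k : ℕ, (k.factorial : K) ≠ 0 := fun k => by exact_mod_cast k.factorial_ne_zero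
  have hr1 := rising_ne_zero hab
  have hr2 := rising_ne_zero han
  have y0 : ∀ k, dixonTerm a b n k = (1 + a + n + k) * (n + 1 - k) / (n + 1) * y k := by
    intro k
    have e := mul_rising_add_one (-(n + 1 : K)) k
    rw [show -(n + 1 : K) + 1 = -n by ring] at e
    have e' : rising (-(n : K)) k = (n + 1 - k) / (n + 1) * rising (-(n + 1 : K)) k := by
      field_simp
      linear_combination -e
    simp only [dixonTerm, hy, rising_succ]
    push_cast
    rw [e']
    have := hfac k
    have := hr1 k
    have := hr2 k
    have := han k
    field_simp
  have y1 : ∀ k, dixonTerm a b (n + 1) k = (1 + a + n) * y k := by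
    intro k
    have e := mul_rising_add_one (1 + a + n : K) k
    have h0 := han 0
    rw [Nat.cast_zero, add_zero] at h0
    have e' : rising (1 + a + n + 1 : K) k = (1 + a + n + k) / (1 + a + n) * rising (1 + a + n) k := by
      field_simp
      linear_combination e
    simp only [dixonTerm, hy, rising_succ]
    push_cast
    rw [show 1 + a + ((n : K) + 1) = 1 + a + n + 1 by ring, e']
    have := hfac k
    have := hr1 k
    have := hr2 k
    have := han k
    field_simp
  have ysucc : ∀ k, y (k + 1) = y k * ((a + k) * (b + k) * (k - n - 1) /
      ((k + 1) * (1 + a - b + k) * (1 + a + n + k + 1))) := by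
    intro k
    have hk : ((k : K) + 1) ≠ 0 := by exact_mod_cast k.succ_ne_zero
    have h5 := han (k + 1)
    push_cast at h5
    rw [← add_assoc] at h5
    simp only [hy, rising_succ, Nat.factorial_succ]
    push_cast
    have := hfac k
    have := hr1 k
    have := hr2 k
    have := han k
    have := hab k
    rw [← add_assoc]
    field_simp
    ring
  have key : ∀ k : ℕ, (1 + a / 2 + n) * (1 + a - b + n) * dixonTerm a b (n + 1) k
      - (1 + a + n) * (1 + a / 2 - b + n) * dixonTerm a b n k
      = -(1 + a + n) / (2 * (n + 1)) *
        ((k + 1 : ℕ) * ((k + 1 : ℕ) + a - b) * (1 + a + n + (k + 1 : ℕ)) * y (k + 1)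
          - k * (k + a - b) * (1 + a + n + k) * y k) := by
    intro k
    have hk : ((k : K) + 1) ≠ 0 := by exact_mod_cast k.succ_ne_zero
    have h5 := han (k + 1)
    have := hab k
    rw [y0, y1, ysucc]
    push_cast at h5 ⊢
    rw [← add_assoc] at h5 ⊢
    rw [show (k : K) + 1 + a - b = 1 + a - b + k by ring]
    field_simp
    ring
  rw [hext, ← sub_eq_zero, Finset.mul_sum, Finset.mul_sum, ← Finset.sum_sub_distrib]
  simp only [key]
  rw [← Finset.mul_sum, Finset.sum_range_sub
    (fun k : ℕ => (k : K) * (k + a - b) * (1 + a + n + k) * y k)]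
  have : y (n + 2) = 0 := by
    simp only [hy]
    rw [rising_neg_natCast_eq_zero (show n + 1 < n + 2 by omega)]
    simp
  simp [this]

/-- Dixon's summation of the terminating well-poised `₃F₂`. -/
theorem dixon_sum (a b : K) (n : ℕ) (hab : ∀ j : ℕ, 1 + a - b + j ≠ 0)
    (ha : ∀ j : ℕ, 1 + a + j ≠ 0) (ha2 : ∀ j : ℕ, 1 + a / 2 + j ≠ 0) :
    ∑ k ∈ Finset.range (n + 1), dixonTerm a b n k
      = rising (1 + a) n * rising (1 + a / 2 - b) n /
        (rising (1 + a / 2) n * rising (1 + a - b) n) := by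
  induction n with
  | zero => simp [dixonTerm]
  | succ n ih =>
    have e := dixon_recurrence a b n hab ha
    rw [ih] at e
    have := rising_ne_zero hab n
    have := rising_ne_zero ha2 n
    have := hab n
    have := ha2 n
    simp only [rising_succ]
    apply mul_left_cancel₀ (mul_ne_zero (ha2 n) (hab n))
    rw [e]
    generalize 1 + a / 2 = c at *
    field_simp

end Hypergeometric

/-! ### Congruences between p-adic numbers and the reduction modulo p² -/

section PadicCongruence

variable {p : ℕ} [Fact p.Prime]

/-- The congruence `a ≡ b` modulo `c ℤ_p` between `p`-adic numbers. -/
def CongrMod (c a b : ℚ_[p]) : Prop := ∃ z ∈ PadicInt.subring p, a - b = c * z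

namespace CongrMod

variable {c d x y z w : ℚ_[p]}

theorem of_eq (h : x = y) : CongrMod c x y := ⟨0, zero_mem _, by rw [h]; ring⟩

theorem refl (c x : ℚ_[p]) : CongrMod c x x := of_eq rfl

theorem symm (h : CongrMod c x y) : CongrMod c y x := by
  obtain ⟨u, hu, e⟩ := h
  exact ⟨-u, neg_mem hu, by linear_combination -e⟩

theorem trans (h : CongrMod c x y) (h' : CongrMod c y z) : CongrMod c x z := by
  obtain ⟨u, hu, e⟩ := h
  obtain ⟨v, hv, e'⟩ := h'
  exact ⟨u + v, add_mem hu hv, by linear_combination e + e'⟩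

theorem add (h : CongrMod c x y) (h' : CongrMod c z w) : CongrMod c (x + z) (y + w) := by
  obtain ⟨u, hu, e⟩ := h
  obtain ⟨v, hv, e'⟩ := h'
  exact ⟨u + v, add_mem hu hv, by linear_combination e + e'⟩

theorem neg (h : CongrMod c x y) : CongrMod c (-x) (-y) := by
  obtain ⟨u, hu, e⟩ := h
  exact ⟨-u, neg_mem hu, by linear_combination -e⟩

theorem sub (h : CongrMod c x y) (h' : CongrMod c z w) : CongrMod c (x - z) (y - w) := by
  rw [sub_eq_add_neg, sub_eq_add_neg]
  exact h.add h'.neg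

theorem mul_left (hz : z ∈ PadicInt.subring p) (h : CongrMod c x y) :
    CongrMod c (z * x) (z * y) := by
  obtain ⟨u, hu, e⟩ := h
  exact ⟨z * u, mul_mem hz hu, by linear_combination z * e⟩

theorem mul_right (hz : z ∈ PadicInt.subring p) (h : CongrMod c x y) :
    CongrMod c (x * z) (y * z) := by
  rw [mul_comm x, mul_comm y]
  exact h.mul_left hz

theorem mul (h : CongrMod c x y) (h' : CongrMod c z w) (hx : x ∈ PadicInt.subring p)
    (hw : w ∈ PadicInt.subring p) : CongrMod c (x * z) (y * w) :=
  (h'.mul_left hx).trans (h.mul_right hw)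

theorem scale (d : ℚ_[p]) (h : CongrMod c x y) : CongrMod (d * c) (d * x) (d * y) := by
  obtain ⟨u, hu, e⟩ := h
  exact ⟨u, hu, by linear_combination d * e⟩

theorem of_scale (hd : d ≠ 0) (h : CongrMod (d * c) (d * x) (d * y)) : CongrMod c x y := by
  obtain ⟨u, hu, e⟩ := h
  exact ⟨u, hu, mul_left_cancel₀ hd (by linear_combination e)⟩

theorem of_mul_left (hd : d ∈ PadicInt.subring p) (h : CongrMod (d * c) x y) :
    CongrMod c x y := by
  obtain ⟨u, hu, e⟩ := h
  exact ⟨d * u, mul_mem hd hu, by linear_combination e⟩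

theorem mem_left (hc : c ∈ PadicInt.subring p) (h : CongrMod c x y) (hy : y ∈ PadicInt.subring p) :
    x ∈ PadicInt.subring p := by
  obtain ⟨u, hu, e⟩ := h
  rw [sub_eq_iff_eq_add] at e
  rw [e]
  exact add_mem (mul_mem hc hu) hy

theorem sum {ι : Type*} {s : Finset ι} {f g : ι → ℚ_[p]} (h : ∀ i ∈ s, CongrMod c (f i) (g i)) :
    CongrMod c (∑ i ∈ s, f i) (∑ i ∈ s, g i) := by
  classical
  induction s using Finset.induction_on with
  | empty => exact of_eq (by simp)
  | insert a s ha ih =>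
    rw [Finset.sum_insert ha, Finset.sum_insert ha]
    exact (h a (Finset.mem_insert_self a s)).add (ih fun i hi => h i (Finset.mem_insert_of_mem hi))

theorem prod {ι : Type*} {s : Finset ι} {f g : ι → ℚ_[p]} (h : ∀ i ∈ s, CongrMod c (f i) (g i))
    (hf : ∀ i ∈ s, f i ∈ PadicInt.subring p) (hg : ∀ i ∈ s, g i ∈ PadicInt.subring p) :
    CongrMod c (∏ i ∈ s, f i) (∏ i ∈ s, g i) := by
  classical
  induction s using Finset.induction_on with
  | empty => exact of_eq (by simp)
  | insert a s ha ih =>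
    rw [Finset.prod_insert ha, Finset.prod_insert ha]
    exact (h a (Finset.mem_insert_self a s)).mul
      (ih (fun i hi => h i (Finset.mem_insert_of_mem hi))
        (fun i hi => hf i (Finset.mem_insert_of_mem hi))
        (fun i hi => hg i (Finset.mem_insert_of_mem hi)))
      (hf a (Finset.mem_insert_self a s))
      (prod_mem fun i hi => hg i (Finset.mem_insert_of_mem hi))

theorem pow (h : CongrMod c x y) (hx : x ∈ PadicInt.subring p) (hy : y ∈ PadicInt.subring p)
    (m : ℕ) : CongrMod c (x ^ m) (y ^ m) := by
  rw [← Finset.card_range m, ← Finset.prod_const, ← Finset.prod_const]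
  exact prod (fun _ _ => h) (fun _ _ => hx) fun _ _ => hy

end CongrMod

theorem mem_of_norm_eq_one {x : ℚ_[p]} (h : ‖x‖ = 1) : x ∈ PadicInt.subring p :=
  (PadicInt.mem_subring_iff p).mpr h.le

theorem ne_zero_of_norm_eq_one {x : ℚ_[p]} (h : ‖x‖ = 1) : x ≠ 0 := by
  rintro rfl
  simp at h

theorem inv_mem_of_norm_eq_one {x : ℚ_[p]} (h : ‖x‖ = 1) : x⁻¹ ∈ PadicInt.subring p :=
  mem_of_norm_eq_one (by rw [norm_inv, h, inv_one])

theorem div_mem_of_norm_eq_one {x y : ℚ_[p]} (hx : x ∈ PadicInt.subring p) (h : ‖y‖ = 1) :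
    x / y ∈ PadicInt.subring p := by
  rw [div_eq_mul_inv]
  exact mul_mem hx (inv_mem_of_norm_eq_one h)

theorem CongrMod.inv {c x y : ℚ_[p]} (h : CongrMod c x y) (hx : ‖x‖ = 1) (hy : ‖y‖ = 1) :
    CongrMod c x⁻¹ y⁻¹ := by
  obtain ⟨u, hu, e⟩ := h
  have := ne_zero_of_norm_eq_one hx
  have := ne_zero_of_norm_eq_one hy
  refine ⟨-u * x⁻¹ * y⁻¹, mul_mem (mul_mem (neg_mem hu) (inv_mem_of_norm_eq_one hx))
    (inv_mem_of_norm_eq_one hy), ?_⟩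
  field_simp
  linear_combination -e

theorem CongrMod.div {c x y z w : ℚ_[p]} (h : CongrMod c x y) (h' : CongrMod c z w)
    (hx : x ∈ PadicInt.subring p) (hz : ‖z‖ = 1) (hw : ‖w‖ = 1) :
    CongrMod c (x / z) (y / w) := by
  rw [div_eq_mul_inv, div_eq_mul_inv]
  exact h.mul (h'.inv hz hw) hx (inv_mem_of_norm_eq_one hw)

/-- A congruence may be tested after multiplication by a unit. -/
theorem CongrMod.of_mul_unit {c d x y : ℚ_[p]} (hd : ‖d‖ = 1) (h : CongrMod c (d * x) (d * y)) :
    CongrMod c x y := by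
  have := h.mul_left (inv_mem_of_norm_eq_one hd)
  rwa [inv_mul_cancel_left₀ (ne_zero_of_norm_eq_one hd),
    inv_mul_cancel_left₀ (ne_zero_of_norm_eq_one hd)] at this

theorem norm_prod_eq_one {ι : Type*} {s : Finset ι} {f : ι → ℚ_[p]} (h : ∀ i ∈ s, ‖f i‖ = 1) :
    ‖∏ i ∈ s, f i‖ = 1 := by
  rw [norm_prod]
  exact Finset.prod_eq_one h

theorem norm_natCast_eq_one {j : ℕ} (h0 : 0 < j) (hj : j < p) : ‖(j : ℚ_[p])‖ = 1 :=
  Padic.norm_natCast_eq_one_iff.mpr (Nat.coprime_of_lt_prime h0.ne' hj Fact.out)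

theorem norm_natCast_add_one_eq_one {j : ℕ} (hj : j + 1 < p) : ‖(j : ℚ_[p]) + 1‖ = 1 := by
  exact_mod_cast norm_natCast_eq_one (p := p) j.succ_pos hj

theorem norm_factorial_eq_one {k : ℕ} (hk : k < p) : ‖(k.factorial : ℚ_[p])‖ = 1 :=
  Padic.norm_natCast_eq_one_iff.mpr
    (Nat.Prime.coprime_factorial_of_lt Fact.out hk)

theorem norm_two_eq_one (h3 : 3 < p) : ‖(2 : ℚ_[p])‖ = 1 := by
  exact_mod_cast norm_natCast_eq_one (p := p) two_pos (by omega)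

/-- By the ultrametric inequality a perturbation in `p ℤ_p` preserves units; this makes many
denominators below invertible. -/
theorem norm_eq_one_of_congrMod {x y : ℚ_[p]} (h : CongrMod (p : ℚ_[p]) x y) (hy : ‖y‖ = 1) :
    ‖x‖ = 1 := by
  obtain ⟨z, hz, e⟩ := h
  have hlt : ‖x - y‖ < ‖y‖ := by
    rw [e, norm_mul, hy]
    calc ‖(p : ℚ_[p])‖ * ‖z‖ ≤ ‖(p : ℚ_[p])‖ * 1 :=
          mul_le_mul_of_nonneg_left ((PadicInt.mem_subring_iff p).mp hz) (norm_nonneg _)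
      _ < 1 := by rw [mul_one]; exact Padic.norm_p_lt_one
  have := IsUltrametricDist.norm_add_eq_max_of_norm_ne_norm hlt.ne
  rw [sub_add_cancel, max_eq_right hlt.le, hy] at this
  exact this

theorem natCast_mem_subring (m : ℕ) : (m : ℚ_[p]) ∈ PadicInt.subring p := natCast_mem _ m

theorem CongrMod.of_sq {x y : ℚ_[p]} (h : CongrMod ((p : ℚ_[p]) ^ 2) x y) :
    CongrMod (p : ℚ_[p]) x y :=
  of_mul_left (natCast_mem_subring p) (by rwa [← sq])

theorem prod_one_add_mul_congrMod {ι : Type*} (s : Finset ι) {c : ℚ_[p]} {z : ι → ℚ_[p]}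
    (hc : c ∈ PadicInt.subring p) (hz : ∀ i ∈ s, z i ∈ PadicInt.subring p) :
    CongrMod (c ^ 2) (∏ i ∈ s, (1 + c * z i)) (1 + c * ∑ i ∈ s, z i) := by
  classical
  induction s using Finset.induction_on with
  | empty => exact .of_eq (by simp)
  | insert a s ha ih =>
    have hs : ∀ i ∈ s, z i ∈ PadicInt.subring p := fun i hi => hz i (Finset.mem_insert_of_mem hi)
    have hza := hz a (Finset.mem_insert_self a s)
    obtain ⟨w, hw, e⟩ := ih hs
    rw [Finset.prod_insert ha, Finset.sum_insert ha]
    refine ⟨z a * ∑ i ∈ s, z i + w + c * z a * w,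
      add_mem (add_mem (mul_mem hza (sum_mem hs)) hw) (mul_mem (mul_mem hc hza) hw), ?_⟩
    linear_combination (1 + c * z a) * e

/-- The coefficient of `c^2` is the second elementary symmetric function, written through power sums
by Newton's identity; this is where `2` must be a unit. -/
theorem prod_one_add_mul_congrMod_cube {ι : Type*} (s : Finset ι) {c : ℚ_[p]} {z : ι → ℚ_[p]}
    (h2 : ‖(2 : ℚ_[p])‖ = 1)
    (hc : c ∈ PadicInt.subring p) (hz : ∀ i ∈ s, z i ∈ PadicInt.subring p) :
    CongrMod (c ^ 3) (∏ i ∈ s, (1 + c * z i))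
      (1 + c * ∑ i ∈ s, z i + c ^ 2 * (((∑ i ∈ s, z i) ^ 2 - ∑ i ∈ s, z i ^ 2) / 2)) := by
  classical
  induction s using Finset.induction_on with
  | empty => exact .of_eq (by simp)
  | insert a s ha ih =>
    have hs : ∀ i ∈ s, z i ∈ PadicInt.subring p := fun i hi => hz i (Finset.mem_insert_of_mem hi)
    have hza := hz a (Finset.mem_insert_self a s)
    have he : (((∑ i ∈ s, z i) ^ 2 - ∑ i ∈ s, z i ^ 2) / 2) ∈ PadicInt.subring p :=
      div_mem_of_norm_eq_one (sub_mem (pow_mem (sum_mem hs) 2)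
        (sum_mem fun i hi => pow_mem (hs i hi) 2)) h2
    obtain ⟨w, hw, e⟩ := ih hs
    rw [Finset.prod_insert ha, Finset.sum_insert ha, Finset.sum_insert ha]
    refine ⟨z a * (((∑ i ∈ s, z i) ^ 2 - ∑ i ∈ s, z i ^ 2) / 2) + w + c * z a * w,
      add_mem (add_mem (mul_mem hza he) hw) (mul_mem (mul_mem hc hza) hw), ?_⟩
    linear_combination (1 + c * z a) * e

theorem fieldHarmonic_mem (r : ℕ) {k : ℕ} (hk : k < p) :
    fieldHarmonic ℚ_[p] r k ∈ PadicInt.subring p := by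
  refine sum_mem fun j hj => div_mem_of_norm_eq_one (one_mem _) ?_
  rw [norm_pow, norm_natCast_add_one_eq_one (by rw [Finset.mem_range] at hj; omega), one_pow]

theorem rising_mem {x : ℚ_[p]} (hx : x ∈ PadicInt.subring p) (k : ℕ) :
    rising x k ∈ PadicInt.subring p :=
  prod_mem fun j _ => add_mem hx (natCast_mem_subring j)

theorem half_mem (h3 : 3 < p) : (1 / 2 : ℚ_[p]) ∈ PadicInt.subring p :=
  div_mem_of_norm_eq_one (one_mem _) (norm_two_eq_one h3)

theorem rising_congrMod {c x y : ℚ_[p]} (h : CongrMod c x y) (hx : x ∈ PadicInt.subring p)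
    (hy : y ∈ PadicInt.subring p) (k : ℕ) : CongrMod c (rising x k) (rising y k) :=
  .prod (fun _ _ => h.add (.refl _ _)) (fun j _ => add_mem hx (natCast_mem_subring j))
    fun j _ => add_mem hy (natCast_mem_subring j)

theorem hyperTerm_half_congrMod (h3 : 3 < p) {n : ℕ} (hn : p = 2 * n + 1) {k : ℕ} (hk : k < p) :
    CongrMod ((p : ℚ_[p]) ^ 2) (hyperTerm (1 / 2) (1 / 2) k) (legendreTerm ℚ_[p] n k) := by
  have hpn : (p : ℚ_[p]) = 2 * n + 1 := by exact_mod_cast congrArg (Nat.cast : ℕ → ℚ_[p]) hn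
  have hf := norm_factorial_eq_one hk
  have hprod : CongrMod ((p : ℚ_[p]) ^ 2) (rising (1 / 2) k * rising (1 / 2) k)
      (rising (-(n : ℚ_[p])) k * rising ((n : ℚ_[p]) + 1) k) := by
    simp only [rising, ← Finset.prod_mul_distrib]
    -- Factor by factor, `(1/2 + j)^2 - (j - n)(n + 1 + j) = (2n+1)^2 / 4 = p^2 / 4`.
    refine .prod (fun j _ => ⟨1 / 4, ?_, ?_⟩) (fun j _ => ?_) fun j _ => ?_
    · rw [show (1 / 4 : ℚ_[p]) = 1 / 2 * (1 / 2) by norm_num]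
      exact mul_mem (half_mem h3) (half_mem h3)
    · rw [hpn]; ring
    · exact mul_mem (add_mem (half_mem h3) (natCast_mem_subring j))
        (add_mem (half_mem h3) (natCast_mem_subring j))
    · exact mul_mem (add_mem (neg_mem (natCast_mem_subring n)) (natCast_mem_subring j))
        (add_mem (add_mem (natCast_mem_subring n) (one_mem _)) (natCast_mem_subring j))
  unfold legendreTerm hyperTerm
  rw [mul_div_assoc, mul_div_assoc]
  exact hprod.mul_right (div_mem_of_norm_eq_one (rising_mem (half_mem h3) k)
    (by rw [norm_pow, hf, one_pow]))

theorem centralRatio_eq_choose {K : Type*} [Field K] [CharZero K] (k : ℕ) :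
    centralRatio K k = ((2 * k).choose k : K) / 4 ^ k := by
  induction k with
  | zero => simp
  | succ k ih =>
    have e := Nat.succ_mul_centralBinom_succ k
    have e' := congrArg (Nat.cast : ℕ → K) e
    rw [Nat.centralBinom_eq_two_mul_choose, Nat.centralBinom_eq_two_mul_choose] at e'
    have h : ((k : K) + 1) ≠ 0 := by exact_mod_cast k.succ_ne_zero
    push_cast at e'
    rw [centralRatio_succ, ih, show (2 * k + 2 : K) = 2 * (k + 1) by ring]
    field_simp
    rw [pow_succ]
    linear_combination -2 * 4 ^ k * e'

theorem genHarmonic_cast {K : Type*} [Field K] [CharZero K] (r k : ℕ) :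
    ((genHarmonic r k : ℚ) : K) = fieldHarmonic K r k := by
  have := Finset.sum_Ico_add' (fun j : ℕ => 1 / (j : K) ^ r) 0 k 1
  simp only [Nat.cast_add, Nat.cast_one] at this
  rw [genHarmonic, fieldHarmonic, Finset.range_eq_Ico, this]
  push_cast
  rfl

/-- Reduction of the binomial sums to terminating hypergeometric sums. -/
theorem binomialSum_congrMod (h3 : 3 < p) {n : ℕ} (hn : p = 2 * n + 1) (r : ℕ) :
    CongrMod ((p : ℚ_[p]) ^ 2)
      ((∑ k ∈ Finset.Icc 1 (p - 1),
        ((2 * k).choose k : ℚ) ^ 3 * genHarmonic r k / 64 ^ k : ℚ) : ℚ_[p])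
      (legendreSum ℚ_[p] (fieldHarmonic ℚ_[p] r) n) := by
  rw [legendreSum_eq _ (show n < p by omega)]
  have hsum : ((∑ k ∈ Finset.Icc 1 (p - 1),
        ((2 * k).choose k : ℚ) ^ 3 * genHarmonic r k / 64 ^ k : ℚ) : ℚ_[p])
      = ∑ k ∈ Finset.range p, hyperTerm (1 / 2) (1 / 2) k * fieldHarmonic ℚ_[p] r k := by
    obtain ⟨m, hm⟩ : ∃ m, p = m + 1 := ⟨p - 1, by omega⟩
    -- The term `k = 0` may be added freely because the harmonic number of index `0` is zero.
    rw [show Finset.range p = Finset.range (m + 1) by rw [← hm], show p - 1 = m by omega,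
      Finset.sum_range_succ']
    simp only [fieldHarmonic_zero, mul_zero, add_zero]
    rw [Finset.range_eq_Ico, Finset.sum_Ico_add' (fun k => hyperTerm (1 / 2) (1 / 2) k *
      fieldHarmonic ℚ_[p] r k) 0 m 1]
    push_cast
    refine Finset.sum_congr rfl fun k _ => ?_
    have := centralRatio_eq_choose (K := ℚ_[p]) k
    rw [genHarmonic_cast, hyperTerm, show (64 : ℚ_[p]) = 4 ^ 3 by norm_num, pow_right_comm]
    have e : rising (1 / 2 : ℚ_[p]) k * rising (1 / 2) k * rising (1 / 2) k /
        (k.factorial : ℚ_[p]) ^ 3 = centralRatio ℚ_[p] k ^ 3 := by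
      rw [centralRatio, div_pow]; ring
    rw [e, this]
    ring
  rw [hsum]
  refine .sum fun k hk => ?_
  rw [Finset.mem_range] at hk
  exact (hyperTerm_half_congrMod h3 hn hk).mul_right (fieldHarmonic_mem r hk)

end PadicCongruence

/-! ### Harmonic sums, the Fermat quotient and factorials -/

section HarmonicCongruence

variable {p : ℕ} [Fact p.Prime]

theorem sum_range_add_reflect {A : Type*} [AddCommMonoid A] (f : ℕ → A) (m k : ℕ) :
    ∑ j ∈ Finset.range (m + k), f j
      = ∑ j ∈ Finset.range m, f j + ∑ i ∈ Finset.range k, f (m + (k - 1 - i)) := by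
  rw [Finset.sum_range_add, Finset.sum_range_reflect (fun i => f (m + i))]

theorem prod_range_add_reflect {A : Type*} [CommMonoid A] (f : ℕ → A) (m k : ℕ) :
    ∏ j ∈ Finset.range (m + k), f j
      = (∏ j ∈ Finset.range m, f j) * ∏ i ∈ Finset.range k, f (m + (k - 1 - i)) := by
  rw [Finset.prod_range_add, Finset.prod_range_reflect (fun i => f (m + i))]

theorem sum_range_two_mul {A : Type*} [AddCommMonoid A] (f : ℕ → A) (n : ℕ) :
    ∑ j ∈ Finset.range (2 * n), f j
      = ∑ i ∈ Finset.range n, f (2 * i) + ∑ i ∈ Finset.range n, f (2 * i + 1) := by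
  induction n with
  | zero => simp
  | succ n ih =>
    rw [show 2 * (n + 1) = 2 * n + 1 + 1 by ring, Finset.sum_range_succ, Finset.sum_range_succ, ih,
      Finset.sum_range_succ, Finset.sum_range_succ]
    abel

theorem congrMod_sub_natCast {i : ℕ} : CongrMod (p : ℚ_[p]) ((p : ℚ_[p]) - (i + 1)) (-(i + 1)) :=
  ⟨1, one_mem _, by ring⟩

/-- `(p - 1 - i) ^ r` inverts to the inverse of `(-(i + 1)) ^ r` modulo `p`. -/
theorem one_div_reflect_congrMod (r : ℕ) {m i : ℕ} (hmi : m + i + 2 = p) :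
    CongrMod (p : ℚ_[p]) (1 / ((m : ℚ_[p]) + 1) ^ r) ((-1) ^ r * (1 / ((i : ℚ_[p]) + 1) ^ r)) := by
  have hm : ((m : ℚ_[p]) + 1) = p - (i + 1) := by
    have := congrArg (Nat.cast : ℕ → ℚ_[p]) hmi
    push_cast at this
    linear_combination this
  have h1 : ‖(m : ℚ_[p]) + 1‖ = 1 := norm_natCast_add_one_eq_one (by omega)
  have h2 : ‖(i : ℚ_[p]) + 1‖ = 1 := norm_natCast_add_one_eq_one (by omega)
  have h2' : ‖-((i : ℚ_[p]) + 1)‖ = 1 := by rw [norm_neg, h2]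
  have hc : CongrMod (p : ℚ_[p]) ((m : ℚ_[p]) + 1) (-(i + 1)) := hm ▸ congrMod_sub_natCast
  have e : (-1) ^ r * (1 / ((i : ℚ_[p]) + 1) ^ r) = ((-((i : ℚ_[p]) + 1))⁻¹) ^ r := by
    rw [inv_neg, neg_pow ((i : ℚ_[p]) + 1)⁻¹ r, inv_pow, one_div]
  rw [e, one_div, ← inv_pow]
  exact (hc.inv h1 h2').pow (inv_mem_of_norm_eq_one h1) (inv_mem_of_norm_eq_one h2') r

theorem fieldHarmonic_reflect (r : ℕ) {m k : ℕ} (hmk : m + k + 1 = p) :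
    CongrMod (p : ℚ_[p]) (fieldHarmonic ℚ_[p] r (m + k))
      (fieldHarmonic ℚ_[p] r m + (-1) ^ r * fieldHarmonic ℚ_[p] r k) := by
  simp only [fieldHarmonic]
  rw [sum_range_add_reflect, Finset.mul_sum]
  refine .add (.refl _ _) (.sum fun i hi => ?_)
  rw [Finset.mem_range] at hi
  exact one_div_reflect_congrMod r (by omega)

theorem fieldHarmonic_one_full {n : ℕ} (hn : p = 2 * n + 1) :
    CongrMod (p : ℚ_[p]) (fieldHarmonic ℚ_[p] 1 (p - 1)) 0 := by
  have h := fieldHarmonic_reflect (p := p) 1 (show n + n + 1 = p by omega)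
  rw [show n + n = p - 1 by omega] at h
  exact h.trans (.of_eq (by ring))

theorem fieldHarmonic_one_reflect {n m k : ℕ} (hn : p = 2 * n + 1) (hmk : m + k + 1 = p) :
    CongrMod (p : ℚ_[p]) (fieldHarmonic ℚ_[p] 1 m) (fieldHarmonic ℚ_[p] 1 k) := by
  have h := fieldHarmonic_reflect (p := p) 1 hmk
  rw [show m + k = p - 1 by omega] at h
  have := (h.symm.trans (fieldHarmonic_one_full hn)).add (.refl _ (fieldHarmonic ℚ_[p] 1 k))
  exact (CongrMod.of_eq (by ring)).trans (this.trans (.of_eq (by ring)))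

/-- Let `S = H_n^{(2)}`. The sum of `1/j^2` over `j < p` is `2S` modulo `p` by the reflection `j ↦ p
- j`. Separating parities gives `S/4` for even `j`, and the same for odd `j`, since reflection
exchanges parities. Hence `2S ≡ S/2`, so `3S ≡ 0`, and `3` is a unit. -/
theorem fieldHarmonic_two_half (h3 : 3 < p) {n : ℕ} (hn : p = 2 * n + 1) :
    CongrMod (p : ℚ_[p]) (fieldHarmonic ℚ_[p] 2 n) 0 := by
  have h2 := norm_two_eq_one h3
  have h2' := ne_zero_of_norm_eq_one h2
  have h := fieldHarmonic_reflect (p := p) 2 (show n + n + 1 = p by omega)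
  have hq : (1 / 4 : ℚ_[p]) ∈ PadicInt.subring p := by
    rw [show (1 / 4 : ℚ_[p]) = 1 / 2 * (1 / 2) by norm_num]
    exact mul_mem (half_mem h3) (half_mem h3)
  have h' : CongrMod (p : ℚ_[p]) (fieldHarmonic ℚ_[p] 2 (n + n))
      (1 / 2 * fieldHarmonic ℚ_[p] 2 n) := by
    rw [← two_mul, fieldHarmonic, sum_range_two_mul]
    have e2 : ∑ i ∈ Finset.range n, 1 / (((2 * i + 1 : ℕ) : ℚ_[p]) + 1) ^ 2
        = 1 / 4 * fieldHarmonic ℚ_[p] 2 n := by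
      rw [fieldHarmonic, Finset.mul_sum]
      refine Finset.sum_congr rfl fun i _ => ?_
      have : ((i : ℚ_[p]) + 1) ≠ 0 := by exact_mod_cast i.succ_ne_zero
      push_cast
      rw [show (2 * i + 1 + 1 : ℚ_[p]) = 2 * (i + 1) by ring]
      field_simp
      norm_num
    have e1 : CongrMod (p : ℚ_[p]) (∑ i ∈ Finset.range n, 1 / (((2 * i : ℕ) : ℚ_[p]) + 1) ^ 2)
        (1 / 4 * fieldHarmonic ℚ_[p] 2 n) := by
      rw [← e2, ← Finset.sum_range_reflect (fun i => 1 / (((2 * i + 1 : ℕ) : ℚ_[p]) + 1) ^ 2)]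
      refine .sum fun i hi => ?_
      rw [Finset.mem_range] at hi
      have := one_div_reflect_congrMod (p := p) 2
        (show 2 * i + (2 * (n - 1 - i) + 1) + 2 = p by omega)
      simpa using this
    rw [e2]
    exact (e1.add (.refl _ _)).trans (.of_eq (by ring))
  have h4 := h.symm.trans h'
  have h3' : ‖(3 : ℚ_[p])‖ = 1 := by
    exact_mod_cast norm_natCast_eq_one (p := p) (j := 3) (by omega) h3
  have h5 := (h4.sub (.refl _ (1 / 2 * fieldHarmonic ℚ_[p] 2 n))).mul_left (mem_of_norm_eq_one h2)
  refine .of_mul_unit h3' ((CongrMod.of_eq ?_).trans (h5.trans (.of_eq ?_))) <;> ring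

theorem fermatQuotient_cast (hp1 : 1 < p) :
    (2 : ℚ_[p]) ^ (p - 1) = 1 + p * ((fermatQuotient p 2 : ℚ) : ℚ_[p]) := by
  have : (p : ℚ_[p]) ≠ 0 := by exact_mod_cast (by omega : p ≠ 0)
  rw [fermatQuotient]
  push_cast
  field_simp
  ring

theorem fermatQuotient_mem (h3 : 3 < p) :
    ((fermatQuotient p 2 : ℚ) : ℚ_[p]) ∈ PadicInt.subring p := by
  have hp : (p : ℚ_[p]) ≠ 0 := by exact_mod_cast (by omega : p ≠ 0)
  have hco : IsCoprime (2 : ℤ) (p : ℤ) := by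
    have : Nat.Coprime p 2 := Nat.coprime_of_lt_prime two_ne_zero (by omega) Fact.out
    exact_mod_cast (Nat.isCoprime_iff_coprime.mpr this.symm)
  have h := Int.ModEq.pow_card_sub_one_eq_one (Fact.out : p.Prime) hco
  obtain ⟨z, hz⟩ := (Int.modEq_iff_dvd.mp h.symm)
  have hz' := congrArg (Int.cast : ℤ → ℚ_[p]) hz
  push_cast at hz'
  have : ((fermatQuotient p 2 : ℚ) : ℚ_[p]) = (z : ℚ_[p]) := by
    apply mul_left_cancel₀ hp
    linear_combination hz' - fermatQuotient_cast (p := p) (by omega)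
  rw [this]
  exact intCast_mem _ z

/-- Pascal's rule: consecutive entries of row `p - 1` add up to an entry of row `p`, which is
divisible by `p`. -/
theorem choose_pred_congrMod {k : ℕ} (hk : k < p) :
    CongrMod (p : ℚ_[p]) ((p - 1).choose k : ℚ_[p]) ((-1) ^ k) := by
  induction k with
  | zero => exact .of_eq (by simp)
  | succ k ih =>
    have hpp : p.Prime := Fact.out
    have e : p.choose (k + 1) = (p - 1).choose k + (p - 1).choose (k + 1) := by
      conv_lhs => rw [show p = p - 1 + 1 by omega]
      rw [Nat.choose_succ_succ]
    obtain ⟨z, hz⟩ := hpp.dvd_choose_self k.succ_ne_zero hk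
    have hz' := congrArg (Nat.cast : ℕ → ℚ_[p]) (e.symm.trans hz)
    push_cast at hz'
    obtain ⟨w, hw, ew⟩ := ih (by omega)
    refine ⟨z - w, sub_mem (natCast_mem_subring z) hw, ?_⟩
    rw [pow_succ]
    linear_combination hz' - ew

/-- Replace `(-1)^k` by `C(p-1, k)`. As `p C(p-1, k) / (k+1) = C(p, k+1)`, the sum becomes `(2^p -
2)/p`. -/
theorem alternating_full (h3 : 3 < p) :
    CongrMod (p : ℚ_[p]) (∑ k ∈ Finset.range (p - 1), (-1) ^ k / ((k : ℚ_[p]) + 1))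
      (2 * ((fermatQuotient p 2 : ℚ) : ℚ_[p])) := by
  have hp : (p : ℚ_[p]) ≠ 0 := by exact_mod_cast (by omega : p ≠ 0)
  have e : ∑ k ∈ Finset.range (p - 1), ((p - 1).choose k : ℚ_[p]) / ((k : ℚ_[p]) + 1)
      = 2 * ((fermatQuotient p 2 : ℚ) : ℚ_[p]) := by
    obtain ⟨m, hm⟩ : ∃ m, p = m + 1 := ⟨p - 1, by omega⟩
    have h1 := Nat.sum_range_choose (m + 1)
    rw [Finset.sum_range_succ', Finset.sum_range_succ, Nat.choose_self, Nat.choose_zero_right] at h1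
    have h1' := congrArg (Nat.cast : ℕ → ℚ_[p]) h1
    push_cast at h1'
    apply mul_left_cancel₀ hp
    have h2 := fermatQuotient_cast (p := p) (by omega)
    rw [show p - 1 = m by omega] at h2 ⊢
    have h3 : (p : ℚ_[p]) * ∑ k ∈ Finset.range m, (m.choose k : ℚ_[p]) / ((k : ℚ_[p]) + 1)
        = ∑ k ∈ Finset.range m, ((m + 1).choose (k + 1) : ℚ_[p]) := by
      rw [Finset.mul_sum]
      refine Finset.sum_congr rfl fun k _ => ?_
      have hk : ((k : ℚ_[p]) + 1) ≠ 0 := by exact_mod_cast k.succ_ne_zero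
      have h4 := congrArg (Nat.cast : ℕ → ℚ_[p]) (Nat.add_one_mul_choose_eq m k)
      have hpm := congrArg (Nat.cast : ℕ → ℚ_[p]) hm
      push_cast at h4 hpm
      field_simp
      linear_combination h4 + (m.choose k : ℚ_[p]) * hpm
    rw [h3]
    linear_combination h1' + 2 * h2
  rw [← e]
  refine .sum fun k hk => ?_
  rw [Finset.mem_range] at hk
  have hk1 := norm_natCast_add_one_eq_one (p := p) (j := k) (by omega)
  rw [div_eq_mul_inv, div_eq_mul_inv]
  exact (choose_pred_congrMod (by omega)).symm.mul_right (inv_mem_of_norm_eq_one hk1)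

/-- Under `j ↦ p - j` both the sign and the reciprocal change sign, so the two halves of the full
alternating sum agree modulo `p`. -/
theorem alternating_half (h3 : 3 < p) {n : ℕ} (hn : p = 2 * n + 1) :
    CongrMod (p : ℚ_[p]) (∑ k ∈ Finset.range n, (-1) ^ (k + 1) / ((k : ℚ_[p]) + 1))
      (-((fermatQuotient p 2 : ℚ) : ℚ_[p])) := by
  have h := alternating_full (p := p) h3
  rw [show p - 1 = n + n by omega, sum_range_add_reflect] at h
  have h' : CongrMod (p : ℚ_[p])
      (∑ i ∈ Finset.range n, (-1) ^ (n + (n - 1 - i)) / (((n + (n - 1 - i) : ℕ) : ℚ_[p]) + 1))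
      (∑ k ∈ Finset.range n, (-1) ^ k / ((k : ℚ_[p]) + 1)) := by
    refine .sum fun i hi => ?_
    rw [Finset.mem_range] at hi
    have e := one_div_reflect_congrMod (p := p) 1 (show n + (n - 1 - i) + i + 2 = p by omega)
    have e' := e.mul_left (pow_mem (neg_mem (one_mem _)) (n + (n - 1 - i)) :
      ((-1) ^ (n + (n - 1 - i)) : ℚ_[p]) ∈ PadicInt.subring p)
    have hs : ((-1) ^ (n + (n - 1 - i)) : ℚ_[p]) * (-1) = (-1) ^ i := by
      rw [← pow_succ, neg_one_pow_congr]
      have h1 : n + (n - 1 - i) + 1 + i = 2 * n := by omega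
      grind
    simp only [pow_one] at e'
    rw [← mul_assoc, hs, mul_one_div, mul_one_div] at e'
    exact e'
  have h2 := ((CongrMod.refl _ _).add h'.symm).trans h
  refine .of_mul_unit (d := -2) (by rw [norm_neg]; exact norm_two_eq_one h3)
    ((CongrMod.of_eq ?_).trans (h2.trans (.of_eq ?_)))
  · rw [← two_mul, neg_mul, ← mul_neg, ← Finset.sum_neg_distrib]
    congr 1
    refine Finset.sum_congr rfl fun k _ => ?_
    rw [pow_succ]
    ring
  · ring

/-- The reciprocals of odd numbers cancel, and those of even numbers are doubled. -/
theorem fieldHarmonic_add_alternating {K : Type*} [Field K] [CharZero K] (m : ℕ) :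
    fieldHarmonic K 1 (2 * m) + ∑ k ∈ Finset.range (2 * m), (-1) ^ (k + 1) / ((k : K) + 1)
      = fieldHarmonic K 1 m := by
  rw [fieldHarmonic, fieldHarmonic, sum_range_two_mul, sum_range_two_mul, ← add_assoc,
    add_right_comm (∑ i ∈ Finset.range m, _), add_assoc, ← Finset.sum_add_distrib,
    ← Finset.sum_add_distrib, ← Finset.sum_add_distrib]
  refine Finset.sum_congr rfl fun i _ => ?_
  have h1 : ((i : K) + 1) ≠ 0 := by exact_mod_cast i.succ_ne_zero
  have h2 : (2 * (i : K) + 1) ≠ 0 := by exact_mod_cast (2 * i).succ_ne_zero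
  push_cast
  rw [show (2 * i + 1 + 1 : K) = 2 * (i + 1) by ring]
  simp only [pow_succ, pow_mul]
  field_simp
  ring

/-- `H_{⌊p/4⌋} ≡ H_{(p-1)/2} - q_p(2)` modulo `p`. -/
theorem fieldHarmonic_quarter (h3 : 3 < p) {n m : ℕ} (hn : p = 2 * n + 1)
    (hm : n = 2 * m ∨ n = 2 * m + 1) :
    CongrMod (p : ℚ_[p]) (fieldHarmonic ℚ_[p] 1 m)
      (fieldHarmonic ℚ_[p] 1 n - ((fermatQuotient p 2 : ℚ) : ℚ_[p])) := by
  have h := alternating_half h3 hn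
  have e : fieldHarmonic ℚ_[p] 1 n + ∑ k ∈ Finset.range n, (-1) ^ (k + 1) / ((k : ℚ_[p]) + 1)
      = fieldHarmonic ℚ_[p] 1 m := by
    rw [← fieldHarmonic_add_alternating m]
    rcases hm with rfl | rfl
    · rfl
    · rw [fieldHarmonic_succ, Finset.sum_range_succ, pow_succ, pow_succ, pow_mul]
      push_cast
      ring
  rw [← e, sub_eq_add_neg]
  exact (CongrMod.refl _ _).add h

/-- The top `k` factors of `(p-1)!` are `p - (i+1) = -(i+1)(1 - p/(i+1))`. The identity is exact, so
it can be expanded to second or third order as needed. -/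
theorem factorial_pred_eq_split {m k : ℕ} (hmk : m + k + 1 = p) :
    ((p - 1).factorial : ℚ_[p]) = (-1) ^ k * m.factorial * k.factorial *
      ∏ j ∈ Finset.range k, (1 + (p : ℚ_[p]) * (-(1 / ((j : ℚ_[p]) + 1)))) := by
  have hf : ∀ k : ℕ, (k.factorial : ℚ_[p]) = ∏ j ∈ Finset.range k, ((j : ℚ_[p]) + 1) := fun k => by
    rw [← Finset.prod_range_add_one_eq_factorial]
    push_cast
    rfl
  have hpm := congrArg (Nat.cast : ℕ → ℚ_[p]) hmk
  push_cast at hpm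
  rw [show p - 1 = m + k by omega, hf, prod_range_add_reflect, ← hf, mul_comm ((-1) ^ k),
    mul_assoc, mul_assoc]
  congr 1
  rw [hf k, ← Finset.card_range k, ← Finset.prod_const, Finset.card_range,
    ← Finset.prod_mul_distrib, ← Finset.prod_mul_distrib]
  refine Finset.prod_congr rfl fun i hi => ?_
  rw [Finset.mem_range] at hi
  have h1 : ((i : ℚ_[p]) + 1) ≠ 0 := by exact_mod_cast i.succ_ne_zero
  rw [← hpm]
  push_cast [Nat.cast_sub (show i ≤ k - 1 by omega), Nat.cast_sub (show 1 ≤ k by omega)]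
  field_simp
  ring

theorem neg_one_div_mem {n j : ℕ} (hn : n < p) (hj : j ∈ Finset.range n) :
    -(1 / ((j : ℚ_[p]) + 1)) ∈ PadicInt.subring p := by
  rw [Finset.mem_range] at hj
  exact neg_mem (div_mem_of_norm_eq_one (one_mem _) (norm_natCast_add_one_eq_one (by omega)))

theorem sum_neg_one_div {K : Type*} [Field K] (n : ℕ) :
    ∑ j ∈ Finset.range n, -(1 / ((j : K) + 1)) = -fieldHarmonic K 1 n := by
  simp [fieldHarmonic]

/-- Splitting `(p-1)!` at `m`, modulo `p²`. -/
theorem factorial_pred_split {m k : ℕ} (hmk : m + k + 1 = p) :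
    CongrMod ((p : ℚ_[p]) ^ 2) ((p - 1).factorial : ℚ_[p])
      ((-1) ^ k * m.factorial * k.factorial * (1 - p * fieldHarmonic ℚ_[p] 1 k)) := by
  rw [factorial_pred_eq_split hmk]
  refine .mul_left (mul_mem (mul_mem (pow_mem (neg_mem (one_mem _)) k)
    (natCast_mem_subring _)) (natCast_mem_subring _)) ?_
  refine (prod_one_add_mul_congrMod _ (natCast_mem_subring p)
    fun j hj => neg_one_div_mem (by omega) hj).trans (.of_eq ?_)
  rw [sum_neg_one_div]
  ring

/-- The algebra behind `fieldHarmonic_half`: comparing second-order expansions of two products. -/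
theorem sq_congruence_of_product_expansion {F : Type*} [Field F] (S : Subring F)
    {P q H X z w v : F} (hP0 : P ≠ 0) (h2 : (2 : F) ≠ 0) (hP : P ∈ S) (hhalf : 1 / 2 ∈ S)
    (hq : q ∈ S) (hH : H ∈ S) (hz : z ∈ S) (hw : w ∈ S) (hv : v ∈ S)
    (ez : (1 + P * q) * X - (1 + P * -H + P ^ 2 * (((-H) ^ 2 - P * v) / 2)) = P ^ 3 * z)
    (ew : X - (1 + P * (-H / 2) + P ^ 2 * (((-H / 2) ^ 2 - P * v / 4) / 2)) = P ^ 3 * w) :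
    ∃ r ∈ S, H - (-2 * q + P * q ^ 2) = P ^ 2 * r := by
  have h4 : (4 : F) = 2 * 2 := by norm_num
  have h2m : (2 : F) ∈ S := by exact_mod_cast natCast_mem S 2
  have h3m : (3 : F) ∈ S := by exact_mod_cast natCast_mem S 3
  -- Eliminating `X` from the two expansions and dividing by `P` leaves this quadratic relation; the
  -- terms with `v` carry a third power of `P`.
  obtain ⟨r, hr, er⟩ : ∃ r ∈ S,
      H + 2 * q - P * (3 / 4 * H ^ 2 + q * H) = P ^ 2 * r := by
    refine ⟨2 * (z - w - P * q * w) - q * (H ^ 2 - P * v) * (1 / 2) * (1 / 2)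
      - 3 * v * (1 / 2) * (1 / 2), ?_, ?_⟩
    · apply_rules [sub_mem, mul_mem, pow_mem]
    · rw [h4] at ew ⊢
      field_simp at ez ew ⊢
      apply mul_left_cancel₀ hP0
      linear_combination 4 * ez - (1 + P * q) * ew
  have hs : 3 / 4 * H - q / 2 ∈ S := by
    rw [show 3 / 4 * H - q / 2 = 3 * (1 / 2) * (1 / 2) * H - q * (1 / 2) by rw [h4]; field_simp]
    apply_rules [sub_mem, mul_mem]
  have hs' : 3 / 4 * H ^ 2 + q * H ∈ S := by
    rw [show 3 / 4 * H ^ 2 + q * H = 3 * (1 / 2) * (1 / 2) * H ^ 2 + q * H by rw [h4]; field_simp]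
    apply_rules [add_mem, mul_mem, pow_mem]
  -- Substitute `H ≡ -2q` in the term with coefficient `P`: `3/4 H^2 + qH - q^2 = (H + 2q)(3/4 H -
  -- q/2)`, and `H + 2q` is itself `P` times an element of `S`.
  refine ⟨r + (P * r + (3 / 4 * H ^ 2 + q * H)) * (3 / 4 * H - q / 2),
    add_mem hr (mul_mem (add_mem (mul_mem hP hr) hs') hs), ?_⟩
  rw [h4] at er ⊢
  field_simp at er ⊢
  linear_combination (4 + P * (3 * H - 2 * q)) * er

/-- `H_{(p-1)/2} ≡ -2 q_p(2) + p q_p(2)²` modulo `p²`. -/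
theorem fieldHarmonic_half (h3 : 3 < p) {n : ℕ} (hn : p = 2 * n + 1) :
    CongrMod ((p : ℚ_[p]) ^ 2) (fieldHarmonic ℚ_[p] 1 n)
      (-2 * ((fermatQuotient p 2 : ℚ) : ℚ_[p]) + p * ((fermatQuotient p 2 : ℚ) : ℚ_[p]) ^ 2) := by
  have hp0 : (p : ℚ_[p]) ≠ 0 := by exact_mod_cast (by omega : p ≠ 0)
  have hpn : (p : ℚ_[p]) = 2 * n + 1 := by exact_mod_cast congrArg (Nat.cast : ℕ → ℚ_[p]) hn
  have h2 := norm_two_eq_one h3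
  have hf := norm_factorial_eq_one (p := p) (k := n) (by omega)
  have hf0 := ne_zero_of_norm_eq_one hf
  -- In reverse order the factors of `(1/2)_n` are `p/2 - (i+1)`.
  have e1 : (rising (1 / 2) n : ℚ_[p]) = (-1) ^ n * n.factorial *
      ∏ j ∈ Finset.range n, (1 + (p : ℚ_[p]) * (-(1 / ((j : ℚ_[p]) + 1)) / 2)) := by
    rw [rising, ← Finset.prod_range_reflect, ← Finset.prod_range_add_one_eq_factorial,
      ← Finset.card_range n, ← Finset.prod_const, Finset.card_range]
    push_cast
    rw [← Finset.prod_mul_distrib, ← Finset.prod_mul_distrib]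
    refine Finset.prod_congr rfl fun i hi => ?_
    rw [Finset.mem_range] at hi
    have h1 : ((i : ℚ_[p]) + 1) ≠ 0 := by exact_mod_cast i.succ_ne_zero
    rw [hpn]
    push_cast [Nat.cast_sub (show i ≤ n - 1 by omega), Nat.cast_sub (show 1 ≤ n by omega)]
    field_simp
    ring
  have e2 := centralRatio_eq_choose (K := ℚ_[p]) n
  have e3 : ((p - 1).factorial : ℚ_[p]) = ((2 * n).choose n) * n.factorial ^ 2 := by
    rw [show p - 1 = 2 * n by omega, ← Nat.choose_mul_factorial_mul_factorial
      (show n ≤ 2 * n by omega), show 2 * n - n = n by omega]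
    push_cast
    ring
  have e4 : (4 : ℚ_[p]) ^ n = 1 + p * ((fermatQuotient p 2 : ℚ) : ℚ_[p]) := by
    rw [← fermatQuotient_cast (by omega), show p - 1 = 2 * n by omega, pow_mul]
    norm_num
  -- Two computations of `C(2n, n)`: as `(2n)! / n!^2` with `2n = p - 1`, and as `4^n (1/2)_n / n!`
  -- with `4^n = 2^(p-1)`.
  have key : ∏ j ∈ Finset.range n, (1 + (p : ℚ_[p]) * (-(1 / ((j : ℚ_[p]) + 1))))
      = (1 + p * ((fermatQuotient p 2 : ℚ) : ℚ_[p])) *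
        ∏ j ∈ Finset.range n, (1 + (p : ℚ_[p]) * (-(1 / ((j : ℚ_[p]) + 1)) / 2)) := by
    have hs : ((-1) ^ n : ℚ_[p]) ≠ 0 := pow_ne_zero n (by norm_num)
    apply mul_left_cancel₀ (mul_ne_zero hs (pow_ne_zero 2 hf0))
    rw [sq, ← mul_assoc, ← factorial_pred_eq_split (show n + n + 1 = p by omega), e3, ← e4]
    rw [centralRatio, div_eq_div_iff hf0 (pow_ne_zero n (by norm_num)), e1] at e2
    linear_combination -(n.factorial : ℚ_[p]) * e2
  have hm1 := fun j (hj : j ∈ Finset.range n) => neg_one_div_mem (p := p) (by omega) hj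
  obtain ⟨z, hz, ez⟩ := prod_one_add_mul_congrMod_cube _ h2 (natCast_mem_subring p) hm1
  obtain ⟨w, hw, ew⟩ := prod_one_add_mul_congrMod_cube _ h2 (natCast_mem_subring p)
    fun j hj => div_mem_of_norm_eq_one (hm1 j hj) h2
  obtain ⟨v, hv, ev⟩ := fieldHarmonic_two_half h3 hn
  have s2 : ∑ j ∈ Finset.range n, (-(1 / ((j : ℚ_[p]) + 1))) ^ 2 = fieldHarmonic ℚ_[p] 2 n := by
    simp [fieldHarmonic]
  have s3 : ∑ j ∈ Finset.range n, (-(1 / ((j : ℚ_[p]) + 1)) / 2) ^ 2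
      = fieldHarmonic ℚ_[p] 2 n / 4 := by
    rw [← s2, Finset.sum_div]
    exact Finset.sum_congr rfl fun j _ => by ring
  rw [← Finset.sum_div, sum_neg_one_div, s3] at ew
  rw [sum_neg_one_div, s2] at ez
  rw [key] at ez
  have hq := fermatQuotient_mem (p := p) h3
  have hH := fieldHarmonic_mem (p := p) 1 (show n < p by omega)
  set q : ℚ_[p] := ((fermatQuotient p 2 : ℚ) : ℚ_[p])
  set H := fieldHarmonic ℚ_[p] 1 n
  rw [sub_zero] at ev
  rw [ev] at ez ew
  set X := ∏ j ∈ Finset.range n, (1 + (p : ℚ_[p]) * (-(1 / ((j : ℚ_[p]) + 1)) / 2))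
  refine sq_congruence_of_product_expansion _ hp0 (ne_zero_of_norm_eq_one h2)
    (natCast_mem_subring (p := p) p) (half_mem h3) hq hH hz hw hv ez ew

end HarmonicCongruence

/-! ### Euler numbers and alternating power sums -/

section EulerNumbers

open Polynomial in
/-- The linear functional on polynomials with `X ^ i ↦ E_i`. -/
noncomputable def eulerFunctional : ℤ[X] →ₗ[ℤ] ℤ :=
  (Polynomial.basisMonomials ℤ).constr ℤ eulerNumber

open Polynomial in
theorem eulerFunctional_X_pow (i : ℕ) : eulerFunctional (X ^ i) = eulerNumber i := by
  rw [eulerFunctional, ← Polynomial.monomial_one_right_eq_X_pow]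
  have := (Polynomial.basisMonomials ℤ).constr_basis ℤ eulerNumber i
  rwa [Polynomial.coe_basisMonomials] at this

open Polynomial in
theorem eulerFunctional_X_add_C_pow (t : ℤ) (m : ℕ) :
    eulerFunctional ((X + C t) ^ m)
      = ∑ i ∈ Finset.range (m + 1), t ^ (m - i) * (m.choose i : ℤ) * eulerNumber i := by
  rw [add_pow, map_sum]
  refine Finset.sum_congr rfl fun i _ => ?_
  have h : (X ^ i * C t ^ (m - i) * (m.choose i : ℤ[X]))
      = (t ^ (m - i) * (m.choose i : ℤ)) • X ^ i := by
    rw [Polynomial.smul_eq_C_mul]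
    simp only [map_mul, map_pow, map_natCast]
    ring
  rw [h, map_smul, eulerFunctional_X_pow, smul_eq_mul]

open Polynomial in
-- The umbral form of `(e^t + e^(-t)) ∑ E_n t^n / n! = 2`. Applied to translates of `X^m` it makes
-- alternating power sums telescope.
theorem eulerFunctional_shift (P : ℤ[X]) :
    eulerFunctional (P.comp (X + C 1)) + eulerFunctional (P.comp (X + C (-1))) = 2 * P.eval 0 := by
  induction P using Polynomial.induction_on' with
  | add P Q hP hQ =>
    simp only [Polynomial.add_comp, map_add, Polynomial.eval_add]
    linear_combination hP + hQ
  | monomial n a =>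
    simp only [Polynomial.monomial_comp, ← Polynomial.smul_eq_C_mul, map_smul,
      eulerFunctional_X_add_C_pow, Polynomial.eval_monomial, smul_eq_mul]
    have h := eulerNumber_recurrence n
    rw [← mul_add, ← Finset.sum_add_distrib]
    have h2 : ∑ i ∈ Finset.range (n + 1), ((1 : ℤ) ^ (n - i) * (n.choose i : ℤ) * eulerNumber i
        + (-1) ^ (n - i) * (n.choose i : ℤ) * eulerNumber i) = 2 * if n = 0 then 1 else 0 := by
      rw [← h, Finset.mul_sum]
      refine Finset.sum_congr rfl fun i _ => ?_
      split_ifs with he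
      · rw [he.neg_one_pow, one_pow]; ring
      · rw [(Nat.not_even_iff_odd.mp he).neg_one_pow, one_pow]; ring
    rw [h2, zero_pow_eq]
    ring

open Polynomial in
theorem eulerFunctional_add_pow (t : ℤ) (m : ℕ) :
    eulerFunctional ((X + C (t + 1)) ^ m) + eulerFunctional ((X + C (t - 1)) ^ m) = 2 * t ^ m := by
  have h := eulerFunctional_shift ((X + C t) ^ m)
  simp only [Polynomial.pow_comp, Polynomial.add_comp, Polynomial.X_comp, Polynomial.C_comp,
    Polynomial.eval_pow, Polynomial.eval_add, Polynomial.eval_X, Polynomial.eval_C, zero_add] at h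
  rw [← h]
  congr 3
  · rw [add_comm t 1, C_add, add_assoc]
  · rw [sub_eq_neg_add, C_add, add_assoc]

theorem eulerNumber_odd {n : ℕ} (hn : Odd n) : eulerNumber n = 0 := by
  induction n using Nat.strong_induction_on with
  | _ n ih =>
    have h := eulerNumber_recurrence n
    rw [if_neg (by rintro rfl; simp at hn), Finset.sum_range_succ, Finset.sum_eq_zero] at h
    · simpa using h
    · intro k hk
      rw [Finset.mem_range] at hk
      split_ifs with he
      · rw [ih k hk (by grind), mul_zero]
      · rfl

open Polynomial in
theorem eulerFunctional_X_add_one_pow {m : ℕ} (hm : Even m) (hm0 : m ≠ 0) :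
    eulerFunctional ((X + C 1) ^ m) = 0 := by
  have h := eulerNumber_recurrence m
  rw [if_neg hm0] at h
  rw [eulerFunctional_X_add_C_pow, ← h]
  refine Finset.sum_congr rfl fun i hi => ?_
  rw [Finset.mem_range] at hi
  split_ifs with he
  · simp
  · rw [eulerNumber_odd (by grind), mul_zero]

open Polynomial in
/-- Alternating sums of even powers of even numbers. -/
theorem alternating_pow_sum {m : ℕ} (hm : Even m) (hm0 : m ≠ 0) (n : ℕ) :
    2 * ∑ j ∈ Finset.range n, (-1) ^ (j + 1) * (2 * ((j : ℤ) + 1)) ^ m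
      = (-1) ^ n * eulerFunctional ((X + C (2 * (n : ℤ) + 1)) ^ m) := by
  induction n with
  | zero => simpa using (eulerFunctional_X_add_one_pow hm hm0).symm
  | succ n ih =>
    have h := eulerFunctional_add_pow (2 * ((n : ℤ) + 1)) m
    rw [Finset.sum_range_succ, mul_add, ih]
    rw [show 2 * ((n : ℤ) + 1) - 1 = 2 * n + 1 by ring] at h
    push_cast
    rw [pow_succ]
    linear_combination (-1) ^ n * h

open Polynomial in
-- The linear term in `t` carries `E_{m-1}`, which is zero since `m - 1` is odd.
theorem eulerFunctional_X_add_C_pow_modEq (t : ℤ) {m : ℕ} (hm : Even m) (hm0 : m ≠ 0) :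
    t ^ 2 ∣ eulerFunctional ((X + C t) ^ m) - eulerNumber m := by
  obtain ⟨k, rfl⟩ : ∃ k, m = k + 2 := ⟨m - 2, by grind⟩
  rw [eulerFunctional_X_add_C_pow, Finset.sum_range_succ, Finset.sum_range_succ,
    eulerNumber_odd (show Odd (k + 1) by grind)]
  simp only [Nat.sub_self, pow_zero, Nat.choose_self, Nat.cast_one, one_mul, mul_zero, add_zero,
    add_sub_cancel_right]
  refine Finset.dvd_sum fun i hi => ?_
  rw [Finset.mem_range] at hi
  rw [show k + 2 - i = (k - i) + 2 by omega, pow_add, mul_assoc, mul_assoc]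
  exact Dvd.dvd.mul_left (Dvd.intro _ rfl) _

variable {p : ℕ} [Fact p.Prime]

theorem alternating_pow_sum_congrMod {n m : ℕ} (hn : p = 2 * n + 1) (hne : Even n) (hm : Even m)
    (hm0 : m ≠ 0) :
    CongrMod ((p : ℚ_[p]) ^ 2)
      (2 ^ (m + 1) * ∑ j ∈ Finset.range n, (-1) ^ (j + 1) * ((j : ℚ_[p]) + 1) ^ m)
      (eulerNumber m : ℚ_[p]) := by
  obtain ⟨z, hz⟩ := eulerFunctional_X_add_C_pow_modEq (p : ℤ) hm hm0
  have h := alternating_pow_sum hm hm0 n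
  rw [hne.neg_one_pow, one_mul, show (2 * (n : ℤ) + 1) = (p : ℤ) by rw [hn]; push_cast; ring] at h
  rw [← h] at hz
  have hz' := congrArg (Int.cast : ℤ → ℚ_[p]) hz
  push_cast at hz'
  refine ⟨z, intCast_mem _ z, ?_⟩
  rw [← hz', pow_succ', mul_assoc, Finset.mul_sum]
  congr 2
  refine Finset.sum_congr rfl fun j _ => ?_
  rw [mul_pow]
  ring

theorem pow_card_sub_one_congrMod {j : ℕ} (hj : j + 1 < p) :
    CongrMod (p : ℚ_[p]) (((j : ℚ_[p]) + 1) ^ (p - 1)) 1 := by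
  have hco : IsCoprime ((j + 1 : ℕ) : ℤ) (p : ℤ) :=
    Nat.isCoprime_iff_coprime.mpr (Nat.coprime_of_lt_prime j.succ_ne_zero hj Fact.out).symm
  have h := Int.ModEq.pow_card_sub_one_eq_one (Fact.out : p.Prime) hco
  obtain ⟨z, hz⟩ := (Int.modEq_iff_dvd.mp h.symm)
  have hz' := congrArg (Int.cast : ℤ → ℚ_[p]) hz
  push_cast at hz'
  exact ⟨z, intCast_mem _ z, hz'⟩

/-- Squaring Fermat's congruence, `(x^(p-1) - 1)^2 ≡ 0` modulo `p^2`, so `x^(-2) ≡ 2 x^(p-3) -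
x^(2p-4)`. The two positive power sums are then given by Euler numbers, up to powers of two. -/
theorem alternating_inv_sq_congrMod (h3 : 3 < p) {n : ℕ} (hn : p = 2 * n + 1) (hne : Even n) :
    CongrMod ((p : ℚ_[p]) ^ 2)
      (∑ j ∈ Finset.range n, (-1) ^ (j + 1) / ((j : ℚ_[p]) + 1) ^ 2)
      ((4 * eulerNumber (p - 3) - 2 * eulerNumber (2 * p - 4) : ℤ) : ℚ_[p]) := by
  set A : ℕ → ℚ_[p] := fun m => ∑ j ∈ Finset.range n, (-1) ^ (j + 1) * ((j : ℚ_[p]) + 1) ^ m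
    with hA
  have hAm : ∀ m, A m ∈ PadicInt.subring p := fun m => sum_mem fun j _ =>
    mul_mem (pow_mem (neg_mem (one_mem _)) _)
      (pow_mem (add_mem (natCast_mem_subring j) (one_mem _)) m)
  have h1 := alternating_pow_sum_congrMod hn hne (show Even (p - 3) by grind) (by grind)
  have h2 := alternating_pow_sum_congrMod hn hne (show Even (2 * p - 4) by grind) (by omega)
  have hsum : CongrMod ((p : ℚ_[p]) ^ 2)
      (∑ j ∈ Finset.range n, (-1) ^ (j + 1) / ((j : ℚ_[p]) + 1) ^ 2)
      (2 * A (p - 3) - A (2 * p - 4)) := by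
    simp only [hA]
    rw [Finset.mul_sum, ← Finset.sum_sub_distrib]
    refine .sum fun j hj => ?_
    rw [Finset.mem_range] at hj
    have hj1 := norm_natCast_add_one_eq_one (p := p) (j := j) (by omega)
    have hj0 := ne_zero_of_norm_eq_one hj1
    obtain ⟨z, hz, e⟩ := pow_card_sub_one_congrMod (p := p) (j := j) (by omega)
    refine ⟨(-1) ^ (j + 1) * z ^ 2 * (((j : ℚ_[p]) + 1)⁻¹) ^ 2, mul_mem (mul_mem
      (pow_mem (neg_mem (one_mem _)) _) (pow_mem hz 2))
      (pow_mem (inv_mem_of_norm_eq_one hj1) 2), ?_⟩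
    rw [show 2 * p - 4 = (p - 3) + (p - 3) + 2 by omega]
    rw [show p - 1 = (p - 3) + 2 by omega, pow_add] at e
    generalize ((j : ℚ_[p]) + 1) = x at *
    simp only [pow_add]
    field_simp
    linear_combination -(x ^ (p - 3) * x ^ 2 - 1 + p * z) * e
  have hdiff : CongrMod (p : ℚ_[p]) (A (p - 3)) (A (2 * p - 4)) := by
    refine .sum fun j hj => ?_
    rw [Finset.mem_range] at hj
    obtain ⟨z, hz, e⟩ := pow_card_sub_one_congrMod (p := p) (j := j) (by omega)
    refine ⟨-((-1) ^ (j + 1) * ((j : ℚ_[p]) + 1) ^ (p - 3) * z), neg_mem (mul_mem (mul_mem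
      (pow_mem (neg_mem (one_mem _)) _) (pow_mem (add_mem (natCast_mem_subring j) (one_mem _)) _))
      hz), ?_⟩
    rw [show 2 * p - 4 = (p - 3) + (p - 1) by omega, pow_add _ (p - 3)]
    linear_combination -((-1) ^ (j + 1) * ((j : ℚ_[p]) + 1) ^ (p - 3)) * e
  have hg := fermatQuotient_cast (p := p) (by omega)
  have hq := fermatQuotient_mem (p := p) h3
  set q := ((fermatQuotient p 2 : ℚ) : ℚ_[p])
  have two_mem : (2 : ℚ_[p]) ∈ PadicInt.subring p := mem_of_norm_eq_one (norm_two_eq_one h3)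
  have four_mem : (4 : ℚ_[p]) ∈ PadicInt.subring p := by
    exact_mod_cast natCast_mem_subring (p := p) 4
  have h5 := (h1.mul_left four_mem).sub (h2.mul_left two_mem)
  obtain ⟨w, hw, ew⟩ := hdiff
  -- The powers of two are harmless. With `g = 2^(p-1) = 1 + pq` the right side is `2g A(p-3) - g^2
  -- A(2p-4)`; its deviation from the left is first order in `p` only through `A(p-3) - A(2p-4)`,
  -- which is itself divisible by `p`.
  have h6 : CongrMod ((p : ℚ_[p]) ^ 2) (2 * A (p - 3) - A (2 * p - 4))
      (4 * (2 ^ (p - 3 + 1) * A (p - 3)) - 2 * (2 ^ (2 * p - 4 + 1) * A (2 * p - 4))) := by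
    have e1 : (4 : ℚ_[p]) * 2 ^ (p - 3 + 1) = 2 * (1 + p * q) := by
      rw [← hg, show p - 1 = p - 3 + 1 + 1 by omega, pow_succ _ (p - 3 + 1)]
      ring
    have e2 : (2 : ℚ_[p]) * 2 ^ (2 * p - 4 + 1) = (1 + p * q) ^ 2 := by
      rw [← hg, ← pow_succ', ← pow_mul]
      congr 1
      omega
    rw [← mul_assoc, ← mul_assoc, e1, e2]
    refine ⟨q ^ 2 * A (2 * p - 4) - 2 * q * w, sub_mem (mul_mem (pow_mem hq 2) (hAm _))
      (mul_mem (mul_mem two_mem hq) hw), ?_⟩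
    linear_combination (-2 * p * q) * ew
  refine hsum.trans (h6.trans (h5.trans (.of_eq ?_)))
  push_cast
  ring

end EulerNumbers

/-! ### The value of Γ_p(1/4)⁴ modulo p² -/

section GammaQuarter

/-- The factors of Morita's product. -/
def coprimeFactor (p k : ℕ) : ℕ := if Nat.Coprime k p then k else 1

theorem moritaSeq_eq (p m : ℕ) :
    moritaSeq p m = (-1) ^ m * ∏ k ∈ Finset.range m, (coprimeFactor p k : ℤ) := by
  rw [moritaSeq, Finset.prod_filter]
  congr 1
  refine Finset.prod_congr rfl fun k _ => ?_
  rw [coprimeFactor]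
  split_ifs <;> simp

variable {p : ℕ} [Fact p.Prime]

/-- Passing to `ℤ_p / p^2` turns the comparison of products into algebra in a commutative ring with
`P^2 = 0`. -/
theorem congrMod_sq_iff (x y : ℤ_[p]) :
    CongrMod ((p : ℚ_[p]) ^ 2) (x : ℚ_[p]) (y : ℚ_[p]) ↔
      Ideal.Quotient.mk (Ideal.span {(p : ℤ_[p]) ^ 2}) x
        = Ideal.Quotient.mk (Ideal.span {(p : ℤ_[p]) ^ 2}) y := by
  rw [Ideal.Quotient.eq, Ideal.mem_span_singleton]
  constructor
  · rintro ⟨z, hz, e⟩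
    refine ⟨⟨z, hz⟩, ?_⟩
    apply Subtype.ext
    push_cast
    exact e
  · rintro ⟨z, e⟩
    refine ⟨z, z.2, ?_⟩
    rw [← PadicInt.coe_sub, e]
    push_cast
    rfl

theorem natCast_sq_eq_zero_quotient (p : ℕ) [Fact p.Prime] :
    (p : ℤ_[p] ⧸ Ideal.span {(p : ℤ_[p]) ^ 2}) ^ 2 = 0 := by
  have : Ideal.Quotient.mk (Ideal.span {(p : ℤ_[p]) ^ 2}) ((p : ℤ_[p]) ^ 2) = 0 :=
    Ideal.Quotient.eq_zero_iff_mem.mpr (Ideal.mem_span_singleton_self _)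
  rwa [map_pow, map_natCast] at this

theorem CongrMod.scale_p {x y : ℚ_[p]} (h : CongrMod (p : ℚ_[p]) x y) :
    CongrMod ((p : ℚ_[p]) ^ 2) ((p : ℚ_[p]) * x) ((p : ℚ_[p]) * y) := by
  rw [sq]
  exact h.scale _

theorem padicCongr_iff (r : ℕ) (a b : ℚ_[p]) :
    PadicCongr p r a b ↔ CongrMod ((p : ℚ_[p]) ^ r) a b :=
  ⟨fun ⟨z, h⟩ => ⟨z, z.2, h⟩, fun ⟨z, hz, h⟩ => ⟨⟨z, hz⟩, h⟩⟩

/-- The natural number `(1 + 3p^2)/4` differs from `1/4` by a multiple of `p^2`, and `Γ_p` does not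
increase distances. -/
theorem padicGamma_quarter_congrMod (h3 : 3 < p) {m : ℕ} (hm : 4 * m = 1 + 3 * p ^ 2) :
    CongrMod ((p : ℚ_[p]) ^ 2) (padicGamma p (padicQuarter p h3) : ℚ_[p])
      (moritaSeq p m : ℚ_[p]) := by
  have hp0 : (p : ℚ_[p]) ^ 2 ≠ 0 := pow_ne_zero 2 (by exact_mod_cast (by omega : p ≠ 0))
  have hd := padicGamma_dist_natCast p (by omega) (padicQuarter p h3) m
  rw [dist_eq_norm, dist_eq_norm, PadicInt.norm_def, PadicInt.norm_def] at hd
  push_cast at hd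
  have hq : ((padicQuarter p h3 : ℤ_[p]) : ℚ_[p]) = 1 / 4 := rfl
  have hm' := congrArg (Nat.cast : ℕ → ℚ_[p]) hm
  push_cast at hm'
  have h3n : ‖(3 : ℚ_[p])‖ = 1 := by
    exact_mod_cast norm_natCast_eq_one (p := p) (j := 3) (by omega) h3
  have h4n : ‖(4 : ℚ_[p])‖ = 1 := by
    rw [show (4 : ℚ_[p]) = 2 * 2 by norm_num, norm_mul, norm_two_eq_one h3, one_mul]
  have e : ((padicQuarter p h3 : ℤ_[p]) : ℚ_[p]) - m = -(3 / 4) * p ^ 2 := by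
    rw [hq]
    linear_combination -(1 / 4) * hm'
  rw [e, norm_mul, norm_neg, norm_div, h3n, h4n, div_one, one_mul] at hd
  refine ⟨((padicGamma p (padicQuarter p h3) : ℚ_[p]) - moritaSeq p m) / p ^ 2, ?_, ?_⟩
  · rw [PadicInt.mem_subring_iff, norm_div]
    exact div_le_one_of_le₀ hd (norm_nonneg _)
  · rw [mul_div_cancel₀ _ hp0]

/-- The first entry `Qp` of the block is omitted from Morita's product; the others are `x (1 +
pQ/x)` for `1 ≤ x ≤ R`. -/
theorem coprimeFactor_block (Q : ℕ) {R : ℕ} (hR : R < p) :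
    CongrMod ((p : ℚ_[p]) ^ 2)
      (∏ x ∈ Finset.range (R + 1), (coprimeFactor p (Q * p + x) : ℚ_[p]))
      (R.factorial * (1 + p * (Q * fieldHarmonic ℚ_[p] 1 R))) := by
  have hpp : p.Prime := Fact.out
  have h0 : coprimeFactor p (Q * p + 0) = 1 := by
    rw [coprimeFactor, if_neg]
    rw [add_zero, Nat.coprime_comm, hpp.coprime_iff_not_dvd, not_not]
    exact Dvd.intro_left Q rfl
  rw [Finset.prod_range_succ', h0, Nat.cast_one, mul_one]
  have e : ∏ x ∈ Finset.range R, (coprimeFactor p (Q * p + (x + 1)) : ℚ_[p])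
      = R.factorial * ∏ x ∈ Finset.range R, (1 + (p : ℚ_[p]) * (Q * (1 / ((x : ℚ_[p]) + 1)))) := by
    rw [← Finset.prod_range_add_one_eq_factorial]
    push_cast
    rw [← Finset.prod_mul_distrib]
    refine Finset.prod_congr rfl fun x hx => ?_
    rw [Finset.mem_range] at hx
    have h1 : ((x : ℚ_[p]) + 1) ≠ 0 := by exact_mod_cast x.succ_ne_zero
    rw [coprimeFactor, if_pos]
    · push_cast
      field_simp
      ring
    · rw [Nat.coprime_comm, hpp.coprime_iff_not_dvd, ← Nat.dvd_add_iff_right (Dvd.intro_left Q rfl)]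
      exact Nat.not_dvd_of_pos_of_lt x.succ_pos (by omega)
  rw [e]
  refine .mul_left (natCast_mem_subring _) ?_
  have h := prod_one_add_mul_congrMod (p := p) (Finset.range R) (natCast_mem_subring p)
    (z := fun x => (Q : ℚ_[p]) * (1 / ((x : ℚ_[p]) + 1))) fun x hx => by
      rw [Finset.mem_range] at hx
      exact mul_mem (natCast_mem_subring Q)
        (div_mem_of_norm_eq_one (one_mem _) (norm_natCast_add_one_eq_one (by omega)))
  refine h.trans (.of_eq ?_)
  rw [← Finset.mul_sum]
  simp [fieldHarmonic]

/-- A full block contributes `(p-1)!`, because its first-order correction contains `H_{p-1}`, which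
vanishes modulo `p`. -/
theorem coprimeFactor_blocks {n : ℕ} (hn : p = 2 * n + 1) (Q : ℕ) :
    CongrMod ((p : ℚ_[p]) ^ 2)
      (∏ x ∈ Finset.range (Q * p), (coprimeFactor p x : ℚ_[p])) ((p - 1).factorial ^ Q) := by
  have hpp : p.Prime := Fact.out
  induction Q with
  | zero => exact .of_eq (by simp)
  | succ Q ih =>
    have h := coprimeFactor_block (p := p) Q (R := p - 1) (by have := hpp.pos; omega)
    rw [show p - 1 + 1 = p by have := hpp.pos; omega] at h
    obtain ⟨z, hz, e⟩ := fieldHarmonic_one_full (p := p) hn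
    have h' : CongrMod ((p : ℚ_[p]) ^ 2) (((p - 1).factorial : ℚ_[p]) *
        (1 + (p : ℚ_[p]) * ((Q : ℚ_[p]) * fieldHarmonic ℚ_[p] 1 (p - 1)))) ((p - 1).factorial : ℚ_[p]) := by
      refine ⟨(p - 1).factorial * Q * z, mul_mem (mul_mem (natCast_mem_subring _)
        (natCast_mem_subring _)) hz, ?_⟩
      linear_combination ((p - 1).factorial * p * Q : ℚ_[p]) * e
    rw [add_mul, one_mul, Finset.prod_range_add, pow_succ _ Q]
    exact ih.mul (h.trans h') (prod_mem fun x _ => natCast_mem_subring _) (natCast_mem_subring _)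

theorem moritaSeq_pow_four_congrMod {n : ℕ} (hn : p = 2 * n + 1) (Q : ℕ) {R : ℕ} (hR : R < p) :
    CongrMod ((p : ℚ_[p]) ^ 2) ((moritaSeq p (Q * p + (R + 1)) : ℚ_[p]) ^ 4)
      ((((p - 1).factorial : ℚ_[p]) ^ Q *
        ((R.factorial : ℚ_[p]) * (1 + (p : ℚ_[p]) * ((Q : ℚ_[p]) * fieldHarmonic ℚ_[p] 1 R)))) ^ 4) := by
  have e : (moritaSeq p (Q * p + (R + 1)) : ℚ_[p]) ^ 4
      = ((∏ x ∈ Finset.range (Q * p), (coprimeFactor p x : ℚ_[p])) *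
        ∏ x ∈ Finset.range (R + 1), (coprimeFactor p (Q * p + x) : ℚ_[p])) ^ 4 := by
    rw [moritaSeq_eq, Finset.prod_range_add]
    push_cast
    rw [mul_pow, ← pow_mul, mul_comm _ 4, pow_mul]
    norm_num
  have hm : ∀ f : ℕ → ℕ, ∀ N, ∏ x ∈ Finset.range N, (f x : ℚ_[p]) ∈ PadicInt.subring p :=
    fun f N => prod_mem fun x _ => natCast_mem_subring _
  have hr : (R.factorial * (1 + p * (Q * fieldHarmonic ℚ_[p] 1 R)) : ℚ_[p]) ∈ PadicInt.subring p :=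
    mul_mem (natCast_mem_subring _) (add_mem (one_mem _) (mul_mem (natCast_mem_subring _)
      (mul_mem (natCast_mem_subring _) (fieldHarmonic_mem 1 hR))))
  rw [e]
  exact ((coprimeFactor_blocks hn Q).mul (coprimeFactor_block Q hR) (hm _ _) hr).pow
    (mul_mem (hm _ _) (hm _ _)) (mul_mem (pow_mem (natCast_mem_subring _) _) hr) 4

theorem wilson_congrMod : CongrMod (p : ℚ_[p]) ((p - 1).factorial : ℚ_[p]) (-1) := by
  have h : (((p - 1).factorial + 1 : ℤ) : ZMod p) = 0 := by
    push_cast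
    rw [ZMod.wilsons_lemma]
    ring
  obtain ⟨w, hw⟩ := (ZMod.intCast_zmod_eq_zero_iff_dvd _ _).mp h
  have hw' := congrArg (Int.cast : ℤ → ℚ_[p]) hw
  push_cast at hw'
  exact ⟨w, intCast_mem _ w, by linear_combination hw'⟩

/-- Wilson's congruence holds modulo `p` only; raising to the power `p` gains one more factor `p`.
-/
theorem factorial_pred_pow_congrMod {n : ℕ} (hn : p = 2 * n + 1) :
    CongrMod ((p : ℚ_[p]) ^ 2) (((p - 1).factorial : ℚ_[p]) ^ p) (-1) := by
  obtain ⟨w, hw, ew⟩ := wilson_congrMod (p := p)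
  have e : ((p - 1).factorial : ℚ_[p]) = -(1 + p * -w) := by linear_combination ew
  have h1 := prod_one_add_mul_congrMod (p := p) (Finset.range p) (natCast_mem_subring p)
    (z := fun _ => -w) fun _ _ => neg_mem hw
  rw [Finset.prod_const, Finset.card_range, Finset.sum_const, Finset.card_range,
    nsmul_eq_mul] at h1
  have hodd : Odd p := ⟨n, hn⟩
  rw [e, hodd.neg_pow]
  refine (h1.trans ?_).neg
  exact ⟨-w, neg_mem hw, by ring⟩

theorem rising_half_eq {K : Type*} [Field K] [CharZero K] (m : ℕ) :
    rising (1 / 2 : K) m * (m.factorial * 4 ^ m) = (2 * m).factorial := by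
  induction m with
  | zero => simp
  | succ m ih =>
    rw [show 2 * (m + 1) = 2 * m + 1 + 1 by ring, rising_succ, Nat.factorial_succ (2 * m + 1),
      Nat.factorial_succ (2 * m), Nat.factorial_succ]
    push_cast
    rw [← ih]
    ring

theorem rising_three_halves_eq {K : Type*} [Field K] [CharZero K] (m : ℕ) :
    rising (3 / 2 : K) m * (m.factorial * 4 ^ m) = (2 * m + 1).factorial := by
  induction m with
  | zero => simp
  | succ m ih =>
    rw [show 2 * (m + 1) + 1 = 2 * m + 1 + 1 + 1 by ring, rising_succ,
      Nat.factorial_succ (2 * m + 1 + 1), Nat.factorial_succ (2 * m + 1), Nat.factorial_succ m]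
    push_cast
    rw [← ih]
    ring

/-- Dictionary for `p = 4m + 1`: `W, A, B, N` are the factorials of `p - 1, 3m, m, 2m`; `h, h', Hn`
are the harmonic numbers of index `m, 3m, 2m`; `U` is `centralRatio` squared and `G` is
`Γ_p(1/4)^4`. Both sides carry a factor that is a unit in the application, so that no division is
needed here. -/
theorem gamma_product_comparison_one {R : Type*} [CommRing R] {P q h h' Hn W A B N s G U Q : R}
    {Qn pn : ℕ} (hP : P ^ 2 = 0) (hQ : 4 * Q = 3 * P - 3) (hQn : 4 * Qn + 3 = 3 * pn)
    (hW : W ^ pn = -1) (hs : s ^ 2 = 1) (hsplit : W = s * A * B * (1 - P * h))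
    (hhalf : W = N ^ 2 * (1 - P * Hn)) (hh' : P * h' = P * h) (hh : P * h = P * (Hn - q))
    (hU : U * (B ^ 4 * (1 + P * q)) = N ^ 2)
    (hG : G = (W ^ Qn * (A * (1 + P * (Q * h')))) ^ 4) :
    B ^ 4 * (1 + P * q) * W ^ 3 * (1 - P * h) ^ 4 * U
      = B ^ 4 * (1 + P * q) * W ^ 3 * (1 - P * h) ^ 4 * -G := by
  -- The exponents add up to `3p`, and `W^p = -1`.
  have e1 : W ^ (4 * Qn) * W ^ 3 = -1 := by
    rw [← pow_add, hQn, mul_comm, pow_mul, hW]; ring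
  have e2 : (1 + P * (Q * h')) ^ 4 = 1 - 3 * P * h := by
    linear_combination (6 * Q ^ 2 * h' ^ 2 + 4 * P * Q ^ 3 * h' ^ 3 + P ^ 2 * Q ^ 4 * h' ^ 4
      + 3 * h') * hP + P * h' * hQ - 3 * hh'
  have e3 : (1 - P * h) ^ 4 = 1 - 4 * P * h := by
    linear_combination (6 * h ^ 2 - 4 * P * h ^ 3 + P ^ 2 * h ^ 4) * hP
  have e4 : (1 + P * q) * (1 - 3 * P * h) * (1 - P * Hn) = 1 - 4 * P * h := by
    linear_combination (-3 * h * q - q * Hn + 3 * h * Hn + 3 * P * q * h * Hn) * hP + hh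
  have e5 : G * W ^ 3 = -(A ^ 4 * (1 - 3 * P * h)) := by
    rw [hG, mul_pow, mul_pow, ← pow_mul, mul_comm Qn 4, e2]
    linear_combination A ^ 4 * (1 - 3 * P * h) * e1
  have e6 : A ^ 4 * B ^ 4 * (1 - P * h) ^ 4 = W ^ 4 := by
    have : s ^ 4 = 1 := by linear_combination (s ^ 2 + 1) * hs
    rw [show W ^ 4 = (s * A * B * (1 - P * h)) ^ 4 by rw [← hsplit]]
    linear_combination -(A * B * (1 - P * h)) ^ 4 * this
  have e7 : W ^ 4 = W ^ 3 * (N ^ 2 * (1 - P * Hn)) := by rw [← hhalf]; ring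
  calc B ^ 4 * (1 + P * q) * W ^ 3 * (1 - P * h) ^ 4 * U
      = N ^ 2 * W ^ 3 * (1 - 4 * P * h) := by rw [← e3, ← hU]; ring
    _ = (1 + P * q) * (1 - 3 * P * h) * (W ^ 3 * (N ^ 2 * (1 - P * Hn))) := by rw [← e4]; ring
    _ = (1 + P * q) * (1 - 3 * P * h) * (A ^ 4 * B ^ 4 * (1 - P * h) ^ 4) := by rw [e6, e7]
    _ = _ := by linear_combination (B ^ 4 * (1 + P * q) * (1 - P * h) ^ 4) * e5

/-- Dictionary for `p = 4m + 3`: `W, B, N` are the factorials of `p - 1, m, 2m + 1`, and `h, Hn` are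
the harmonic numbers of index `m, 2m + 1`. Here only the harmonic number of index `m` enters `G`,
and no reflection is needed. -/
theorem gamma_product_comparison_three {R : Type*} [CommRing R] {P q h Hn W B N G V Q : R}
    {Qn pn : ℕ} (hP : P ^ 2 = 0) (hQ : 4 * Q = 3 * P - 1) (hQn : 4 * Qn + 1 = 3 * pn)
    (hW : W ^ pn = -1) (hhalf : W = -(N ^ 2 * (1 - P * Hn))) (hh : P * h = P * (Hn - q))
    (hV : 4 * V * N ^ 2 = B ^ 4 * (1 + P * q))
    (hG : G = (W ^ Qn * (B * (1 + P * (Q * h)))) ^ 4) :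
    W * (4 * V) = W * G := by
  have e1 : W ^ (4 * Qn) * W = -1 := by
    rw [← pow_succ, hQn, mul_comm, pow_mul, hW]; ring
  have e2 : (1 + P * (Q * h)) ^ 4 = 1 - P * h := by
    linear_combination (6 * Q ^ 2 * h ^ 2 + 4 * P * Q ^ 3 * h ^ 3 + P ^ 2 * Q ^ 4 * h ^ 4
      + 3 * h) * hP + P * h * hQ
  have e3 : W * G = -(B ^ 4 * (1 - P * h)) := by
    rw [hG, mul_pow, mul_pow, ← pow_mul, mul_comm Qn 4, e2]
    linear_combination B ^ 4 * (1 - P * h) * e1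
  rw [e3, hhalf]
  linear_combination -(1 - P * Hn) * hV + B ^ 4 * q * Hn * hP - B ^ 4 * hh

theorem centralRatio_sq_congrMod_gamma (h3 : 3 < p) {m : ℕ} (hm : p = 4 * m + 1) :
    CongrMod ((p : ℚ_[p]) ^ 2) (centralRatio ℚ_[p] m ^ 2)
      (-(padicGamma p (padicQuarter p h3) : ℚ_[p]) ^ 4) := by
  have hn : p = 2 * (2 * m) + 1 := by omega
  -- For `p = 4m + 1`, `(1 + 3p^2)/4` in base `p`: `3m` full blocks and a last block ending at `R =
  -- 3m`.
  have hG := padicGamma_quarter_congrMod h3 (m := 3 * m * p + (3 * m + 1)) (by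
    rw [hm]; ring)
  have hGm : ∀ z : ℤ_[p], (z : ℚ_[p]) ∈ PadicInt.subring p := fun z => z.2
  have hG4 := (hG.pow (hGm _) (intCast_mem _ _) 4).trans
    (moritaSeq_pow_four_congrMod hn (3 * m) (R := 3 * m) (by omega))
  have hW := factorial_pred_pow_congrMod hn
  have hsplit := factorial_pred_split (p := p) (show 3 * m + m + 1 = p by omega)
  have hhalf := factorial_pred_split (p := p) (show 2 * m + 2 * m + 1 = p by omega)
  have hh' := (fieldHarmonic_one_reflect (p := p) hn (show 3 * m + m + 1 = p by omega)).scale_p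
  have hh := (fieldHarmonic_quarter h3 hn (m := m) (.inl rfl)).scale_p
  have hU : centralRatio ℚ_[p] m ^ 2 * ((m.factorial : ℚ_[p]) ^ 4 *
      (1 + p * ((fermatQuotient p 2 : ℚ) : ℚ_[p]))) = ((2 * m).factorial : ℚ_[p]) ^ 2 := by
    have e := rising_half_eq (K := ℚ_[p]) m
    have hf : (m.factorial : ℚ_[p]) ≠ 0 := by exact_mod_cast m.factorial_ne_zero
    rw [← fermatQuotient_cast (by omega), ← e, centralRatio, show p - 1 = 2 * m * 2 by omega,
      pow_mul, pow_mul]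
    norm_num
    field_simp
  have hWn := norm_factorial_eq_one (p := p) (k := p - 1) (by omega)
  have hBn := norm_factorial_eq_one (p := p) (k := m) (by omega)
  have hgn : ‖(1 + p * ((fermatQuotient p 2 : ℚ) : ℚ_[p]))‖ = 1 := by
    rw [← fermatQuotient_cast (by omega), norm_pow, norm_two_eq_one h3, one_pow]
  have hqm := fermatQuotient_mem (p := p) h3
  have hhm := fieldHarmonic_mem (p := p) 1 (show m < p by omega)
  have hh3m := fieldHarmonic_mem (p := p) 1 (show 3 * m < p by omega)
  have hh2m := fieldHarmonic_mem (p := p) 1 (show 2 * m < p by omega)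
  have hfn : ‖1 - p * fieldHarmonic ℚ_[p] 1 m‖ = 1 :=
    norm_eq_one_of_congrMod (y := 1) ⟨-fieldHarmonic ℚ_[p] 1 m, neg_mem hhm, by ring⟩ norm_one
  have hUm : centralRatio ℚ_[p] m ^ 2 ∈ PadicInt.subring p :=
    pow_mem (div_mem_of_norm_eq_one (rising_mem (half_mem h3) m) hBn) 2
  set q := ((fermatQuotient p 2 : ℚ) : ℚ_[p])
  obtain ⟨q', hq'⟩ : ∃ z : ℤ_[p], (z : ℚ_[p]) = q := ⟨⟨_, hqm⟩, rfl⟩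
  obtain ⟨h1', hh1'⟩ : ∃ z : ℤ_[p], (z : ℚ_[p]) = fieldHarmonic ℚ_[p] 1 m := ⟨⟨_, hhm⟩, rfl⟩
  obtain ⟨h2', hh2'⟩ : ∃ z : ℤ_[p], (z : ℚ_[p]) = fieldHarmonic ℚ_[p] 1 (2 * m) := ⟨⟨_, hh2m⟩, rfl⟩
  obtain ⟨h3', hh3'⟩ : ∃ z : ℤ_[p], (z : ℚ_[p]) = fieldHarmonic ℚ_[p] 1 (3 * m) := ⟨⟨_, hh3m⟩, rfl⟩
  obtain ⟨U', hU'⟩ : ∃ z : ℤ_[p], (z : ℚ_[p]) = centralRatio ℚ_[p] m ^ 2 := ⟨⟨_, hUm⟩, rfl⟩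
  rw [← hq'] at hU hgn hh
  rw [← hh1'] at hsplit hh' hh hfn
  rw [← hh2'] at hhalf hh
  rw [← hh3'] at hG4 hh'
  rw [← hU'] at hU ⊢
  have hun : ‖((m.factorial : ℚ_[p]) ^ 4 * (1 + p * (q' : ℚ_[p])) *
      ((p - 1).factorial : ℚ_[p]) ^ 3 * (1 - p * (h1' : ℚ_[p])) ^ 4)‖ = 1 := by
    simp only [norm_mul, norm_pow, hWn, hBn, hgn, hfn, one_pow, mul_one]
  refine CongrMod.of_mul_unit hun ?_
  have cast := fun x y => (congrMod_sq_iff (p := p) x y).mp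
  have := gamma_product_comparison_one (R := ℤ_[p] ⧸ Ideal.span {(p : ℤ_[p]) ^ 2})
    (P := p) (q := Ideal.Quotient.mk _ q') (h := Ideal.Quotient.mk _ h1')
    (h' := Ideal.Quotient.mk _ h3')
    (Hn := Ideal.Quotient.mk _ h2') (W := (p - 1).factorial) (A := (3 * m).factorial)
    (B := m.factorial) (N := (2 * m).factorial) (s := (-1) ^ m)
    (G := Ideal.Quotient.mk _ (padicGamma p (padicQuarter p h3)) ^ 4)
    (U := Ideal.Quotient.mk _ U') (Q := (3 * m : ℕ)) (Qn := 3 * m) (pn := p)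
    (natCast_sq_eq_zero_quotient p)
    (by
      have hpm := congrArg (Nat.cast : ℕ → ℤ_[p] ⧸ Ideal.span {(p : ℤ_[p]) ^ 2}) hm
      push_cast at hpm ⊢
      rw [hpm]
      ring)
    (by omega)
    (by
      have := cast ((p - 1).factorial ^ p) (-1) (by exact_mod_cast hW)
      simpa only [map_pow, map_neg, map_one, map_natCast] using this)
    (by rw [← pow_mul, mul_comm, pow_mul]; norm_num)
    (by
      have := cast ((p - 1).factorial)
          ((-1) ^ m * (3 * m).factorial * m.factorial * (1 - p * h1')) (by exact_mod_cast hsplit)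
      simpa only [map_pow, map_neg, map_one, map_natCast, map_mul, map_sub] using this)
    (by
      have := cast ((p - 1).factorial)
        ((-1) ^ (2 * m) * (2 * m).factorial * (2 * m).factorial * (1 - p * h2'))
        (by exact_mod_cast hhalf)
      simp only [map_pow, map_neg, map_one, map_natCast, map_mul, map_sub] at this
      rw [this, pow_mul]
      ring)
    (by
      have := cast (p * h3') (p * h1') (by exact_mod_cast hh')
      simpa only [map_natCast, map_mul] using this)
    (by
      have := cast (p * h1') (p * (h2' - q')) (by exact_mod_cast hh)
      simpa only [map_natCast, map_mul, map_sub] using this)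
    (by
      have := cast (U' * (m.factorial ^ 4 * (1 + p * q'))) ((2 * m).factorial ^ 2)
          (.of_eq (by exact_mod_cast hU))
      simpa only [map_pow, map_one, map_natCast, map_mul, map_add] using this)
    (by
      have := cast (padicGamma p (padicQuarter p h3) ^ 4) (((p - 1).factorial ^ (3 * m) *
          ((3 * m).factorial * (1 + p * ((3 * m : ℕ) * h3')))) ^ 4) (by exact_mod_cast hG4)
      simpa only [map_pow, map_one, map_natCast, map_mul, map_add] using this)
  have h := (congrMod_sq_iff (p := p)
    (m.factorial ^ 4 * (1 + p * q') * (p - 1).factorial ^ 3 * (1 - p * h1') ^ 4 * U')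
    (m.factorial ^ 4 * (1 + p * q') * (p - 1).factorial ^ 3 * (1 - p * h1') ^ 4 *
      -(padicGamma p (padicQuarter p h3) ^ 4))).mpr (by
        simpa only [map_pow, map_one, map_natCast, map_mul, map_add, map_sub, map_neg] using this)
  push_cast at h
  exact h

theorem odd_ratio_sq_congrMod_gamma (h3 : 3 < p) {m : ℕ} (hm : p = 4 * m + 3) :
    CongrMod ((p : ℚ_[p]) ^ 2) (4 * ((m.factorial : ℚ_[p]) / rising (3 / 2 : ℚ_[p]) m) ^ 2)
      ((padicGamma p (padicQuarter p h3) : ℚ_[p]) ^ 4) := by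
  have hn : p = 2 * (2 * m + 1) + 1 := by omega
  -- For `p = 4m + 3`, the number `(1 + 3p^2)/4` has `3m + 2` full blocks and a last block ending at
  -- `R = m`.
  have hG := padicGamma_quarter_congrMod h3 (m := (3 * m + 2) * p + (m + 1)) (by
    rw [hm]; ring)
  have hGm : ∀ z : ℤ_[p], (z : ℚ_[p]) ∈ PadicInt.subring p := fun z => z.2
  have hG4 := (hG.pow (hGm _) (intCast_mem _ _) 4).trans
    (moritaSeq_pow_four_congrMod hn (3 * m + 2) (R := m) (by omega))
  have hW := factorial_pred_pow_congrMod hn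
  have hhalf := factorial_pred_split (p := p) (show 2 * m + 1 + (2 * m + 1) + 1 = p by omega)
  have hh := (fieldHarmonic_quarter h3 hn (m := m) (.inr rfl)).scale_p
  have hNn := norm_factorial_eq_one (p := p) (k := 2 * m + 1) (by omega)
  have hfact : (m.factorial / rising (3 / 2 : ℚ_[p]) m)
      = (m.factorial : ℚ_[p]) ^ 2 * 4 ^ m / (2 * m + 1).factorial := by
    have e := rising_three_halves_eq (K := ℚ_[p]) m
    have hf0 : (m.factorial : ℚ_[p]) ≠ 0 := by exact_mod_cast m.factorial_ne_zero
    have hN0 := ne_zero_of_norm_eq_one hNn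
    have hr : rising (3 / 2 : ℚ_[p]) m ≠ 0 := by
      intro h
      rw [h, zero_mul] at e
      exact hN0 e.symm
    rw [← e]
    field_simp
  rw [hfact]
  have hV : 4 * ((m.factorial : ℚ_[p]) ^ 2 * 4 ^ m / (2 * m + 1).factorial) ^ 2 *
      ((2 * m + 1).factorial : ℚ_[p]) ^ 2
      = (m.factorial : ℚ_[p]) ^ 4 * (1 + p * ((fermatQuotient p 2 : ℚ) : ℚ_[p])) := by
    have hN0 := ne_zero_of_norm_eq_one hNn
    rw [← fermatQuotient_cast (by omega), show p - 1 = 2 * (m * 2 + 1) by omega, pow_mul]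
    norm_num
    field_simp
    ring
  have hWn := norm_factorial_eq_one (p := p) (k := p - 1) (by omega)
  have hqm := fermatQuotient_mem (p := p) h3
  have hhm := fieldHarmonic_mem (p := p) 1 (show m < p by omega)
  have hh2m := fieldHarmonic_mem (p := p) 1 (show 2 * m + 1 < p by omega)
  have hVm : ((m.factorial : ℚ_[p]) ^ 2 * 4 ^ m / (2 * m + 1).factorial) ^ 2
      ∈ PadicInt.subring p := by
    refine pow_mem (div_mem_of_norm_eq_one (mul_mem (pow_mem (natCast_mem_subring _) 2)
      (pow_mem ?_ m)) hNn) 2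
    exact_mod_cast natCast_mem_subring (p := p) 4
  set q := ((fermatQuotient p 2 : ℚ) : ℚ_[p])
  obtain ⟨q', hq'⟩ : ∃ z : ℤ_[p], (z : ℚ_[p]) = q := ⟨⟨_, hqm⟩, rfl⟩
  obtain ⟨h1', hh1'⟩ : ∃ z : ℤ_[p], (z : ℚ_[p]) = fieldHarmonic ℚ_[p] 1 m := ⟨⟨_, hhm⟩, rfl⟩
  obtain ⟨h2', hh2'⟩ : ∃ z : ℤ_[p], (z : ℚ_[p]) = fieldHarmonic ℚ_[p] 1 (2 * m + 1) :=
    ⟨⟨_, hh2m⟩, rfl⟩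
  obtain ⟨V', hV'⟩ : ∃ z : ℤ_[p],
      (z : ℚ_[p]) = ((m.factorial : ℚ_[p]) ^ 2 * 4 ^ m / (2 * m + 1).factorial) ^ 2 :=
    ⟨⟨_, hVm⟩, rfl⟩
  rw [← hq'] at hV hh
  rw [← hh1'] at hh hG4
  rw [← hh2'] at hhalf hh
  rw [← hV'] at hV ⊢
  refine CongrMod.of_mul_unit hWn ?_
  have cast := fun x y => (congrMod_sq_iff (p := p) x y).mp
  have := gamma_product_comparison_three (R := ℤ_[p] ⧸ Ideal.span {(p : ℤ_[p]) ^ 2})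
    (P := p) (q := Ideal.Quotient.mk _ q') (h := Ideal.Quotient.mk _ h1')
    (Hn := Ideal.Quotient.mk _ h2') (W := (p - 1).factorial)
    (B := m.factorial) (N := (2 * m + 1).factorial)
    (G := Ideal.Quotient.mk _ (padicGamma p (padicQuarter p h3)) ^ 4)
    (V := Ideal.Quotient.mk _ V') (Q := (3 * m + 2 : ℕ)) (Qn := 3 * m + 2) (pn := p)
    (natCast_sq_eq_zero_quotient p)
    (by
      have hpm := congrArg (Nat.cast : ℕ → ℤ_[p] ⧸ Ideal.span {(p : ℤ_[p]) ^ 2}) hm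
      push_cast at hpm ⊢
      rw [hpm]
      ring)
    (by omega)
    (by
      have := cast ((p - 1).factorial ^ p) (-1) (by exact_mod_cast hW)
      simpa only [map_pow, map_neg, map_one, map_natCast] using this)
    (by
      have := cast ((p - 1).factorial)
        ((-1) ^ (2 * m + 1) * (2 * m + 1).factorial * (2 * m + 1).factorial * (1 - p * h2'))
        (by exact_mod_cast hhalf)
      simp only [map_pow, map_neg, map_one, map_natCast, map_mul, map_sub] at this
      rw [this, Odd.neg_one_pow ⟨m, rfl⟩]
      ring)
    (by
      have := cast (p * h1') (p * (h2' - q')) (by exact_mod_cast hh)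
      simpa only [map_natCast, map_mul, map_sub] using this)
    (by
      have := cast ((4 : ℕ) * V' * (2 * m + 1).factorial ^ 2) (m.factorial ^ 4 * (1 + p * q'))
          (.of_eq (by exact_mod_cast hV))
      simpa only [map_pow, map_one, map_natCast, map_mul, map_add, Nat.cast_ofNat, map_ofNat] using this)
    (by
      have := cast (padicGamma p (padicQuarter p h3) ^ 4) (((p - 1).factorial ^ (3 * m + 2) *
          (m.factorial * (1 + p * ((3 * m + 2 : ℕ) * h1')))) ^ 4) (by exact_mod_cast hG4)
      simpa only [map_pow, map_one, map_natCast, map_mul, map_add] using this)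
  have h := (congrMod_sq_iff (p := p) ((p - 1).factorial * ((4 : ℕ) * V'))
    ((p - 1).factorial * (padicGamma p (padicQuarter p h3) ^ 4))).mpr (by
        simpa only [map_pow, map_natCast, map_mul, Nat.cast_ofNat, map_ofNat] using this)
  push_cast at h
  exact h

end GammaQuarter

/-! ### First-order expansion of Dixon's summand -/

section DixonCongruence

variable {p : ℕ} [Fact p.Prime]

/-- `A = 1 + c α` to first order in `c`. -/
def FirstOrder (c A α : ℚ_[p]) : Prop :=
  α ∈ PadicInt.subring p ∧ CongrMod (c ^ 2) A (1 + c * α)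

namespace FirstOrder

variable {c A B α β : ℚ_[p]}

theorem mul (hc : c ∈ PadicInt.subring p) (hA : FirstOrder c A α) (hB : FirstOrder c B β) :
    FirstOrder c (A * B) (α + β) := by
  obtain ⟨hα, z, hz, ez⟩ := hA
  obtain ⟨hβ, w, hw, ew⟩ := hB
  refine ⟨add_mem hα hβ, α * β + z * (1 + c * β) + (1 + c * α) * w + c ^ 2 * z * w, ?_, ?_⟩
  · have h1 : 1 + c * α ∈ PadicInt.subring p := add_mem (one_mem _) (mul_mem hc hα)
    have h2 : 1 + c * β ∈ PadicInt.subring p := add_mem (one_mem _) (mul_mem hc hβ)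
    exact add_mem (add_mem (add_mem (mul_mem hα hβ) (mul_mem hz h2)) (mul_mem h1 hw))
      (mul_mem (mul_mem (pow_mem hc 2) hz) hw)
  · linear_combination B * ez + (1 + c * α) * ew + c ^ 2 * z * ew

theorem inv (hc : c ∈ PadicInt.subring p) (hA : FirstOrder c A α) (hn : ‖A‖ = 1) :
    FirstOrder c A⁻¹ (-α) := by
  obtain ⟨hα, z, hz, ez⟩ := hA
  have hA0 := ne_zero_of_norm_eq_one hn
  have hAi := inv_mem_of_norm_eq_one hn
  refine ⟨neg_mem hα, A⁻¹ * (α ^ 2 - z * (1 - c * α)), mul_mem hAi (sub_mem (pow_mem hα 2)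
    (mul_mem hz (sub_mem (one_mem _) (mul_mem hc hα)))), ?_⟩
  field_simp
  linear_combination -(1 - c * α) * ez

theorem prod {ι : Type*} (s : Finset ι) {z : ι → ℚ_[p]} (hc : c ∈ PadicInt.subring p)
    (hz : ∀ i ∈ s, z i ∈ PadicInt.subring p) :
    FirstOrder c (∏ i ∈ s, (1 + c * z i)) (∑ i ∈ s, z i) :=
  ⟨sum_mem hz, prod_one_add_mul_congrMod s hc hz⟩

end FirstOrder

theorem norm_rising_eq_one {x : ℚ_[p]} {k : ℕ} (h : ∀ j < k, ‖x + j‖ = 1) : ‖rising x k‖ = 1 :=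
  norm_prod_eq_one fun j hj => h j (Finset.mem_range.mp hj)

/-- First-order expansion of a rising factorial in its argument. -/
theorem rising_add_mul_eq {x c y : ℚ_[p]} {k : ℕ} (h : ∀ j < k, ‖x + j‖ = 1) :
    rising (x + c * y) k
      = rising x k * ∏ j ∈ Finset.range k, (1 + c * (y * (1 / (x + (j : ℚ_[p]))))) := by
  rw [rising, rising, ← Finset.prod_mul_distrib]
  refine Finset.prod_congr rfl fun j hj => ?_
  have := ne_zero_of_norm_eq_one (h j (Finset.mem_range.mp hj))
  field_simp
  ring

theorem firstOrder_rising {x c y : ℚ_[p]} {k : ℕ} (hc : c ∈ PadicInt.subring p)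
    (hy : y ∈ PadicInt.subring p) (h : ∀ j < k, ‖x + j‖ = 1) :
    FirstOrder c (∏ j ∈ Finset.range k, (1 + c * (y * (1 / (x + (j : ℚ_[p]))))))
      (y * ∑ j ∈ Finset.range k, 1 / (x + (j : ℚ_[p]))) := by
  rw [Finset.mul_sum]
  exact .prod _ hc fun j hj => mul_mem hy
    (div_mem_of_norm_eq_one (one_mem _) (h j (Finset.mem_range.mp hj)))

/-- First-order expansion of an inverse. -/
theorem one_div_add_congrMod {x y : ℚ_[p]} (hx : ‖x‖ = 1) (hy : y ∈ PadicInt.subring p) :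
    CongrMod ((p : ℚ_[p]) ^ 2) (1 / (x + (p : ℚ_[p]) * y))
      (1 / x - (p : ℚ_[p]) * (y * (1 / x ^ 2))) := by
  have hxy : ‖x + p * y‖ = 1 := norm_eq_one_of_congrMod ⟨y, hy, by ring⟩ hx
  have h0 := ne_zero_of_norm_eq_one hx
  have h1 := ne_zero_of_norm_eq_one hxy
  refine ⟨y ^ 2 * x⁻¹ ^ 2 * (x + p * y)⁻¹, mul_mem (mul_mem (pow_mem hy 2)
    (pow_mem (inv_mem_of_norm_eq_one hx) 2)) (inv_mem_of_norm_eq_one hxy), ?_⟩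
  field_simp
  ring

theorem norm_half_add {n j : ℕ} (h3 : 3 < p) (hn : p = 2 * n + 1) (hj : j < n) :
    ‖(1 / 2 + j : ℚ_[p])‖ = 1 := by
  have h2 := norm_two_eq_one h3
  have h := norm_natCast_eq_one (p := p) (j := 2 * j + 1) (by omega) (by omega)
  have e : (1 / 2 + j : ℚ_[p]) = ((2 * j + 1 : ℕ) : ℚ_[p]) / 2 := by push_cast; ring
  rw [e, norm_div, h, h2, div_one]

/-- The quadratic odd harmonic sum `∑_{j<k} (1/2 + j)⁻²`. -/
def oddHarmonic (K : Type*) [Field K] (k : ℕ) : K := ∑ j ∈ Finset.range k, 1 / (1 / 2 + (j : K)) ^ 2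

theorem norm_natCast_add_one_add {n j : ℕ} (hn : p = 2 * n + 1) (hj : j < n) :
    ‖((n : ℚ_[p]) + 1 + j)‖ = 1 := by
  have := norm_natCast_eq_one (p := p) (j := n + 1 + j) (by omega) (by omega)
  exact_mod_cast this

theorem norm_half_sub_add {n j : ℕ} (h3 : 3 < p) (hn : p = 2 * n + 1) (hj : j < n) :
    ‖(1 / 2 - n + j : ℚ_[p])‖ = 1 := by
  have hpn : (p : ℚ_[p]) = 2 * n + 1 := by exact_mod_cast congrArg (Nat.cast : ℕ → ℚ_[p]) hn
  exact norm_eq_one_of_congrMod ⟨-(1 / 2), neg_mem (half_mem h3), by rw [hpn]; ring⟩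
    (norm_natCast_add_one_eq_one (j := j) (by omega))

theorem norm_three_halves_add {n j : ℕ} (h3 : 3 < p) (hn : p = 2 * n + 1) (hj : j < n) :
    ‖((n : ℚ_[p]) + 3 / 2 + j)‖ = 1 := by
  have hpn : (p : ℚ_[p]) = 2 * n + 1 := by exact_mod_cast congrArg (Nat.cast : ℕ → ℚ_[p]) hn
  exact norm_eq_one_of_congrMod ⟨1 / 2, half_mem h3, by rw [hpn]; ring⟩
    (norm_natCast_add_one_eq_one (j := j) (by omega))

theorem dixonTerm_half (K : Type*) [Field K] [CharZero K] (n k : ℕ) :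
    dixonTerm (1 / 2 : K) (n + 1) n k
      = rising (1 / 2 : K) k * rising ((n : K) + 1) k * rising (-(n : K)) k
      / k.factorial / (rising (1 / 2 - (n : K)) k * rising ((n : K) + 3 / 2) k) := by
  rw [dixonTerm, show 1 + 1 / 2 - ((n : K) + 1) = 1 / 2 - n by ring,
    show 1 + 1 / 2 + (n : K) = n + 3 / 2 by ring, div_div, mul_assoc (k.factorial : K)]

theorem dixonTerm_mem_and_congrMod (h3 : 3 < p) {n : ℕ} (hn : p = 2 * n + 1) {k : ℕ} (hk : k ≤ n) :
    dixonTerm (1 / 2 : ℚ_[p]) (n + 1) n k ∈ PadicInt.subring p ∧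
    CongrMod ((p : ℚ_[p]) ^ 2) (dixonTerm (1 / 2 : ℚ_[p]) (n + 1) n k)
      (legendreTerm ℚ_[p] n k) := by
  have hpn : (p : ℚ_[p]) = 2 * n + 1 := by exact_mod_cast congrArg (Nat.cast : ℕ → ℚ_[p]) hn
  have n0 : ∀ j < k, ‖(j : ℚ_[p]) + 1‖ = 1 := fun j hj => norm_natCast_add_one_eq_one (by omega)
  have n3 : ∀ j < k, ‖(1 / 2 - n + j : ℚ_[p])‖ = 1 := fun j hj =>
    norm_half_sub_add h3 hn (by omega)
  have n4 : ∀ j < k, ‖((n : ℚ_[p]) + 3 / 2 + j)‖ = 1 := fun j hj =>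
    norm_three_halves_add h3 hn (by omega)
  have hf := norm_factorial_eq_one (p := p) (k := k) (by omega)
  have hprod : CongrMod ((p : ℚ_[p]) ^ 2)
      (rising (1 / 2 - (n : ℚ_[p])) k * rising ((n : ℚ_[p]) + 3 / 2) k)
      ((k.factorial : ℚ_[p]) ^ 2) := by
    rw [sq (k.factorial : ℚ_[p]), ← Finset.prod_range_add_one_eq_factorial]
    push_cast
    rw [rising, rising, ← Finset.prod_mul_distrib, ← Finset.prod_mul_distrib]
    -- The lower parameters are `1 - p/2` and `1 + p/2`, so the paired factors are `(j+1)^2 -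
    -- p^2/4`.
    refine .prod (fun j _ => ⟨-(1 / 2 * (1 / 2)), neg_mem (mul_mem (half_mem h3) (half_mem h3)), ?_⟩)
      (fun j hj => ?_) fun j hj => ?_
    · rw [hpn]; ring
    · rw [Finset.mem_range] at hj
      exact mul_mem (mem_of_norm_eq_one (n3 j hj)) (mem_of_norm_eq_one (n4 j hj))
    · rw [Finset.mem_range] at hj
      exact mul_mem (mem_of_norm_eq_one (n0 j hj)) (mem_of_norm_eq_one (n0 j hj))
  have hnum : rising (1 / 2 : ℚ_[p]) k * rising ((n : ℚ_[p]) + 1) k * rising (-(n : ℚ_[p])) k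
      / k.factorial ∈ PadicInt.subring p :=
    div_mem_of_norm_eq_one (mul_mem (mul_mem (rising_mem (half_mem h3) k)
      (rising_mem (add_mem (natCast_mem_subring n) (one_mem _)) k))
      (rising_mem (neg_mem (natCast_mem_subring n)) k)) hf
  have hDn : ‖rising (1 / 2 - (n : ℚ_[p])) k * rising ((n : ℚ_[p]) + 3 / 2) k‖ = 1 := by
    rw [norm_mul, norm_rising_eq_one n3, norm_rising_eq_one n4, one_mul]
  rw [dixonTerm_half]
  refine ⟨div_mem_of_norm_eq_one hnum hDn, ?_⟩
  refine (CongrMod.div (.refl _ _) hprod hnum hDn (by rw [norm_pow, hf, one_pow])).trans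
    (.of_eq ?_)
  rw [legendreTerm, hyperTerm, div_div]
  ring

/-- The logarithmic derivative at `0` of the summand of Dixon's series with parameters
`1/2 + X, n + 1 - X, -n`. -/
def dixonSlope (K : Type*) [Field K] (n k : ℕ) : K :=
  1 * ∑ j ∈ Finset.range k, 1 / (1 / 2 + (j : K))
    + -1 * ∑ j ∈ Finset.range k, 1 / ((n : K) + 1 + (j : K))
    + -(2 * ∑ j ∈ Finset.range k, 1 / (1 / 2 - (n : K) + (j : K)))
    + -(1 * ∑ j ∈ Finset.range k, 1 / ((n : K) + 3 / 2 + (j : K)))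

/-- The parameters are `1/2`, `1/2 + p/2`, `1 - p/2` and `1 + p/2`; expanding the reciprocals in
`p`, the sums of `1/(1/2 + j)` cancel and the others combine to `-3 H_k`. -/
theorem dixonSlope_congrMod (h3 : 3 < p) {n : ℕ} (hn : p = 2 * n + 1) {k : ℕ} (hk : k ≤ n) :
    CongrMod ((p : ℚ_[p]) ^ 2) (dixonSlope ℚ_[p] n k) (-3 * fieldHarmonic ℚ_[p] 1 k
        + (p : ℚ_[p]) / 2 * (oddHarmonic ℚ_[p] k - fieldHarmonic ℚ_[p] 2 k)) := by
  have hpn : (p : ℚ_[p]) = 2 * n + 1 := by exact_mod_cast congrArg (Nat.cast : ℕ → ℚ_[p]) hn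
  have h2m : (2 : ℚ_[p]) ∈ PadicInt.subring p := mem_of_norm_eq_one (norm_two_eq_one h3)
  have hpd : (p : ℚ_[p]) / 2 = p * (1 / 2) := by ring
  have n0 : ∀ j < k, ‖(j : ℚ_[p]) + 1‖ = 1 := fun j hj => norm_natCast_add_one_eq_one (by omega)
  have g2 : CongrMod ((p : ℚ_[p]) ^ 2) (∑ j ∈ Finset.range k, 1 / ((n : ℚ_[p]) + 1 + (j : ℚ_[p])))
      (∑ j ∈ Finset.range k, 1 / (1 / 2 + (j : ℚ_[p]))
        - (p : ℚ_[p]) / 2 * oddHarmonic ℚ_[p] k) := by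
    rw [oddHarmonic, Finset.mul_sum, ← Finset.sum_sub_distrib]
    refine .sum fun j hj => ?_
    have hj' := Finset.mem_range.mp hj
    have := one_div_add_congrMod (norm_half_add h3 hn (show j < n by omega)) (half_mem h3)
    rw [show (n : ℚ_[p]) + 1 + j = 1 / 2 + j + p * (1 / 2) by rw [hpn]; ring, hpd, mul_assoc]
    exact this
  have g3 : CongrMod ((p : ℚ_[p]) ^ 2)
      (∑ j ∈ Finset.range k, 1 / (1 / 2 - (n : ℚ_[p]) + (j : ℚ_[p])))
      (fieldHarmonic ℚ_[p] 1 k + (p : ℚ_[p]) / 2 * fieldHarmonic ℚ_[p] 2 k) := by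
    rw [fieldHarmonic, fieldHarmonic, Finset.mul_sum, ← Finset.sum_add_distrib]
    refine .sum fun j hj => ?_
    have := one_div_add_congrMod (n0 j (Finset.mem_range.mp hj)) (neg_mem (half_mem h3))
    rw [show 1 / 2 - (n : ℚ_[p]) + j = j + 1 + p * -(1 / 2) by rw [hpn]; ring, hpd, pow_one]
    exact this.trans (.of_eq (by ring))
  have g4 : CongrMod ((p : ℚ_[p]) ^ 2)
      (∑ j ∈ Finset.range k, 1 / ((n : ℚ_[p]) + 3 / 2 + (j : ℚ_[p])))
      (fieldHarmonic ℚ_[p] 1 k - (p : ℚ_[p]) / 2 * fieldHarmonic ℚ_[p] 2 k) := by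
    rw [fieldHarmonic, fieldHarmonic, Finset.mul_sum, ← Finset.sum_sub_distrib]
    refine .sum fun j hj => ?_
    have := one_div_add_congrMod (n0 j (Finset.mem_range.mp hj)) (half_mem h3)
    rw [show (n : ℚ_[p]) + 3 / 2 + j = j + 1 + p * (1 / 2) by rw [hpn]; ring, hpd, pow_one]
    exact this.trans (.of_eq (by ring))
  refine ((((CongrMod.refl _ _).add (g2.mul_left (neg_mem (one_mem _)))).add
    (g3.mul_left h2m).neg).add (g4.mul_left (one_mem _)).neg).trans (.of_eq ?_)
  ring

theorem FirstOrder.norm_eq_one {A α : ℚ_[p]} (h : FirstOrder ((p : ℚ_[p]) ^ 2) A α) : ‖A‖ = 1 := by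
  obtain ⟨hα, z, hz, e⟩ := h
  have hp := natCast_mem_subring (p := p) p
  refine norm_eq_one_of_congrMod (y := 1) ⟨p * α + p * (p : ℚ_[p]) ^ 2 * z,
    add_mem (mul_mem hp hα) (mul_mem (mul_mem hp (pow_mem hp 2)) hz), ?_⟩ norm_one
  linear_combination e

theorem dixonTerm_firstOrder (h3 : 3 < p) {n : ℕ} (hn : p = 2 * n + 1) {k : ℕ} (hk : k ≤ n) :
    ∃ R : ℚ_[p], FirstOrder ((p : ℚ_[p]) ^ 2) R (dixonSlope ℚ_[p] n k) ∧
      dixonTerm (1 / 2 + (p : ℚ_[p]) ^ 2) (n + 1 - (p : ℚ_[p]) ^ 2) n k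
        = dixonTerm (1 / 2 : ℚ_[p]) (n + 1) n k * R := by
  have hc : (p : ℚ_[p]) ^ 2 ∈ PadicInt.subring p := pow_mem (natCast_mem_subring p) 2
  have h2m : (2 : ℚ_[p]) ∈ PadicInt.subring p := mem_of_norm_eq_one (norm_two_eq_one h3)
  have n1 : ∀ j < k, ‖(1 / 2 + j : ℚ_[p])‖ = 1 := fun j hj => norm_half_add h3 hn (by omega)
  have n2 : ∀ j < k, ‖((n : ℚ_[p]) + 1 + j)‖ = 1 := fun j hj =>
    norm_natCast_add_one_add hn (by omega)
  have n3 : ∀ j < k, ‖(1 / 2 - n + j : ℚ_[p])‖ = 1 := fun j hj =>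
    norm_half_sub_add h3 hn (by omega)
  have n4 : ∀ j < k, ‖((n : ℚ_[p]) + 3 / 2 + j)‖ = 1 := fun j hj =>
    norm_three_halves_add h3 hn (by omega)
  have hf := norm_factorial_eq_one (p := p) (k := k) (by omega)
  have f1 := firstOrder_rising hc (one_mem _) n1
  have f2 := firstOrder_rising hc (neg_mem (one_mem _)) n2
  have f3 := firstOrder_rising hc h2m n3
  have f4 := firstOrder_rising hc (one_mem _) n4
  refine ⟨_, ((f1.mul hc f2).mul hc (f3.inv hc f3.norm_eq_one)).mul hc
    (f4.inv hc f4.norm_eq_one), ?_⟩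
  rw [dixonTerm_half, dixonTerm]
  generalize (p : ℚ_[p]) ^ 2 = c
  rw [show (1 / 2 + c : ℚ_[p]) = 1 / 2 + c * 1 by ring,
    show ((n : ℚ_[p]) + 1 - c) = n + 1 + c * (-1) by ring,
    show 1 + (1 / 2 + c * 1) - ((n : ℚ_[p]) + 1 + c * (-1)) = 1 / 2 - n + c * 2 by ring,
    show 1 + (1 / 2 + c * 1) + (n : ℚ_[p]) = n + 3 / 2 + c * 1 by ring,
    rising_add_mul_eq n1, rising_add_mul_eq n2, rising_add_mul_eq n3, rising_add_mul_eq n4]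
  simp only [div_eq_mul_inv, mul_inv]
  ring

theorem dixonTerm_expansion (h3 : 3 < p) {n : ℕ} (hn : p = 2 * n + 1) {k : ℕ} (hk : k ≤ n) :
    CongrMod (((p : ℚ_[p]) ^ 2) ^ 2)
      (dixonTerm (1 / 2 + (p : ℚ_[p]) ^ 2) (n + 1 - (p : ℚ_[p]) ^ 2) n k
        - dixonTerm (1 / 2 : ℚ_[p]) (n + 1) n k)
      ((p : ℚ_[p]) ^ 2 * (legendreTerm ℚ_[p] n k * (-3 * fieldHarmonic ℚ_[p] 1 k
        + (p : ℚ_[p]) / 2 * (oddHarmonic ℚ_[p] k - fieldHarmonic ℚ_[p] 2 k)))) := by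
  have hc : (p : ℚ_[p]) ^ 2 ∈ PadicInt.subring p := pow_mem (natCast_mem_subring p) 2
  obtain ⟨R, ⟨hεm, w, hw, ew⟩, e0⟩ := dixonTerm_firstOrder h3 hn hk
  obtain ⟨hDm, hT⟩ := dixonTerm_mem_and_congrMod h3 hn hk
  have hεc := dixonSlope_congrMod h3 hn hk
  rw [e0]
  have s2 := (hT.mul hεc hDm (hεc.symm.mem_left hc hεm)).scale ((p : ℚ_[p]) ^ 2)
  rw [← sq] at s2
  refine CongrMod.trans ⟨dixonTerm (1 / 2 : ℚ_[p]) (n + 1) n k * w, mul_mem hDm hw, ?_⟩ s2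
  linear_combination dixonTerm (1 / 2 : ℚ_[p]) (n + 1) n k * ew

end DixonCongruence

/-! ### The sum weighted by H_k for p ≡ 3 mod 4 -/

section OddHalf

variable {p : ℕ} [Fact p.Prime]

theorem rising_neg_natCast_eq_choose {K : Type*} [Field K] [CharZero K] (n k : ℕ) :
    rising (-(n : K)) k = (-1) ^ k * n.choose k * k.factorial := by
  induction k with
  | zero => simp
  | succ k ih =>
    rw [rising_succ, ih, pow_succ, Nat.factorial_succ]
    rcases le_or_gt k n with hk | hk
    · have e := congrArg (Nat.cast : ℕ → K) (Nat.choose_succ_right_eq n k)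
      push_cast [Nat.cast_sub hk] at e ⊢
      linear_combination (-1) ^ k * (k.factorial : K) * e
    · rw [Nat.choose_eq_zero_of_lt hk, Nat.choose_eq_zero_of_lt (by omega)]
      simp

/-- The antisymmetry of `(-1)^k C(n,k)^3` for odd `n`. -/
theorem antisymmetric_cube_sum {K : Type*} [Field K] [CharZero K] {n : ℕ} (hn : Odd n)
    (c : ℕ → K) (hc : ∀ k ≤ n, c (n - k) = c k) :
    ∑ k ∈ Finset.range (n + 1), ((-1) ^ k * (n.choose k : K)) ^ 3 * c k = 0 := by
  have h : ∑ k ∈ Finset.range (n + 1), ((-1) ^ k * (n.choose k : K)) ^ 3 * c k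
      = -∑ k ∈ Finset.range (n + 1), ((-1) ^ k * (n.choose k : K)) ^ 3 * c k := by
    conv_lhs => rw [← Finset.sum_range_reflect]
    rw [← Finset.sum_neg_distrib]
    refine Finset.sum_congr rfl fun k hk => ?_
    have hk' : k ≤ n := by rw [Finset.mem_range] at hk; omega
    rw [show n + 1 - 1 - k = n - k by omega, hc k hk', Nat.choose_symm hk']
    have hs : ((-1) ^ (n - k) : K) = -(-1) ^ k := by
      rcases Nat.even_or_odd k with hk2 | hk2
      · rw [hk2.neg_one_pow, Odd.neg_one_pow (by grind)]
      · rw [hk2.neg_one_pow, Even.neg_one_pow (by grind)]; ring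
    rw [hs]
    ring
  have h2 : (2 : K) * ∑ k ∈ Finset.range (n + 1), ((-1) ^ k * (n.choose k : K)) ^ 3 * c k = 0 := by
    linear_combination h
  exact (mul_eq_zero.mp h2).resolve_left two_ne_zero

/-- Modulo `p`, `1/2 + j ≡ -(n - j)`, so the squares run through the top `k` indices up to `n`. -/
theorem oddHarmonic_congrMod (h3 : 3 < p) {n : ℕ} (hn : p = 2 * n + 1) {k : ℕ} (hk : k ≤ n) :
    CongrMod (p : ℚ_[p]) (oddHarmonic ℚ_[p] k)
      (fieldHarmonic ℚ_[p] 2 n - fieldHarmonic ℚ_[p] 2 (n - k)) := by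
  have hpn : (p : ℚ_[p]) = 2 * n + 1 := by exact_mod_cast congrArg (Nat.cast : ℕ → ℚ_[p]) hn
  have e : fieldHarmonic ℚ_[p] 2 n - fieldHarmonic ℚ_[p] 2 (n - k)
      = ∑ i ∈ Finset.range k, 1 / (((n - k + (k - 1 - i) : ℕ) : ℚ_[p]) + 1) ^ 2 := by
    obtain ⟨d, rfl⟩ := Nat.exists_eq_add_of_le' hk
    rw [Nat.add_sub_cancel, fieldHarmonic, fieldHarmonic, sum_range_add_reflect]
    ring
  rw [e, oddHarmonic]
  refine .sum fun i hi => ?_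
  rw [Finset.mem_range] at hi
  have n1 := norm_half_add h3 hn (show i < n by omega)
  have n2 := norm_natCast_add_one_eq_one (p := p) (j := n - k + (k - 1 - i)) (by omega)
  have e2 : ((n - k + (k - 1 - i) : ℕ) : ℚ_[p]) + 1 = n - i := by
    rw [show n - k + (k - 1 - i) = n - (i + 1) by omega, Nat.cast_sub (by omega)]
    push_cast
    ring
  rw [e2] at n2 ⊢
  have h : CongrMod (p : ℚ_[p]) (1 / 2 + i) (-(n - i)) :=
    ⟨1 / 2, half_mem h3, by rw [hpn]; ring⟩
  have n2' : ‖-((n : ℚ_[p]) - i)‖ = 1 := by rw [norm_neg, n2]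
  have := (h.inv n1 n2').pow (inv_mem_of_norm_eq_one n1) (inv_mem_of_norm_eq_one n2') 2
  rw [one_div ((1 / 2 + (i : ℚ_[p])) ^ 2), one_div (((n : ℚ_[p]) - i) ^ 2), ← inv_pow, ← inv_pow]
  refine this.trans (.of_eq ?_)
  rw [inv_neg, neg_sq]

theorem legendreTerm_congrMod_choose (h3 : 3 < p) {n : ℕ} (hn : p = 2 * n + 1) {k : ℕ}
    (hk : k ≤ n) :
    CongrMod (p : ℚ_[p]) (legendreTerm ℚ_[p] n k) (((-1) ^ k * (n.choose k : ℚ_[p])) ^ 3) := by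
  have hpn : (p : ℚ_[p]) = 2 * n + 1 := by exact_mod_cast congrArg (Nat.cast : ℕ → ℚ_[p]) hn
  have hf := norm_factorial_eq_one (p := p) (k := k) (by omega)
  have m0 : -(n : ℚ_[p]) ∈ PadicInt.subring p := neg_mem (natCast_mem_subring n)
  have m1 : (n : ℚ_[p]) + 1 ∈ PadicInt.subring p := add_mem (natCast_mem_subring n) (one_mem _)
  have c1 : CongrMod (p : ℚ_[p]) ((n : ℚ_[p]) + 1) (-n) := ⟨1, one_mem _, by rw [hpn]; ring⟩
  have c2 : CongrMod (p : ℚ_[p]) (1 / 2) (-n) := ⟨1 / 2, half_mem h3, by rw [hpn]; ring⟩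
  have h := (((CongrMod.refl (p : ℚ_[p]) (rising (-(n : ℚ_[p])) k)).mul
    (rising_congrMod c1 m1 m0 k) (rising_mem m0 k) (rising_mem m0 k)).mul
    (rising_congrMod c2 (half_mem h3) m0 k) (mul_mem (rising_mem m0 k) (rising_mem m1 k))
    (rising_mem m0 k)).mul_right (inv_mem_of_norm_eq_one (show ‖(k.factorial : ℚ_[p]) ^ 3‖ = 1 by
      rw [norm_pow, hf, one_pow]))
  rw [legendreTerm, hyperTerm, div_eq_mul_inv]
  refine h.trans (.of_eq ?_)
  have := ne_zero_of_norm_eq_one hf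
  rw [rising_neg_natCast_eq_choose]
  field_simp

/-- Modulo `p` the weight is symmetric under `k ↦ n - k` and the summand `((-1)^k C(n,k))^3`
antisymmetric, so the correction term in the slope does not contribute. -/
theorem legendreSum_oddHarmonic_sub (h3 : 3 < p) {n : ℕ} (hn : p = 2 * n + 1) (hodd : Odd n) :
    CongrMod (p : ℚ_[p])
      (legendreSum ℚ_[p] (fun k => oddHarmonic ℚ_[p] k - fieldHarmonic ℚ_[p] 2 k) n) 0 := by
  rw [← antisymmetric_cube_sum (K := ℚ_[p]) hodd (fun k => fieldHarmonic ℚ_[p] 2 n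
    - fieldHarmonic ℚ_[p] 2 (n - k) - fieldHarmonic ℚ_[p] 2 k) fun k hk => by
      rw [Nat.sub_sub_self hk]; ring]
  refine .sum fun k hk => ?_
  have hk' : k ≤ n := by rw [Finset.mem_range] at hk; omega
  have hm : ∀ j ≤ n, fieldHarmonic ℚ_[p] 2 j ∈ PadicInt.subring p := fun j hj =>
    fieldHarmonic_mem 2 (by omega)
  have hL := legendreTerm_congrMod_choose h3 hn hk'
  refine hL.mul ((oddHarmonic_congrMod h3 hn hk').sub (.refl _ _))
    (hL.mem_left (natCast_mem_subring p) (pow_mem (mul_mem (pow_mem (neg_mem (one_mem _)) k)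
      (natCast_mem_subring _)) 3))
    (sub_mem (sub_mem (hm n le_rfl) (hm _ (Nat.sub_le n k))) (hm k hk'))

/-- The harmonic sum through the derivative of Dixon's sum. -/
theorem dixon_difference_congrMod (h3 : 3 < p) {n : ℕ} (hn : p = 2 * n + 1) (hodd : Odd n) :
    CongrMod (((p : ℚ_[p]) ^ 2) ^ 2)
      (∑ k ∈ Finset.range (n + 1),
          dixonTerm (1 / 2 + (p : ℚ_[p]) ^ 2) (n + 1 - (p : ℚ_[p]) ^ 2) n k
        - ∑ k ∈ Finset.range (n + 1), dixonTerm (1 / 2 : ℚ_[p]) (n + 1) n k)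
      ((p : ℚ_[p]) ^ 2 * (-3 * legendreSum ℚ_[p] (fieldHarmonic ℚ_[p] 1) n)) := by
  rw [← Finset.sum_sub_distrib]
  have h1 : CongrMod (((p : ℚ_[p]) ^ 2) ^ 2) (∑ k ∈ Finset.range (n + 1),
      (dixonTerm (1 / 2 + (p : ℚ_[p]) ^ 2) (n + 1 - (p : ℚ_[p]) ^ 2) n k
        - dixonTerm (1 / 2 : ℚ_[p]) (n + 1) n k)) _ :=
    .sum fun k hk => dixonTerm_expansion h3 hn (show k ≤ n by rw [Finset.mem_range] at hk; omega)
  refine h1.trans ?_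
  rw [← Finset.mul_sum]
  have h2 := (legendreSum_oddHarmonic_sub h3 hn hodd).mul_left (half_mem h3)
  have h3 := h2.scale_p.scale ((p : ℚ_[p]) ^ 2)
  rw [← sq] at h3
  have e : ∑ k ∈ Finset.range (n + 1), legendreTerm ℚ_[p] n k * (-3 * fieldHarmonic ℚ_[p] 1 k
        + (p : ℚ_[p]) / 2 * (oddHarmonic ℚ_[p] k - fieldHarmonic ℚ_[p] 2 k))
      = -3 * legendreSum ℚ_[p] (fieldHarmonic ℚ_[p] 1) n + (p : ℚ_[p]) * (1 / 2 *
        legendreSum ℚ_[p] (fun k => oddHarmonic ℚ_[p] k - fieldHarmonic ℚ_[p] 2 k) n) := by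
    rw [legendreSum, legendreSum, Finset.mul_sum, Finset.mul_sum, Finset.mul_sum,
      ← Finset.sum_add_distrib]
    exact Finset.sum_congr rfl fun k _ => by ring
  rw [e, mul_add]
  exact ((CongrMod.refl _ _).add h3).trans (.of_eq (by ring))

theorem rising_add {K : Type*} [Field K] (x : K) (a b : ℕ) :
    rising x (a + b) = rising x a * rising (x + a) b := by
  rw [rising, Finset.prod_range_add, rising, rising]
  congr 1
  refine Finset.prod_congr rfl fun j _ => ?_
  push_cast
  ring

/-- The cofactor in Dixon's product for `n = 2 * m + 1` after the two factors that are divisible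
by `p = 4 * m + 3` at `X = 0` have been removed. -/
def dixonCofactor (K : Type*) [Field K] (m : ℕ) (X : K) : K :=
  rising (3 / 2 + X) (2 * m) * (rising (1 / 4 - (2 * m + 1) + 3 * X / 2) m *
    rising (1 / 4 - m + 3 * X / 2) m) /
    (rising (5 / 4 + X / 2) (2 * m + 1) * rising (1 / 2 - (2 * m + 1) + 2 * X) (2 * m + 1))

/-- The shift is a natural number, so that the lower parameters are seen to be nonzero by parity or
positivity. It is applied with `x = p^2` and `x = 0`. -/
theorem dixon_sum_eq_cofactor {K : Type*} [Field K] [CharZero K] (m x : ℕ) :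
    ∑ k ∈ Finset.range (2 * m + 1 + 1),
        dixonTerm (1 / 2 + (x : K)) ((2 * m + 1 : ℕ) + 1 - (x : K)) (2 * m + 1) k
      = ((4 * m + 3) / 2 + x) * (-(4 * m + 3) / 4 + 3 * x / 2) * dixonCofactor K m x := by
  rw [dixon_sum]
  · have e1 : 1 + (1 / 2 + (x : K)) = 3 / 2 + x := by ring
    have e2 : 1 + (1 / 2 + (x : K)) / 2 - ((2 * m + 1 : ℕ) + 1 - (x : K))
        = 1 / 4 - (2 * m + 1) + 3 * x / 2 := by push_cast; ring
    have e3 : 1 + (1 / 2 + (x : K)) / 2 = 5 / 4 + x / 2 := by ring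
    have e4 : 1 + (1 / 2 + (x : K)) - ((2 * m + 1 : ℕ) + 1 - (x : K))
        = 1 / 2 - (2 * m + 1) + 2 * x := by push_cast; ring
    rw [e4, e2, e1, e3, dixonCofactor]
    have s1 : rising (3 / 2 + (x : K)) (2 * m + 1)
        = rising (3 / 2 + (x : K)) (2 * m) * ((4 * m + 3) / 2 + x) := by
      rw [rising_succ]
      push_cast
      ring
    -- The factor with `j = m` is `-p/4 + 3x/2`; it is isolated from the `m` factors on either side.
    have s2 : rising (1 / 4 - (2 * m + 1) + 3 * (x : K) / 2) (2 * m + 1)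
        = rising (1 / 4 - (2 * m + 1) + 3 * (x : K) / 2) m * (-(4 * m + 3) / 4 + 3 * x / 2) *
          rising (1 / 4 - m + 3 * (x : K) / 2) m := by
      rw [show 2 * m + 1 = m + 1 + m by ring, rising_add, rising_succ]
      push_cast
      congr 2 <;> ring
    rw [s1, s2]
    ring
  · intro j h
    have : ((1 + 4 * x + 2 * j : ℕ) : K) = ((2 * (2 * m + 1) : ℕ) : K) := by
      push_cast at h ⊢
      linear_combination 2 * h
    have := Nat.cast_injective this
    omega
  · intro j h
    have : ((3 + 2 * x + 2 * j : ℕ) : K) = 0 := by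
      push_cast
      linear_combination 2 * h
    rw [Nat.cast_eq_zero] at this
    omega
  · intro j h
    have : ((5 + 2 * x + 4 * j : ℕ) : K) = 0 := by
      push_cast
      linear_combination 4 * h
    rw [Nat.cast_eq_zero] at this
    omega

theorem norm_four_eq_one (h3 : 3 < p) : ‖(4 : ℚ_[p])‖ = 1 := by
  rw [show (4 : ℚ_[p]) = 2 * 2 by norm_num, norm_mul, norm_two_eq_one h3, one_mul]

theorem rising_natCast_add_one {K : Type*} [Field K] [CharZero K] (a k : ℕ) :
    rising ((a : K) + 1) k * a.factorial = (a + k).factorial := by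
  induction k with
  | zero => simp
  | succ k ih =>
    rw [rising_succ, ← add_assoc, Nat.factorial_succ]
    push_cast
    rw [← ih]
    ring

theorem quarter_mem (h3 : 3 < p) : (1 / 4 : ℚ_[p]) ∈ PadicInt.subring p :=
  div_mem_of_norm_eq_one (one_mem _) (norm_four_eq_one h3)

/-- The reduction of `dixonCofactor` modulo `p`. -/
def dixonCofactorResidue (K : Type*) [Field K] (m : ℕ) : K :=
  (2 * m).factorial * ((-1) ^ m * m.factorial * m.factorial) /
    (rising (((m + 1 : ℕ) : K) + 1) (2 * m + 1) * (2 * m + 1).factorial)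

theorem dixonCofactor_congrMod (h3 : 3 < p) {m : ℕ} (hm : p = 4 * m + 3) {X : ℚ_[p]}
    (hX : CongrMod (p : ℚ_[p]) X 0) :
    CongrMod (p : ℚ_[p]) (rising (3 / 2 + X) (2 * m) *
        (rising (1 / 4 - (2 * m + 1) + 3 * X / 2) m * rising (1 / 4 - m + 3 * X / 2) m))
      ((2 * m).factorial * ((-1) ^ m * m.factorial * m.factorial)) ∧
    CongrMod (p : ℚ_[p])
      (rising (5 / 4 + X / 2) (2 * m + 1) * rising (1 / 2 - (2 * m + 1) + 2 * X) (2 * m + 1))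
      (rising (((m + 1 : ℕ) : ℚ_[p]) + 1) (2 * m + 1) * (2 * m + 1).factorial) := by
  obtain ⟨ξ, hξ, eX⟩ := hX
  rw [sub_zero] at eX
  have hpm : (p : ℚ_[p]) = 4 * m + 3 := by exact_mod_cast congrArg (Nat.cast : ℕ → ℚ_[p]) hm
  have hP := natCast_mem_subring (p := p) p
  have hh := half_mem h3
  have hq := quarter_mem h3
  have h2m : (2 : ℚ_[p]) ∈ PadicInt.subring p := mem_of_norm_eq_one (norm_two_eq_one h3)
  have h3m : (3 : ℚ_[p]) ∈ PadicInt.subring p := by exact_mod_cast natCast_mem_subring (p := p) 3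
  have b1 : -((2 * m : ℕ) : ℚ_[p]) ∈ PadicInt.subring p := neg_mem (natCast_mem_subring _)
  have b2 : -(m : ℚ_[p]) ∈ PadicInt.subring p := neg_mem (natCast_mem_subring _)
  have b3 : ((0 : ℕ) : ℚ_[p]) + 1 ∈ PadicInt.subring p := add_mem (natCast_mem_subring _) (one_mem _)
  have b4 : ((m + 1 : ℕ) : ℚ_[p]) + 1 ∈ PadicInt.subring p :=
    add_mem (natCast_mem_subring _) (one_mem _)
  have a1 : CongrMod (p : ℚ_[p]) (3 / 2 + X) (-((2 * m : ℕ) : ℚ_[p])) :=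
    ⟨1 / 2 + ξ, add_mem hh hξ, by rw [eX, hpm]; push_cast; ring⟩
  have a2 : CongrMod (p : ℚ_[p]) (1 / 4 - (2 * m + 1) + 3 * X / 2) (-(m : ℚ_[p])) :=
    ⟨-(1 / 4) + 3 * ξ * (1 / 2), add_mem (neg_mem hq) (mul_mem (mul_mem h3m hξ) hh), by
      rw [eX, hpm]; ring⟩
  have a3 : CongrMod (p : ℚ_[p]) (1 / 4 - m + 3 * X / 2) (((0 : ℕ) : ℚ_[p]) + 1) :=
    ⟨-(1 / 4) + 3 * ξ * (1 / 2), add_mem (neg_mem hq) (mul_mem (mul_mem h3m hξ) hh), by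
      rw [eX, hpm]; push_cast; ring⟩
  have a4 : CongrMod (p : ℚ_[p]) (5 / 4 + X / 2) (((m + 1 : ℕ) : ℚ_[p]) + 1) :=
    ⟨-(1 / 4) + ξ * (1 / 2), add_mem (neg_mem hq) (mul_mem hξ hh), by
      rw [eX, hpm]; push_cast; ring⟩
  have a5 : CongrMod (p : ℚ_[p]) (1 / 2 - (2 * m + 1) + 2 * X) (((0 : ℕ) : ℚ_[p]) + 1) :=
    ⟨-(1 / 2) + 2 * ξ, add_mem (neg_mem hh) (mul_mem h2m hξ), by
      rw [eX, hpm]; push_cast; ring⟩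
  have r1 := rising_congrMod a1 (a1.mem_left hP b1) b1 (2 * m)
  have r2 := rising_congrMod a2 (a2.mem_left hP b2) b2 m
  have r3 := rising_congrMod a3 (a3.mem_left hP b3) b3 m
  have r4 := rising_congrMod a4 (a4.mem_left hP b4) b4 (2 * m + 1)
  have r5 := rising_congrMod a5 (a5.mem_left hP b3) b3 (2 * m + 1)
  constructor
  · refine (r1.mul (r2.mul r3 (rising_mem (a2.mem_left hP b2) _) (rising_mem b3 _))
      (rising_mem (a1.mem_left hP b1) _) (mul_mem (rising_mem b2 _) (rising_mem b3 _))).trans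
      (.of_eq ?_)
    have e3 := rising_natCast_add_one (K := ℚ_[p]) 0 m
    rw [Nat.factorial_zero, Nat.cast_one, mul_one, zero_add] at e3
    rw [e3, rising_neg_natCast_eq_choose, rising_neg_natCast_eq_choose, Nat.choose_self,
      Nat.choose_self, Even.neg_one_pow (by simp)]
    simp
  · have e3 := rising_natCast_add_one (K := ℚ_[p]) 0 (2 * m + 1)
    rw [Nat.factorial_zero, Nat.cast_one, mul_one, zero_add] at e3
    rw [← e3]
    exact r4.mul r5 (rising_mem (a4.mem_left hP b4) _) (rising_mem b3 _)

theorem norm_dixonCofactorResidue_denominator {m : ℕ} (hm : p = 4 * m + 3) :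
    ‖rising (((m + 1 : ℕ) : ℚ_[p]) + 1) (2 * m + 1) * ((2 * m + 1).factorial : ℚ_[p])‖ = 1 := by
  have h := congrArg norm (rising_natCast_add_one (K := ℚ_[p]) (m + 1) (2 * m + 1))
  rw [norm_mul, norm_factorial_eq_one (show m + 1 < p by omega),
    norm_factorial_eq_one (show m + 1 + (2 * m + 1) < p by omega), mul_one] at h
  rw [norm_mul, h, norm_factorial_eq_one (show 2 * m + 1 < p by omega), one_mul]

theorem dixonCofactor_residue (h3 : 3 < p) {m : ℕ} (hm : p = 4 * m + 3) :
    CongrMod (p : ℚ_[p]) (dixonCofactor ℚ_[p] m 0) (dixonCofactorResidue ℚ_[p] m) := by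
  obtain ⟨h1, h2⟩ := dixonCofactor_congrMod h3 hm (.refl _ 0)
  have hn := norm_dixonCofactorResidue_denominator hm
  have hmem : ((2 * m).factorial * ((-1) ^ m * m.factorial * m.factorial) : ℚ_[p])
      ∈ PadicInt.subring p :=
    mul_mem (natCast_mem_subring _) (mul_mem (mul_mem (pow_mem (neg_mem (one_mem _)) m)
      (natCast_mem_subring _)) (natCast_mem_subring _))
  exact h1.div h2 (h1.mem_left (natCast_mem_subring p) hmem) (norm_eq_one_of_congrMod h2 hn) hn

/-- Each parameter moves by a multiple of `p^2`, and the denominators are units at both points. -/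
theorem dixonCofactor_sq_congrMod (h3 : 3 < p) {m : ℕ} (hm : p = 4 * m + 3) :
    CongrMod ((p : ℚ_[p]) ^ 2) (dixonCofactor ℚ_[p] m ((p : ℚ_[p]) ^ 2))
      (dixonCofactor ℚ_[p] m 0) := by
  have hP := natCast_mem_subring (p := p) p
  have hX : CongrMod (p : ℚ_[p]) ((p : ℚ_[p]) ^ 2) 0 := ⟨p, hP, by ring⟩
  obtain ⟨h1, h2⟩ := dixonCofactor_congrMod h3 hm hX
  obtain ⟨_, h4⟩ := dixonCofactor_congrMod h3 hm (.refl _ 0)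
  have hn := norm_dixonCofactorResidue_denominator hm
  have hmem : ((2 * m).factorial * ((-1) ^ m * m.factorial * m.factorial) : ℚ_[p])
      ∈ PadicInt.subring p :=
    mul_mem (natCast_mem_subring _) (mul_mem (mul_mem (pow_mem (neg_mem (one_mem _)) m)
      (natCast_mem_subring _)) (natCast_mem_subring _))
  have hh := half_mem h3
  have hq := quarter_mem h3
  have h2m : (2 : ℚ_[p]) ∈ PadicInt.subring p := mem_of_norm_eq_one (norm_two_eq_one h3)
  have h3m : (3 : ℚ_[p]) ∈ PadicInt.subring p := by exact_mod_cast natCast_mem_subring (p := p) 3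
  have shift : ∀ {a y : ℚ_[p]} (_ : a ∈ PadicInt.subring p) (_ : y ∈ PadicInt.subring p) (k : ℕ),
      CongrMod ((p : ℚ_[p]) ^ 2) (rising (a + (p : ℚ_[p]) ^ 2 * y) k) (rising a k) := fun ha hy k =>
    rising_congrMod ⟨_, hy, by ring⟩ (add_mem ha (mul_mem (pow_mem hP 2) hy)) ha k
  have m1 : (3 / 2 : ℚ_[p]) ∈ PadicInt.subring p := by
    rw [show (3 / 2 : ℚ_[p]) = 3 * (1 / 2) by ring]; exact mul_mem h3m hh
  have m2 : (1 / 4 - (2 * m + 1) : ℚ_[p]) ∈ PadicInt.subring p :=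
    sub_mem hq (add_mem (mul_mem h2m (natCast_mem_subring m)) (one_mem _))
  have m3 : (1 / 4 - m : ℚ_[p]) ∈ PadicInt.subring p := sub_mem hq (natCast_mem_subring m)
  have m4 : (5 / 4 : ℚ_[p]) ∈ PadicInt.subring p := by
    rw [show (5 / 4 : ℚ_[p]) = 1 + 1 / 4 by norm_num]; exact add_mem (one_mem _) hq
  have m5 : (1 / 2 - (2 * m + 1) : ℚ_[p]) ∈ PadicInt.subring p :=
    sub_mem hh (add_mem (mul_mem h2m (natCast_mem_subring m)) (one_mem _))
  have hN : CongrMod ((p : ℚ_[p]) ^ 2) _ _ := (shift m1 (one_mem _) (2 * m)).mul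
    ((shift m2 m1 m).mul (shift m3 m1 m)
      (rising_mem (add_mem m2 (mul_mem (pow_mem hP 2) m1)) m) (rising_mem m3 m))
    (rising_mem (add_mem m1 (mul_mem (pow_mem hP 2) (one_mem _))) _)
    (mul_mem (rising_mem m2 m) (rising_mem m3 m))
  have hD : CongrMod ((p : ℚ_[p]) ^ 2) _ _ := (shift m4 hh (2 * m + 1)).mul
    (shift m5 h2m (2 * m + 1))
    (rising_mem (add_mem m4 (mul_mem (pow_mem hP 2) hh)) _) (rising_mem m5 _)
  have e1 : (3 / 2 + (p : ℚ_[p]) ^ 2) = 3 / 2 + (p : ℚ_[p]) ^ 2 * 1 := by ring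
  have e2 : (1 / 4 - (2 * m + 1) + 3 * (p : ℚ_[p]) ^ 2 / 2)
    = 1 / 4 - (2 * m + 1) + (p : ℚ_[p]) ^ 2 * (3 / 2) := by ring
  have e3 : (1 / 4 - m + 3 * (p : ℚ_[p]) ^ 2 / 2)
    = 1 / 4 - m + (p : ℚ_[p]) ^ 2 * (3 / 2) := by ring
  have e4 : (5 / 4 + (p : ℚ_[p]) ^ 2 / 2) = 5 / 4 + (p : ℚ_[p]) ^ 2 * (1 / 2) := by ring
  have e5 : (1 / 2 - (2 * m + 1) + 2 * (p : ℚ_[p]) ^ 2)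
    = 1 / 2 - (2 * m + 1) + (p : ℚ_[p]) ^ 2 * 2 := by ring
  have n1 := norm_eq_one_of_congrMod h2 hn
  have n2 := norm_eq_one_of_congrMod h4 hn
  have hmN := h1.mem_left hP hmem
  rw [e1, e2, e3] at hmN
  rw [e4, e5] at n1
  simp only [mul_zero, zero_div, add_zero] at n2
  unfold dixonCofactor
  rw [e1, e2, e3, e4, e5]
  simp only [mul_zero, zero_div, add_zero]
  exact hN.div hD hmN n1 n2

/-- After clearing `(3m+2)! (2m+1)`, this combines `2(m+1) ≡ -(2m+1)` with Wilson's congruence in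
the form `(-1)^m (3m+2)! m! ≡ -1`. -/
theorem two_mul_residue_congrMod {m : ℕ} (hm : p = 4 * m + 3) :
    CongrMod (p : ℚ_[p]) (2 * dixonCofactorResidue ℚ_[p] m) ((m.factorial : ℚ_[p]) ^ 4) := by
  have hpm : (p : ℚ_[p]) = 4 * m + 3 := by exact_mod_cast congrArg (Nat.cast : ℕ → ℚ_[p]) hm
  have nA := norm_factorial_eq_one (p := p) (k := 3 * m + 2) (by omega)
  have nB := norm_natCast_eq_one (p := p) (j := 2 * m + 1) (by omega) (by omega)
  have hr := rising_natCast_add_one (K := ℚ_[p]) (m + 1) (2 * m + 1)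
  rw [show m + 1 + (2 * m + 1) = 3 * m + 2 by ring] at hr
  have hd := norm_dixonCofactorResidue_denominator hm
  have e : ((3 * m + 2).factorial : ℚ_[p]) * ((2 * m + 1 : ℕ) : ℚ_[p]) *
      (2 * dixonCofactorResidue ℚ_[p] m)
      = 2 * (-1) ^ m * (m.factorial : ℚ_[p]) ^ 3 * (m + 1) := by
    have hd0 := ne_zero_of_norm_eq_one hd
    rw [dixonCofactorResidue, ← hr]
    have hr0 := left_ne_zero_of_mul hd0
    generalize rising (((m + 1 : ℕ) : ℚ_[p]) + 1) (2 * m + 1) = ρ at *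
    have h1 : ((2 * m).factorial : ℚ_[p]) ≠ 0 := by exact_mod_cast (2 * m).factorial_ne_zero
    have h2 : ((m : ℚ_[p]) * 2 + 1) ≠ 0 := by
      rw [mul_comm]
      exact_mod_cast (2 * m).succ_ne_zero
    rw [Nat.factorial_succ (2 * m), Nat.factorial_succ m]
    push_cast
    field_simp
  have hW := (factorial_pred_split (p := p) (show 3 * m + 2 + m + 1 = p by omega)).of_sq
  have hW2 := hW.symm.trans wilson_congrMod
  refine .of_mul_unit (d := ((3 * m + 2).factorial : ℚ_[p]) * ((2 * m + 1 : ℕ) : ℚ_[p]))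
    (by rw [norm_mul, nA, nB, one_mul]) ?_
  rw [e]
  obtain ⟨z, hz, ez⟩ := hW2
  have hs : ((-1) ^ m : ℚ_[p]) * (-1) ^ m = 1 := by rw [← mul_pow]; simp
  have hH := fieldHarmonic_mem (p := p) 1 (show m < p by omega)
  set H := fieldHarmonic ℚ_[p] 1 m
  set s := ((-1) ^ m : ℚ_[p])
  set A := ((3 * m + 2).factorial : ℚ_[p])
  set B := (m.factorial : ℚ_[p])
  have hs_mem : s ∈ PadicInt.subring p := pow_mem (neg_mem (one_mem _)) m
  have hA : A ∈ PadicInt.subring p := natCast_mem_subring _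
  have hB : B ∈ PadicInt.subring p := natCast_mem_subring _
  have hC : (2 * m + 1 : ℚ_[p]) ∈ PadicInt.subring p := by
    exact_mod_cast natCast_mem_subring (p := p) (2 * m + 1)
  refine ⟨s * B ^ 3 - B ^ 3 * (2 * m + 1) * (s * z) - B ^ 3 * (2 * m + 1) * (A * B * H),
    sub_mem (sub_mem (mul_mem hs_mem (pow_mem hB 3))
      (mul_mem (mul_mem (pow_mem hB 3) hC) (mul_mem hs_mem hz)))
      (mul_mem (mul_mem (pow_mem hB 3) hC) (mul_mem (mul_mem hA hB) hH)), ?_⟩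
  push_cast
  rw [hpm] at ez ⊢
  linear_combination (-(B ^ 3 * (2 * m + 1) * s)) * ez
    + B ^ 3 * (2 * m + 1) * A * B * (1 - (4 * m + 3) * H) * hs

theorem gamma_congrMod_factorial (h3 : 3 < p) {m : ℕ} (hm : p = 4 * m + 3) :
    CongrMod (p : ℚ_[p]) ((padicGamma p (padicQuarter p h3) : ℚ_[p]) ^ 4)
      ((m.factorial : ℚ_[p]) ^ 4) := by
  have hG := padicGamma_quarter_congrMod h3 (m := (3 * m + 2) * p + (m + 1)) (by
    rw [hm]; ring)
  have hGm : ∀ z : ℤ_[p], (z : ℚ_[p]) ∈ PadicInt.subring p := fun z => z.2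
  have hG4 := ((hG.pow (hGm _) (intCast_mem _ _) 4).trans (moritaSeq_pow_four_congrMod
    (show p = 2 * (2 * m + 1) + 1 by omega) (3 * m + 2) (R := m) (by omega))).of_sq
  have hH := fieldHarmonic_mem (p := p) 1 (show m < p by omega)
  have hf := natCast_mem_subring (p := p) m.factorial
  have hW : CongrMod (p : ℚ_[p]) (((p - 1).factorial : ℚ_[p]) ^ (3 * m + 2)) ((-1) ^ (3 * m + 2)) :=
    wilson_congrMod.pow (natCast_mem_subring _) (neg_mem (one_mem _)) _
  have hR : CongrMod (p : ℚ_[p]) ((m.factorial : ℚ_[p]) * (1 + (p : ℚ_[p]) *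
      (((3 * m + 2 : ℕ) : ℚ_[p]) * fieldHarmonic ℚ_[p] 1 m))) (m.factorial : ℚ_[p]) :=
    ⟨m.factorial * (((3 * m + 2 : ℕ) : ℚ_[p]) * fieldHarmonic ℚ_[p] 1 m),
      mul_mem hf (mul_mem (natCast_mem_subring _) hH), by ring⟩
  have hs : ((-1) ^ (3 * m + 2) : ℚ_[p]) ∈ PadicInt.subring p := pow_mem (neg_mem (one_mem _)) _
  have hWm : (((p - 1).factorial : ℚ_[p]) ^ (3 * m + 2)) ∈ PadicInt.subring p :=
    pow_mem (natCast_mem_subring _) _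
  have h := (hW.mul hR hWm hf).pow
    (mul_mem hWm (hR.mem_left (natCast_mem_subring p) hf)) (mul_mem hs hf) 4
  refine hG4.trans (h.trans (.of_eq ?_))
  rw [mul_pow, ← pow_mul, mul_comm _ 4, pow_mul]
  norm_num

theorem legendreSum_harmonic_one_odd_congrMod (h3 : 3 < p) {m : ℕ} (hm : p = 4 * m + 3) :
    CongrMod ((p : ℚ_[p]) ^ 2) (legendreSum ℚ_[p] (fieldHarmonic ℚ_[p] 1) (2 * m + 1))
      (-((p : ℚ_[p]) / 12) * (padicGamma p (padicQuarter p h3) : ℚ_[p]) ^ 4) := by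
  have hpm : (p : ℚ_[p]) = 4 * m + 3 := by exact_mod_cast congrArg (Nat.cast : ℕ → ℚ_[p]) hm
  have hp0 : (p : ℚ_[p]) ^ 2 ≠ 0 := pow_ne_zero 2 (by exact_mod_cast (by omega : p ≠ 0))
  have hP := natCast_mem_subring (p := p) p
  have hhalf := half_mem h3
  have hq := quarter_mem h3
  have h3m : (3 : ℚ_[p]) ∈ PadicInt.subring p := by exact_mod_cast natCast_mem_subring (p := p) 3
  have hD := dixon_difference_congrMod h3 (show p = 2 * (2 * m + 1) + 1 by omega) ⟨m, rfl⟩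
  have d1 := dixon_sum_eq_cofactor (K := ℚ_[p]) m (p ^ 2)
  have d0 := dixon_sum_eq_cofactor (K := ℚ_[p]) m 0
  rw [Nat.cast_pow] at d1
  rw [Nat.cast_zero, add_zero, sub_zero, ← hpm, mul_zero, zero_div, add_zero, add_zero] at d0
  rw [d1, d0, ← hpm] at hD
  have hres := dixonCofactor_residue h3 hm
  have hn := norm_dixonCofactorResidue_denominator hm
  have hres_mem : dixonCofactorResidue ℚ_[p] m ∈ PadicInt.subring p :=
    div_mem_of_norm_eq_one (mul_mem (natCast_mem_subring _) (mul_mem (mul_mem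
      (pow_mem (neg_mem (one_mem _)) m) (natCast_mem_subring _)) (natCast_mem_subring _))) hn
  have hR0 := hres.mem_left hP hres_mem
  have hRsq := dixonCofactor_sq_congrMod h3 hm
  set R0 := dixonCofactor ℚ_[p] m 0
  set R1 := dixonCofactor ℚ_[p] m ((p : ℚ_[p]) ^ 2)
  -- The two factors divisible by `p` have been divided by `p`. Since `(1/2 + p)(-1/4 + 3p/2) + 1/8
  -- = p/2 + 3p^2/2`, the constant terms cancel and a factor `p` survives.
  have e : CongrMod ((p : ℚ_[p]) ^ 2)
      ((1 / 2 + (p : ℚ_[p])) * (-(1 / 4) + (p : ℚ_[p]) * 3 * (1 / 2)) * R1 + 1 / 2 * (1 / 4) * R0) ((p : ℚ_[p]) * (1 / 2 * R0)) := by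
    have hcoef : (1 / 2 + (p : ℚ_[p])) * (-(1 / 4) + p * 3 * (1 / 2)) ∈ PadicInt.subring p :=
      mul_mem (add_mem hhalf hP) (add_mem (neg_mem hq) (mul_mem (mul_mem hP h3m) hhalf))
    refine ((hRsq.mul_left hcoef).add (.refl _ _)).trans
      ⟨3 * (1 / 2) * R0, mul_mem (mul_mem h3m hhalf) hR0, by ring⟩
  have hmain : CongrMod ((p : ℚ_[p]) ^ 2)
      (-3 * legendreSum ℚ_[p] (fieldHarmonic ℚ_[p] 1) (2 * m + 1)) ((p : ℚ_[p]) * (1 / 2 * R0)) := by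
    refine CongrMod.trans (.of_scale hp0 ?_) e
    rw [← sq]
    refine hD.symm.trans (.of_eq ?_)
    ring
  have hG : CongrMod (p : ℚ_[p]) (1 / 2 * R0)
      (1 / 4 * (padicGamma p (padicQuarter p h3) : ℚ_[p]) ^ 4) := by
    have h := ((two_mul_residue_congrMod hm).trans (gamma_congrMod_factorial h3 hm).symm).mul_left hq
    have h2m : (2 : ℚ_[p]) ∈ PadicInt.subring p := mem_of_norm_eq_one (norm_two_eq_one h3)
    have h' := (hres.mul_left h2m).mul_left hq
    exact (CongrMod.of_eq (by ring)).trans (h'.trans h)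
  have h3n : ‖(-3 : ℚ_[p])‖ = 1 := by
    rw [norm_neg]
    exact_mod_cast norm_natCast_eq_one (p := p) (j := 3) (by omega) h3
  refine CongrMod.of_mul_unit h3n ((hmain.trans hG.scale_p).trans (.of_eq ?_))
  ring

end OddHalf

/-! ### The four congruences -/

theorem mainTheorem2 (p : ℕ) [Fact p.Prime] (h3 : 3 < p) :
    (p % 4 = 1 →
      PadicCongr p 2
        ((∑ k ∈ Finset.Icc 1 (p - 1),
          ((2 * k).choose k : ℚ) ^ 3 * genHarmonic 1 k / 64 ^ k : ℚ) : ℚ_[p])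
        ((padicGamma p (padicQuarter p h3) : ℚ_[p]) ^ 4 *
          ((2 * fermatQuotient p 2 - p * fermatQuotient p 2 ^ 2 : ℚ) : ℚ_[p]))) ∧
    (p % 4 = 3 →
      PadicCongr p 2
        ((∑ k ∈ Finset.Icc 1 (p - 1),
          ((2 * k).choose k : ℚ) ^ 3 * genHarmonic 1 k / 64 ^ k : ℚ) : ℚ_[p])
        (-((p : ℚ_[p]) / 12) * (padicGamma p (padicQuarter p h3) : ℚ_[p]) ^ 4)) ∧
    (p % 4 = 1 →
      PadicCongr p 2
        ((∑ k ∈ Finset.Icc 1 (p - 1),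
          ((2 * k).choose k : ℚ) ^ 3 * genHarmonic 2 k / 64 ^ k : ℚ) : ℚ_[p])
        (-(padicGamma p (padicQuarter p h3) : ℚ_[p]) ^ 4 *
          ((4 * eulerNumber (p - 3) - 2 * eulerNumber (2 * p - 4) : ℤ) : ℚ_[p]))) ∧
    (p % 4 = 3 →
      PadicCongr p 2
        ((∑ k ∈ Finset.Icc 1 (p - 1),
          ((2 * k).choose k : ℚ) ^ 3 * genHarmonic 2 k / 64 ^ k : ℚ) : ℚ_[p])
        (-(1 / 4) * (padicGamma p (padicQuarter p h3) : ℚ_[p]) ^ 4)) := by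
  simp only [padicCongr_iff]
  have hcentral : ∀ m < p, centralRatio ℚ_[p] m ^ 2 ∈ PadicInt.subring p := fun m hm =>
    pow_mem (div_mem_of_norm_eq_one (rising_mem (half_mem h3) m) (norm_factorial_eq_one hm)) 2
  refine ⟨fun h => ?_, fun h => ?_, fun h => ?_, fun h => ?_⟩
  · obtain ⟨m, hm⟩ : ∃ m, p = 4 * m + 1 := ⟨p / 4, by omega⟩
    have hn : p = 2 * (2 * m) + 1 := by omega
    refine (binomialSum_congrMod h3 hn 1).trans ?_
    rw [legendreSum_harmonic_one_even]
    have hq := fermatQuotient_mem (p := p) h3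
    have h2m : (2 : ℚ_[p]) ∈ PadicInt.subring p := mem_of_norm_eq_one (norm_two_eq_one h3)
    refine ((centralRatio_sq_congrMod_gamma h3 hm).mul (fieldHarmonic_half h3 hn)
      (hcentral m (by omega)) (add_mem (mul_mem (neg_mem h2m) hq)
        (mul_mem (natCast_mem_subring p) (pow_mem hq 2)))).trans (.of_eq ?_)
    push_cast
    ring
  · obtain ⟨m, hm⟩ : ∃ m, p = 4 * m + 3 := ⟨p / 4, by omega⟩
    exact (binomialSum_congrMod h3 (show p = 2 * (2 * m + 1) + 1 by omega) 1).trans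
      (legendreSum_harmonic_one_odd_congrMod h3 hm)
  · obtain ⟨m, hm⟩ : ∃ m, p = 4 * m + 1 := ⟨p / 4, by omega⟩
    have hn : p = 2 * (2 * m) + 1 := by omega
    refine (binomialSum_congrMod h3 hn 2).trans ?_
    rw [legendreSum_harmonic_two_even]
    exact (centralRatio_sq_congrMod_gamma h3 hm).mul
      (alternating_inv_sq_congrMod h3 hn (even_two_mul m)) (hcentral m (by omega))
      (intCast_mem _ _)
  · obtain ⟨m, hm⟩ : ∃ m, p = 4 * m + 3 := ⟨p / 4, by omega⟩
    refine (binomialSum_congrMod h3 (show p = 2 * (2 * m + 1) + 1 by omega) 2).trans ?_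
    rw [legendreSum_harmonic_two_odd]
    refine .trans (.of_eq ?_)
      ((odd_ratio_sq_congrMod_gamma h3 hm).mul_left (neg_mem (quarter_mem h3)))
    ring
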